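/- Let $S$ be a scheme, $G$ a smooth group scheme over $S$ and $X$ a smooth $S$-scheme. **Combinatorial forms.** Points $x_0,\dots,x_n\in X(T)$ of $X$ with values in an $S$-scheme $T$ are called *infinitesimally close* if they have the same underlying map of topological spaces and if, wherever they are described by homomorphisms of rings $x_i:B\to C$ (for an affine open $\operatorname{Spec}B\subset X$ and a morphism $\operatorname{Spec}C\to T$), one has $$(x_i(b)-x_j(b))\,(x_i(b')-x_j(b'))=0,\qquad (x_i(b)-x_0(b))\,(x_j(b)-x_0(b))=0$$ for all $i,j$ and all $b,b'\in B$. These tuples are the $T$-valued points of $\Delta^n_{X/S}$. For a presheaf of groups $F$ on $S$-schemes, a *combinatorial $F$-valued $n$-form* on $X$ is a morphism of presheaves $f:\Delta^n_{X/S}\to F$ with $f(x_0,\dots,x_n)=1$ whenever $x_i=x_{i+1}$ for some $i$. Let $\operatorname{Aut}(G)$ be the presheaf $T\mapsto\operatorname{Aut}_{T\text{-gr}}(G_T)$. For a combinatorial $G$-valued 2-form $\varphi$ and a combinatorial $\operatorname{Aut}(G)$-valued 1-form $\chi$ put $$\delta^2_\chi(\varphi)(x,y,z,u)=\chi(x,y)\big(\varphi(y,z,u)\big)\;\varphi(x,y,u)\;\varphi(x,u,z)\;\varphi(x,z,y).$$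 **Classical forms.** For $F=G$ or $F=\operatorname{Aut}(G)$ and a ring $C$ with a morphism $\operatorname{Spec}C\to S$, let $\operatorname{Lie}(F)(C)=\ker\big(F(C[\varepsilon])\to F(C)\big)$, where $\varepsilon^2=0$; this is a $C$-module. For $Y\in\operatorname{Lie}(F)(C)$ and an element $s$ of square zero in a $C$-algebra $C'$, let $Y(s)\in F(C')$ be the image of $Y$ under $\varepsilon\mapsto s$. Let $\operatorname{Spec}R\subset S$ and $\operatorname{Spec}B\subset X$ be affine open subschemes, the second lying over the first. For $n\ge 1$, a form $v\in\operatorname{Lie}(F)(B)\otimes_B\Omega^n_{B/R}$ is said to *represent* a combinatorial $n$-form $f$ on $\operatorname{Spec}B$ if, for all infinitesimally close homomorphisms of $R$-algebras $x_0,\dots,x_n:B\to C$, the element $f(x_0,\dots,x_n)\in F(C)$ is the value of $v$ at $(x_0,\dots,x_n)$: this value is additive in $v$, and for $v=Y\otimes c\,db_1\wedge\dots\wedge db_n$ it is $$(x_0Y)\Big(x_0(c)\prod_{i=1}^n\big(x_i(b_i)-x_0(b_i)\big)\Big),$$ with $x_0Y$ the image of $Y$ in $\operatorname{Lie}(F)(C)$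 under $x_0$. Forms in $\operatorname{Lie}(G)(R)\otimes_R\Omega^n_{B/R}$ are regarded as forms in $\operatorname{Lie}(G)(B)\otimes_B\Omega^n_{B/R}$ through $R\to B$. The classical differential is $d(Y\otimes\omega)=Y\otimes d\omega$ on $\operatorname{Lie}(G)(R)\otimes_R\Omega^2_{B/R}$. The pairing $[\,,\,]:\operatorname{Lie}(\operatorname{Aut}G)(B)\times\operatorname{Lie}(G)(B)\to\operatorname{Lie}(G)(B)$ is characterized by $$[Y,Z](\varepsilon_0\varepsilon_1)=Y(\varepsilon_0)\big(Z(\varepsilon_1)\big)\cdot Z(\varepsilon_1)^{-1}\in G(B[\varepsilon_0,\varepsilon_1]),\qquad \varepsilon_0^2=\varepsilon_1^2=0,$$ and it is extended to forms by $[Y\otimes\eta,Z\otimes\omega]=[Y,Z]\otimes(\eta\wedge\omega)$. **Theorem.** Let $\varphi$ be a combinatorial $G$-valued 2-form and $\chi$ a combinatorial $\operatorname{Aut}(G)$-valued 1-form on $X$. Then $\delta^2_\chi(\varphi)$ is a combinatorial $G$-valued 3-form on $X$, and $$\delta^2_\chi(\varphi)=d\varphi+[\chi,\varphi].$$ That is: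 1. Every point of $X$ lies in an affine open $\operatorname{Spec}B$ over an affine open $\operatorname{Spec}R\subset S$ on which $\varphi$ is represented by a unique form in $\operatorname{Lie}(G)(R)\otimes_R\Omega^2_{B/R}$, $\chi$ by a unique form in $\operatorname{Lie}(\operatorname{Aut}G)(B)\otimes_B\Omega^1_{B/R}$, and $\delta^2_\chi(\varphi)$ by a unique form in $\operatorname{Lie}(G)(B)\otimes_B\Omega^3_{B/R}$. 2. For all affine open $\operatorname{Spec}B\subset X$ over affine open $\operatorname{Spec}R\subset S$: if $w\in\operatorname{Lie}(G)(R)\otimes_R\Omega^2_{B/R}$ represents $\varphi$ and $t\in\operatorname{Lie}(\operatorname{Aut}G)(B)\otimes_B\Omega^1_{B/R}$ represents $\chi$ on $\operatorname{Spec}B$, then $dw+[t,w]$ represents $\delta^2_\chi(\varphi)$ on $\operatorname{Spec}B$. -/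

import Mathlib

open CategoryTheory AlgebraicGeometry Limits Opposite TensorProduct

universe u v

set_option linter.unusedSectionVars false

noncomputable section

namespace CombForms

/-! ### Square zero extensions -/

/-- The ring `D_C(M) = C ⊕ M ε` with `ε ^ 2 = 0`. -/
@[ext]
structure DualRing (C M : Type u) : Type u where
  fst : C
  snd : M

namespace DualRing

variable {C M N : Type u} [CommRing C] [AddCommGroup M] [Module C M] [AddCommGroup N] [Module C N]

instance : Zero (DualRing C M) := ⟨⟨0, 0⟩⟩
instance : One (DualRing C M) := ⟨⟨1, 0⟩⟩
instance : Add (DualRing C M) := ⟨fun x y => ⟨x.fst + y.fst, x.snd + y.snd⟩⟩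
instance : Neg (DualRing C M) := ⟨fun x => ⟨-x.fst, -x.snd⟩⟩
instance : Mul (DualRing C M) := ⟨fun x y => ⟨x.fst * y.fst, x.fst • y.snd + y.fst • x.snd⟩⟩

@[simp] lemma fst_zero : (0 : DualRing C M).fst = 0 := rfl
@[simp] lemma snd_zero : (0 : DualRing C M).snd = 0 := rfl
@[simp] lemma fst_one : (1 : DualRing C M).fst = 1 := rfl
@[simp] lemma snd_one : (1 : DualRing C M).snd = 0 := rfl
@[simp] lemma fst_add (x y : DualRing C M) : (x + y).fst = x.fst + y.fst := rfl
@[simp] lemma snd_add (x y : DualRing C M) : (x + y).snd = x.snd + y.snd := rfl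
@[simp] lemma fst_neg (x : DualRing C M) : (-x).fst = -x.fst := rfl
@[simp] lemma snd_neg (x : DualRing C M) : (-x).snd = -x.snd := rfl
@[simp] lemma fst_mul (x y : DualRing C M) : (x * y).fst = x.fst * y.fst := rfl
@[simp] lemma snd_mul (x y : DualRing C M) :
    (x * y).snd = x.fst • y.snd + y.fst • x.snd := rfl

instance : CommRing (DualRing C M) where
  add_assoc x y z := by ext <;> simp [add_assoc]
  zero_add x := by ext <;> simp
  add_zero x := by ext <;> simp
  add_comm x y := by ext <;> simp [add_comm]
  neg_add_cancel x := by ext <;> simp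
  nsmul := nsmulRec
  zsmul := zsmulRec
  left_distrib x y z := by
    ext
    · simp [mul_add]
    · simp only [snd_mul, snd_add, fst_add]; module
  right_distrib x y z := by
    ext
    · simp [add_mul]
    · simp only [snd_mul, snd_add, fst_add]; module
  zero_mul x := by ext <;> simp
  mul_zero x := by ext <;> simp
  mul_assoc x y z := by
    ext
    · simp [mul_assoc]
    · simp only [snd_mul, fst_mul]; module
  one_mul x := by ext <;> simp
  mul_one x := by ext <;> simp
  mul_comm x y := by
    ext
    · simp [mul_comm]
    · simp only [snd_mul]; module

/-- The inclusion `C → D_C(M)`. -/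
def inlRingHom (C M : Type u) [CommRing C] [AddCommGroup M] [Module C M] : C →+* DualRing C M where
  toFun c := ⟨c, 0⟩
  map_zero' := rfl
  map_one' := rfl
  map_add' x y := by ext <;> simp
  map_mul' x y := by ext <;> simp

variable {R : Type u} [CommRing R] [Algebra R C]

instance : Algebra R (DualRing C M) := ((inlRingHom C M).comp (algebraMap R C)).toAlgebra

lemma algebraMap_eq (r : R) : algebraMap R (DualRing C M) r = ⟨algebraMap R C r, 0⟩ := rfl

/-- The inclusion `C → D_C(M)`, as a homomorphism of `R`-algebras. -/
def inl (R C M : Type u) [CommRing R] [CommRing C] [Algebra R C] [AddCommGroup M] [Module C M] :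
    C →ₐ[R] DualRing C M where
  __ := inlRingHom C M
  commutes' _ := rfl

@[simp] lemma fst_inl (c : C) : (inl R C M c).fst = c := rfl
@[simp] lemma snd_inl (c : C) : (inl R C M c).snd = 0 := rfl

/-- The augmentation `D_C(M) → C`. -/
def aug (R C M : Type u) [CommRing R] [CommRing C] [Algebra R C] [AddCommGroup M] [Module C M] :
    DualRing C M →ₐ[R] C where
  toFun x := x.fst
  map_zero' := rfl
  map_one' := rfl
  map_add' _ _ := rfl
  map_mul' _ _ := rfl
  commutes' _ := rfl

@[simp] lemma aug_apply (x : DualRing C M) : aug R C M x = x.fst := rfl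

/-- A homomorphism out of `D_C(M)` is given by a homomorphism out of `C` and a compatible additive
map out of `M` whose values have pairwise products zero. -/
def lift {A : Type u} [CommRing A] [Algebra R A] (f : C →ₐ[R] A) (g : M →+ A)
    (hsmul : ∀ c m, g (c • m) = f c * g m) (hmul : ∀ m m', g m * g m' = 0) :
    DualRing C M →ₐ[R] A where
  toFun x := f x.fst + g x.snd
  map_zero' := by simp
  map_one' := by simp
  map_add' x y := by simp only [fst_add, snd_add, map_add]; ring
  map_mul' x y := by
    simp only [fst_mul, snd_mul, map_add, map_mul, hsmul]
    linear_combination -hmul x.snd y.snd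
  commutes' r := by simp [algebraMap_eq]

@[simp] lemma lift_apply {A : Type u} [CommRing A] [Algebra R A] (f : C →ₐ[R] A) (g : M →+ A)
    (hsmul hmul) (x : DualRing C M) : lift f g hsmul hmul x = f x.fst + g x.snd := rfl

variable (R) in
/-- The functoriality of `D_C(M)` in the module `M`. -/
def mapMod (g : M →ₗ[C] N) : DualRing C M →ₐ[R] DualRing C N where
  toFun x := ⟨x.fst, g x.snd⟩
  map_zero' := by ext <;> simp
  map_one' := by ext <;> simp
  map_add' x y := by ext <;> simp
  map_mul' x y := by ext <;> simp
  commutes' r := by ext <;> simp [algebraMap_eq]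

@[simp] lemma fst_mapMod (g : M →ₗ[C] N) (x : DualRing C M) : (mapMod R g x).fst = x.fst := rfl
@[simp] lemma snd_mapMod (g : M →ₗ[C] N) (x : DualRing C M) : (mapMod R g x).snd = g x.snd := rfl

/-- The functoriality of the ring of dual numbers `C[ε]` in the ring `C`. -/
def mapRing {C' : Type u} [CommRing C'] [Algebra R C'] (f : C →ₐ[R] C') :
    DualRing C C →ₐ[R] DualRing C' C' where
  toFun x := ⟨f x.fst, f x.snd⟩
  map_zero' := by ext <;> simp
  map_one' := by ext <;> simp
  map_add' x y := by ext <;> simp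
  map_mul' x y := by ext <;> simp
  commutes' r := by ext <;> simp [algebraMap_eq]

@[simp] lemma fst_mapRing {C' : Type u} [CommRing C'] [Algebra R C'] (f : C →ₐ[R] C')
    (x : DualRing C C) : (mapRing f x).fst = f x.fst := rfl
@[simp] lemma snd_mapRing {C' : Type u} [CommRing C'] [Algebra R C'] (f : C →ₐ[R] C')
    (x : DualRing C C) : (mapRing f x).snd = f x.snd := rfl

end DualRing

/-! ### Presheaves of groups on the category of `S`-schemes, evaluated on affine schemes -/

section Presheaves

variable {S : Scheme.{u}} {R : Type u} [CommRing R]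

/-- The `S`-scheme `Spec C`, for an algebra `C` over a ring `R` with a morphism `Spec R ⟶ S`. -/
def specOver (σ : Spec (.of R) ⟶ S) (C : Type u) [CommRing C] [Algebra R C] : Over S :=
  Over.mk (Spec.map (CommRingCat.ofHom (algebraMap R C)) ≫ σ)

variable (σ : Spec (.of R) ⟶ S) {C C' C'' : Type u} [CommRing C] [Algebra R C] [CommRing C']
  [Algebra R C'] [CommRing C''] [Algebra R C'']

/-- The morphism of `S`-schemes attached to a homomorphism of `R`-algebras. -/
def specOverMap (f : C →ₐ[R] C') : specOver σ C' ⟶ specOver σ C :=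
  Over.homMk (Spec.map (CommRingCat.ofHom f.toRingHom)) (by
    simp only [specOver, Over.mk_left, Over.mk_hom, ← Category.assoc, ← Spec.map_comp,
      ← CommRingCat.ofHom_comp]
    congr 3
    exact f.comp_algebraMap)

lemma specOverMap_id : specOverMap σ (AlgHom.id R C) = 𝟙 _ := by
  ext1
  exact Spec.map_id _

lemma specOverMap_comp (f : C →ₐ[R] C') (g : C' →ₐ[R] C'') :
    specOverMap σ (g.comp f) = specOverMap σ g ≫ specOverMap σ f := by
  ext1
  exact Spec.map_comp (CommRingCat.ofHom f.toRingHom) (CommRingCat.ofHom g.toRingHom)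

variable (F : (Over S)ᵒᵖ ⥤ GrpCat.{v})

/-- The group `F(C)` of `C`-valued points of the presheaf of groups `F`. -/
abbrev Pts (C : Type u) [CommRing C] [Algebra R C] : Type v := F.obj (op (specOver σ C))

/-- The homomorphism `F(C) → F(C')` attached to a homomorphism `C → C'` of `R`-algebras. -/
def ptsMap (f : C →ₐ[R] C') : Pts σ F C →* Pts σ F C' := (F.map (specOverMap σ f).op).hom

lemma ptsMap_id (y : Pts σ F C) : ptsMap σ F (AlgHom.id R C) y = y := by
  simp [ptsMap, specOverMap_id]

lemma ptsMap_ptsMap (f : C →ₐ[R] C') (g : C' →ₐ[R] C'') (y : Pts σ F C) :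
    ptsMap σ F g (ptsMap σ F f y) = ptsMap σ F (g.comp f) y := by
  simp [ptsMap, specOverMap_comp]

/-- `F` is infinitesimally linear: for modules `M`, `N` over an affine `S`-scheme `Spec C`, a section
of `F` over `I(M × N) = I(M) ⨿_{Spec C} I(N)` is determined by its restrictions to
`I(M) = Spec D_C(M)` and `I(N) = Spec D_C(N)`. -/
class InfLinear (F : (Over S)ᵒᵖ ⥤ GrpCat.{v}) : Prop where
  ext : ∀ {R : Type u} [CommRing R] (σ : Spec (.of R) ⟶ S) {C M N : Type u} [CommRing C]
    [Algebra R C] [AddCommGroup M] [Module C M] [AddCommGroup N] [Module C N]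
    (y z : Pts σ F (DualRing C (M × N))),
    ptsMap σ F (DualRing.mapMod R (LinearMap.fst C M N)) y =
      ptsMap σ F (DualRing.mapMod R (LinearMap.fst C M N)) z →
    ptsMap σ F (DualRing.mapMod R (LinearMap.snd C M N)) y =
      ptsMap σ F (DualRing.mapMod R (LinearMap.snd C M N)) z → y = z

/-- `Lie(F, M)`, the kernel of `F(D_C(M)) → F(C)`; the group law of `F` is written additively. -/
def LieMod (C M : Type u) [CommRing C] [Algebra R C] [AddCommGroup M] [Module C M] : Type v :=
  Additive (ptsMap σ F (DualRing.aug R C M)).ker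

namespace LieMod

variable {σ F} {M N P : Type u} [AddCommGroup M] [Module C M] [AddCommGroup N] [Module C N]
  [AddCommGroup P] [Module C P]

instance : AddGroup (LieMod σ F C M) :=
  inferInstanceAs (AddGroup (Additive (ptsMap σ F (DualRing.aug R C M)).ker))

/-- The underlying section of `F` over `Spec D_C(M)`. -/
def val (y : LieMod σ F C M) : Pts σ F (DualRing C M) := (Additive.toMul y).1

/-- An element of `Lie(F, M)` from a section of `F` over `Spec D_C(M)` that is trivial
on `Spec C`. -/
def mk (y : Pts σ F (DualRing C M)) (hy : ptsMap σ F (DualRing.aug R C M) y = 1) :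
    LieMod σ F C M := Additive.ofMul ⟨y, hy⟩

lemma aug_val (y : LieMod σ F C M) : ptsMap σ F (DualRing.aug R C M) y.val = 1 :=
  (Additive.toMul y).2

@[simp] lemma val_mk (y : Pts σ F (DualRing C M)) (hy) : (mk y hy : LieMod σ F C M).val = y := rfl

@[ext] lemma ext {y z : LieMod σ F C M} (h : y.val = z.val) : y = z := Subtype.ext h

@[simp] lemma val_add (y z : LieMod σ F C M) : (y + z).val = y.val * z.val := rfl
@[simp] lemma val_zero : (0 : LieMod σ F C M).val = 1 := rfl
@[simp] lemma val_neg (y : LieMod σ F C M) : (-y).val = y.val⁻¹ := rfl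

/-- A homomorphism of algebras `D_C(M) → A` that kills `M` sends `Lie(F, M)` to `1`. -/
lemma map_val_eq_one (y : LieMod σ F C M) (g : DualRing C M →ₐ[R] C')
    (h : ∀ x, g x = g ⟨x.fst, 0⟩) : ptsMap σ F g y.val = 1 := by
  have : g = (g.comp (DualRing.inl R C M)).comp (DualRing.aug R C M) := by
    ext x; exact h x
  rw [this, ← ptsMap_ptsMap, aug_val, map_one]

/-- `Lie(F, M) → Lie(F, N)` attached to a linear map `M → N`. -/
def mapMod (g : M →ₗ[C] N) : LieMod σ F C M →+ LieMod σ F C N where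
  toFun y := mk (ptsMap σ F (DualRing.mapMod R g) y.val) (by
    rw [ptsMap_ptsMap]; exact y.aug_val)
  map_zero' := by ext; simp
  map_add' y z := by ext; simp

@[simp] lemma val_mapMod (g : M →ₗ[C] N) (y : LieMod σ F C M) :
    (mapMod g y).val = ptsMap σ F (DualRing.mapMod R g) y.val := rfl

lemma mapMod_congr {g h : M →ₗ[C] N} (e : g = h) (y : LieMod σ F C M) :
    mapMod g y = mapMod h y := by rw [e]

lemma mapMod_id (y : LieMod σ F C M) : mapMod LinearMap.id y = y := by
  ext
  exact ptsMap_id σ F _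

lemma mapMod_comp (g : M →ₗ[C] N) (h : N →ₗ[C] P) (y : LieMod σ F C M) :
    mapMod (h.comp g) y = mapMod h (mapMod g y) := by
  ext
  simp only [val_mapMod, ptsMap_ptsMap]
  rfl

lemma mapMod_zero (y : LieMod σ F C M) : mapMod (0 : M →ₗ[C] N) y = 0 := by
  ext
  exact map_val_eq_one _ _ fun x => by ext <;> simp

variable [InfLinear F]

lemma mapMod_inl_add_inr (y : LieMod σ F C M) (z : LieMod σ F C N)
    (w : LieMod σ F C (M × N)) (h1 : mapMod (LinearMap.fst C M N) w = y)
    (h2 : mapMod (LinearMap.snd C M N) w = z) :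
    w = mapMod (LinearMap.inl C M N) y + mapMod (LinearMap.inr C M N) z := by
  ext
  apply InfLinear.ext σ
  · change (mapMod (LinearMap.fst C M N) w).val = (mapMod (LinearMap.fst C M N) _).val
    rw [map_add, ← mapMod_comp, ← mapMod_comp, LinearMap.fst_comp_inl, LinearMap.fst_comp_inr,
      mapMod_id, mapMod_zero, add_zero, h1]
  · change (mapMod (LinearMap.snd C M N) w).val = (mapMod (LinearMap.snd C M N) _).val
    rw [map_add, ← mapMod_comp, ← mapMod_comp, LinearMap.snd_comp_inl, LinearMap.snd_comp_inr,
      mapMod_id, mapMod_zero, zero_add, h2]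

instance : AddCommGroup (LieMod σ F C M) where
  add_comm y z := by
    have key : mapMod (LinearMap.inr C M M) z + mapMod (LinearMap.inl C M M) y =
        mapMod (LinearMap.inl C M M) y + mapMod (LinearMap.inr C M M) z := by
      apply mapMod_inl_add_inr
      · rw [map_add, ← mapMod_comp, ← mapMod_comp, LinearMap.fst_comp_inl, LinearMap.fst_comp_inr,
          mapMod_id, mapMod_zero, zero_add]
      · rw [map_add, ← mapMod_comp, ← mapMod_comp, LinearMap.snd_comp_inl, LinearMap.snd_comp_inr,
          mapMod_id, mapMod_zero, add_zero]
    have := congrArg (mapMod (LinearMap.coprod LinearMap.id LinearMap.id)) key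
    rw [map_add, map_add, ← mapMod_comp, ← mapMod_comp, LinearMap.coprod_inl,
      LinearMap.coprod_inr, mapMod_id, mapMod_id] at this
    exact this.symm

lemma mapMod_add (g h : M →ₗ[C] N) (y : LieMod σ F C M) :
    mapMod (g + h) y = mapMod g y + mapMod h y := by
  have key := mapMod_inl_add_inr y y (mapMod (LinearMap.prod LinearMap.id LinearMap.id) y)
    (by rw [← mapMod_comp, LinearMap.fst_prod, mapMod_id])
    (by rw [← mapMod_comp, LinearMap.snd_prod, mapMod_id])
  have := congrArg (mapMod (LinearMap.coprod g h)) key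
  rw [map_add, ← mapMod_comp, ← mapMod_comp, ← mapMod_comp, LinearMap.coprod_inl,
      LinearMap.coprod_inr] at this
  rw [← this]
  congr 1

/-- `c` acts on `Lie(F, M)` through the endomorphism of `D_C(M)` given by the multiplication by `c`
on `M`. -/
instance : Module C (LieMod σ F C M) where
  smul c y := mapMod (c • LinearMap.id) y
  one_smul y := by
    change mapMod _ y = y
    rw [one_smul, mapMod_id]
  mul_smul c c' y := by
    change mapMod _ y = mapMod _ (mapMod _ y)
    rw [← mapMod_comp]
    refine mapMod_congr ?_ y
    ext; simp [mul_smul]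
  smul_zero c := map_zero _
  smul_add c y z := map_add _ _ _
  add_smul c c' y := by
    change mapMod _ y = mapMod _ y + mapMod _ y
    rw [add_smul, mapMod_add]
  zero_smul y := by
    change mapMod _ y = 0
    rw [zero_smul, mapMod_zero]

lemma smul_def (c : C) (y : LieMod σ F C M) : c • y = mapMod (c • LinearMap.id) y := rfl

variable (σ F C M) in
/-- The map `Lie(F)(C) ⊗ M → Lie(F, M)` which sends `Y ⊗ m` to the image of `Y` under the
homomorphism `C[ε] → D_C(M)` with `ε ↦ m`. -/
def ofTensor : LieMod σ F C C ⊗[C] M →ₗ[C] LieMod σ F C M :=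
  TensorProduct.lift <| LinearMap.mk₂ C
    (fun Y m => mapMod (LinearMap.toSpanSingleton C M m) Y)
    (fun Y Z m => map_add _ _ _)
    (fun c Y m => by
      rw [smul_def, smul_def, ← mapMod_comp, ← mapMod_comp]
      refine mapMod_congr ?_ _
      ext; simp)
    (fun Y m n => by
      rw [← mapMod_add]
      refine mapMod_congr ?_ _
      ext; simp)
    (fun c Y m => by
      rw [smul_def, ← mapMod_comp]
      refine mapMod_congr ?_ _
      ext; simp)

end LieMod

namespace LieMod

variable {σ F}

/-- The homomorphism `Lie(F)(C) → Lie(F)(C')` attached to a homomorphism of algebras `C → C'`. -/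
def mapRing (f : C →ₐ[R] C') : LieMod σ F C C →+ LieMod σ F C' C' where
  toFun y := mk (ptsMap σ F (DualRing.mapRing f) y.val) (by
    have h : (DualRing.aug R C' C').comp (DualRing.mapRing f) = f.comp (DualRing.aug R C C) := rfl
    rw [ptsMap_ptsMap, h, ← ptsMap_ptsMap, aug_val, map_one])
  map_zero' := by ext; simp
  map_add' y z := by ext; simp

@[simp] lemma val_mapRing (f : C →ₐ[R] C') (y : LieMod σ F C C) :
    (mapRing f y).val = ptsMap σ F (DualRing.mapRing f) y.val := rfl

lemma mapRing_smul [InfLinear F] (f : C →ₐ[R] C') (c : C) (y : LieMod σ F C C) :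
    mapRing f (c • y) = f c • mapRing f y := by
  ext
  simp only [smul_def, val_mapRing, val_mapMod, ptsMap_ptsMap]
  congr 2
  ext x <;> simp

end LieMod

/-! ### The presheaf of automorphisms of a presheaf of groups -/

/-- The sections over `T` of the presheaf `Aut(F)`: automorphisms of the restriction of the presheaf
of groups `F` to the category of `T`-schemes. -/
@[ext]
structure AutSection (F : (Over S)ᵒᵖ ⥤ GrpCat.{v}) (T : Over S) where
  app : ∀ T' : Over S, (T' ⟶ T) → (F.obj (op T') ≃* F.obj (op T'))
  naturality : ∀ {T' T'' : Over S} (f : T' ⟶ T) (g : T'' ⟶ T') (a : F.obj (op T')),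
    F.map g.op (app T' f a) = app T'' (g ≫ f) (F.map g.op a)

namespace AutSection

variable {F} {T : Over S}

instance : One (AutSection F T) := ⟨⟨fun _ _ => MulEquiv.refl _, fun _ _ _ => rfl⟩⟩

instance : Mul (AutSection F T) := ⟨fun s t => ⟨fun T' f => (t.app T' f).trans (s.app T' f), by
  intro T' T'' f g a
  simp only [MulEquiv.trans_apply, s.naturality, t.naturality]⟩⟩

instance : Inv (AutSection F T) := ⟨fun s => ⟨fun T' f => (s.app T' f).symm, by
  intro T' T'' f g a
  rw [MulEquiv.eq_symm_apply, ← s.naturality, MulEquiv.apply_symm_apply]⟩⟩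

lemma one_app (T' : Over S) (f : T' ⟶ T) (a : F.obj (op T')) :
    (1 : AutSection F T).app T' f a = a := rfl

lemma mul_app (s t : AutSection F T) (T' : Over S) (f : T' ⟶ T) (a : F.obj (op T')) :
    (s * t).app T' f a = s.app T' f (t.app T' f a) := rfl

instance : Group (AutSection F T) where
  mul_assoc _ _ _ := rfl
  one_mul _ := rfl
  mul_one _ := rfl
  inv_mul_cancel s := by
    ext T' f a
    exact (s.app T' f).symm_apply_apply a

/-- Restriction of an automorphism along a morphism `T₁ ⟶ T`. -/
def restrict {T₁ : Over S} (h : T₁ ⟶ T) : AutSection F T →* AutSection F T₁ where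
  toFun s := ⟨fun T' f => s.app T' (f ≫ h), by
    intro T' T'' f g a
    simp only [s.naturality, Category.assoc]⟩
  map_one' := rfl
  map_mul' _ _ := rfl

/-- The evaluation pairing `Aut(F) × F → F`. -/
def eval (s : AutSection F T) (a : F.obj (op T)) : F.obj (op T) := s.app T (𝟙 T) a

lemma map_eval {T₁ : Over S} (h : T₁ ⟶ T) (s : AutSection F T) (a : F.obj (op T)) :
    F.map h.op (s.eval a) = (restrict h s).eval (F.map h.op a) := by
  simp [eval, s.naturality, restrict]

end AutSection

/-- The presheaf of groups `Aut(F)`. -/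
def autPresheaf (F : (Over S)ᵒᵖ ⥤ GrpCat.{v}) : (Over S)ᵒᵖ ⥤ GrpCat.{max (u + 1) v} where
  obj T := GrpCat.of (AutSection F T.unop)
  map h := GrpCat.ofHom (AutSection.restrict h.unop)
  map_id T := by
    refine GrpCat.hom_ext (MonoidHom.ext fun s => AutSection.ext ?_)
    funext T' f
    simp [AutSection.restrict]
  map_comp g h := by
    refine GrpCat.hom_ext (MonoidHom.ext fun s => AutSection.ext ?_)
    funext T' f
    simp [AutSection.restrict]

/-- The map `{u, g} = u(g) g⁻¹` from `Aut(F) × F` to `F`. -/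
def autComm {F : (Over S)ᵒᵖ ⥤ GrpCat.{v}} {T : Over S} (s : (autPresheaf F).obj (op T))
    (a : F.obj (op T)) : F.obj (op T) :=
  AutSection.eval s a * a⁻¹

section Bracket

variable (R C) in
/-- The homomorphism `C[η] → C[ε₀, ε₁]` with `η ↦ ε₀ ε₁`. Here `C[ε₀, ε₁]` is the ring of dual
numbers (with generator `ε₁`) over the ring of dual numbers (with generator `ε₀`) over `C`. -/
def smashHom : DualRing C C →ₐ[R] DualRing (DualRing C C) (DualRing C C) where
  toFun x := ⟨⟨x.fst, 0⟩, ⟨0, x.snd⟩⟩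
  map_zero' := rfl
  map_one' := rfl
  map_add' x y := by ext <;> simp
  map_mul' x y := by ext <;> simp
  commutes' r := rfl

@[simp] lemma smashHom_apply (x : DualRing C C) :
    smashHom R C x = ⟨⟨x.fst, 0⟩, ⟨0, x.snd⟩⟩ := rfl

/-- `F` is good: a section of `F` over `Spec C[ε₀, ε₁]` that is trivial both on the locus `ε₁ = 0`
and on the locus `ε₀ = 0` descends uniquely along `Spec C[ε₀, ε₁] ⟶ Spec C[η]`,
where `η = ε₀ ε₁`. -/
class IsGood (F : (Over S)ᵒᵖ ⥤ GrpCat.{v}) : Prop where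
  existsUnique : ∀ {R : Type u} [CommRing R] (σ : Spec (.of R) ⟶ S) {C : Type u} [CommRing C]
    [Algebra R C] (w : Pts σ F (DualRing (DualRing C C) (DualRing C C))),
    ptsMap σ F (DualRing.aug R (DualRing C C) (DualRing C C)) w = 1 →
    ptsMap σ F (DualRing.mapRing (DualRing.aug R C C)) w = 1 →
    ∃! z : Pts σ F (DualRing C C), ptsMap σ F (smashHom R C) z = w

variable {F σ}

lemma ptsMap_eval (f : C →ₐ[R] C') (s : Pts σ (autPresheaf F) C) (a : Pts σ F C) :
    ptsMap σ F f (AutSection.eval s a) =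
      AutSection.eval (ptsMap σ (autPresheaf F) f s : AutSection F _) (ptsMap σ F f a) :=
  AutSection.map_eval _ _ _

lemma ptsMap_autComm (f : C →ₐ[R] C') (s : Pts σ (autPresheaf F) C) (a : Pts σ F C) :
    ptsMap σ F f (autComm s a) =
      autComm (ptsMap σ (autPresheaf F) f s) (ptsMap σ F f a) := by
  rw [autComm, map_mul, map_inv, ptsMap_eval]; rfl

lemma autComm_one_left {T : Over S} (a : F.obj (op T)) :
    autComm (1 : (autPresheaf F).obj (op T)) a = 1 := mul_inv_cancel a

lemma autComm_one_right {T : Over S} (s : (autPresheaf F).obj (op T)) :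
    autComm s (1 : F.obj (op T)) = 1 := by
  simp [autComm, AutSection.eval]

lemma autComm_mul_left {T : Over S} (s t : (autPresheaf F).obj (op T)) (a : F.obj (op T)) :
    autComm (s * t) a = AutSection.eval s (autComm t a) * autComm s a := by
  have h : AutSection.eval (s * t) a = AutSection.eval s (AutSection.eval t a) := rfl
  simp only [autComm, h]
  simp [AutSection.eval]

lemma autComm_mul_right {T : Over S} (s : (autPresheaf F).obj (op T)) (a b : F.obj (op T)) :
    autComm s (a * b) = autComm s a * (a * autComm s b * a⁻¹) := by
  simp only [autComm, AutSection.eval, map_mul]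
  group

namespace LieMod

/-- The section `{Y(ε₀), Z(ε₁)}` of `F` over `Spec C[ε₀, ε₁]`. -/
def preBracket (Y : LieMod σ (autPresheaf F) C C) (Z : LieMod σ F C C) :
    Pts σ F (DualRing (DualRing C C) (DualRing C C)) :=
  autComm (ptsMap σ (autPresheaf F) (DualRing.inl R (DualRing C C) (DualRing C C)) Y.val)
    (ptsMap σ F (DualRing.mapRing (DualRing.inl R C C)) Z.val)

lemma aug_preBracket (Y : LieMod σ (autPresheaf F) C C) (Z : LieMod σ F C C) :
    ptsMap σ F (DualRing.aug R (DualRing C C) (DualRing C C)) (preBracket Y Z) = 1 := by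
  rw [preBracket, ptsMap_autComm, ptsMap_ptsMap σ F, map_val_eq_one Z, autComm_one_right]
  intro x
  ext <;> simp

lemma mapRing_aug_preBracket (Y : LieMod σ (autPresheaf F) C C) (Z : LieMod σ F C C) :
    ptsMap σ F (DualRing.mapRing (DualRing.aug R C C)) (preBracket Y Z) = 1 := by
  rw [preBracket, ptsMap_autComm, ptsMap_ptsMap σ (autPresheaf F), map_val_eq_one Y,
    autComm_one_left]
  intro x
  ext <;> simp

variable [IsGood F]

/-- The bracket `[Y, Z] ∈ Lie(F)(C)` of `Y ∈ Lie(Aut(F))(C)` and `Z ∈ Lie(F)(C)`: the element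
characterized by `[Y, Z](ε₀ ε₁) = {Y(ε₀), Z(ε₁)}`. -/
def bracket (Y : LieMod σ (autPresheaf F) C C) (Z : LieMod σ F C C) : LieMod σ F C C :=
  mk (IsGood.existsUnique σ _ (aug_preBracket Y Z) (mapRing_aug_preBracket Y Z)).choose (by
    have h := (IsGood.existsUnique σ _ (aug_preBracket Y Z) (mapRing_aug_preBracket Y Z)).choose_spec.1
    have h1 := congrArg (ptsMap σ F ((DualRing.aug R C C).comp
      (DualRing.aug R (DualRing C C) (DualRing C C)))) h
    simp only at h1
    rw [← ptsMap_ptsMap _ _ _ (DualRing.aug R C C) (preBracket Y Z), aug_preBracket, map_one,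
      ptsMap_ptsMap] at h1
    exact h1)

lemma smash_bracket (Y : LieMod σ (autPresheaf F) C C) (Z : LieMod σ F C C) :
    ptsMap σ F (smashHom R C) (bracket Y Z).val = preBracket Y Z :=
  (IsGood.existsUnique σ _ (aug_preBracket Y Z) (mapRing_aug_preBracket Y Z)).choose_spec.1

lemma eq_bracket (Y : LieMod σ (autPresheaf F) C C) (Z W : LieMod σ F C C)
    (h : ptsMap σ F (smashHom R C) W.val = preBracket Y Z) : W = bracket Y Z := by
  ext
  exact (IsGood.existsUnique σ _ (aug_preBracket Y Z) (mapRing_aug_preBracket Y Z)).unique h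
    (smash_bracket Y Z)

variable [InfLinear F] [InfLinear (autPresheaf F)]

/-- The automorphism `Y(ε₀)` fixes `W(ε₀ ε₁)`. -/
lemma eval_smash (Y : LieMod σ (autPresheaf F) C C) (W : LieMod σ F C C) :
    AutSection.eval (ptsMap σ (autPresheaf F) (DualRing.inl R (DualRing C C) (DualRing C C)) Y.val)
      (ptsMap σ F (smashHom R C) W.val) = ptsMap σ F (smashHom R C) W.val := by
  -- the endomorphism of `C[ε₀, ε₁]` with `ε₀ ↦ ε₀` and `ε₁ ↦ ε₀ ε₁`
  let e : DualRing C C := ⟨0, 1⟩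
  let θ : DualRing (DualRing C C) (DualRing C C) →ₐ[R] DualRing (DualRing C C) (DualRing C C) :=
    DualRing.mapMod R (LinearMap.lsmul (DualRing C C) (DualRing C C) e)
  have h1 : θ.comp (DualRing.inl R _ _) = DualRing.inl R (DualRing C C) (DualRing C C) := by
    ext x <;> simp [θ]
  have h2 : θ.comp (DualRing.mapRing (DualRing.inl R C C)) = smashHom R C := by
    ext x <;> simp [θ, e]
  have h := congrArg (ptsMap σ F θ) (smash_bracket Y W)
  rw [preBracket, ptsMap_autComm, ptsMap_ptsMap, ptsMap_ptsMap, ptsMap_ptsMap, h1, h2,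
    map_val_eq_one, eq_comm, autComm, mul_inv_eq_one] at h
  · exact h
  · intro x
    ext <;> simp [θ, e]

lemma bracket_add_left (Y Y' : LieMod σ (autPresheaf F) C C) (Z : LieMod σ F C C) :
    bracket (Y + Y') Z = bracket Y Z + bracket Y' Z := by
  rw [add_comm (bracket Y Z)]
  refine (eq_bracket _ _ _ ?_).symm
  rw [val_add, map_mul, smash_bracket, smash_bracket, preBracket, preBracket, preBracket, val_add,
    map_mul, autComm_mul_left]
  congr 1
  have := eval_smash Y (bracket Y' Z)
  rw [smash_bracket] at this
  exact this.symm

lemma bracket_add_right (Y : LieMod σ (autPresheaf F) C C) (Z Z' : LieMod σ F C C) :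
    bracket Y (Z + Z') = bracket Y Z + bracket Y Z' := by
  refine (eq_bracket _ _ _ ?_).symm
  rw [val_add, map_mul, smash_bracket, smash_bracket]
  have h : preBracket Y (Z + Z') = preBracket Y Z *
      (ptsMap σ F (DualRing.mapRing (DualRing.inl R C C)) Z.val * preBracket Y Z' *
        (ptsMap σ F (DualRing.mapRing (DualRing.inl R C C)) Z.val)⁻¹) := by
    rw [preBracket, val_add, map_mul, autComm_mul_right]; rfl
  rw [h]
  congr 1
  let z : LieMod σ F (DualRing C C) (DualRing C C) := mapRing (DualRing.inl R C C) Z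
  let b : LieMod σ F (DualRing C C) (DualRing C C) := mk (preBracket Y Z') (aug_preBracket Y Z')
  have hc : z + b = b + z := add_comm _ _
  have hc' : z.val * b.val = b.val * z.val := congrArg val hc
  change b.val = z.val * b.val * z.val⁻¹
  rw [hc', mul_inv_cancel_right]

lemma bracket_smul_left (c : C) (Y : LieMod σ (autPresheaf F) C C) (Z : LieMod σ F C C) :
    bracket (c • Y) Z = c • bracket Y Z := by
  refine (eq_bracket _ _ _ ?_).symm
  -- the endomorphism of `C[ε₀, ε₁]` with `ε₀ ↦ c ε₀` and `ε₁ ↦ ε₁`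
  let θ : DualRing (DualRing C C) (DualRing C C) →ₐ[R] DualRing (DualRing C C) (DualRing C C) :=
    DualRing.mapRing (DualRing.mapMod R (c • LinearMap.id))
  have h := congrArg (ptsMap σ F θ) (smash_bracket Y Z)
  rw [preBracket, ptsMap_autComm, ptsMap_ptsMap, ptsMap_ptsMap, ptsMap_ptsMap] at h
  rw [smul_def, val_mapMod, ptsMap_ptsMap, preBracket, smul_def, val_mapMod, ptsMap_ptsMap]
  have h1 : θ.comp (DualRing.inl R _ _) = (DualRing.inl R (DualRing C C) (DualRing C C)).comp
      (DualRing.mapMod R (c • LinearMap.id)) := by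
    ext x <;> simp [θ]
  have h2 : θ.comp (DualRing.mapRing (DualRing.inl R C C)) =
      DualRing.mapRing (DualRing.inl R C C) := by
    ext x <;> simp [θ]
  have h3 : θ.comp (smashHom R C) =
      (smashHom R C).comp (DualRing.mapMod R (c • LinearMap.id)) := by
    ext x <;> simp [θ]
  rw [h1, h2, h3] at h
  exact h

lemma bracket_smul_right (c : C) (Y : LieMod σ (autPresheaf F) C C) (Z : LieMod σ F C C) :
    bracket Y (c • Z) = c • bracket Y Z := by
  refine (eq_bracket _ _ _ ?_).symm
  -- the endomorphism of `C[ε₀, ε₁]` with `ε₀ ↦ ε₀` and `ε₁ ↦ c ε₁`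
  let θ : DualRing (DualRing C C) (DualRing C C) →ₐ[R] DualRing (DualRing C C) (DualRing C C) :=
    DualRing.mapMod R ((DualRing.inl R C C c) • LinearMap.id)
  have h := congrArg (ptsMap σ F θ) (smash_bracket Y Z)
  rw [preBracket, ptsMap_autComm, ptsMap_ptsMap, ptsMap_ptsMap, ptsMap_ptsMap] at h
  rw [smul_def, val_mapMod, ptsMap_ptsMap, preBracket, smul_def, val_mapMod, ptsMap_ptsMap]
  have h1 : θ.comp (DualRing.inl R _ _) = DualRing.inl R (DualRing C C) (DualRing C C) := by
    ext x <;> simp [θ]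
  have h2 : θ.comp (DualRing.mapRing (DualRing.inl R C C)) =
      (DualRing.mapRing (DualRing.inl R C C)).comp (DualRing.mapMod R (c • LinearMap.id)) := by
    ext x <;> simp [θ]
  have h3 : θ.comp (smashHom R C) =
      (smashHom R C).comp (DualRing.mapMod R (c • LinearMap.id)) := by
    ext x <;> simp [θ]
  rw [h1, h2, h3] at h
  exact h

variable (σ F C) in
/-- The bracket as a bilinear pairing `Lie(Aut(F))(C) × Lie(F)(C) → Lie(F)(C)`. -/
def bracketₗ : LieMod σ (autPresheaf F) C C →ₗ[C] LieMod σ F C C →ₗ[C] LieMod σ F C C :=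
  LinearMap.mk₂ C bracket bracket_add_left bracket_smul_left bracket_add_right bracket_smul_right

end LieMod

end Bracket

/-! ### Group schemes are infinitesimally linear -/

section Epi

lemma epi_of_surjective_of_isSchemeTheoreticallyDominant {X Y : Scheme.{u}} (f : X ⟶ Y)
    [Surjective f] [QuasiCompact f] [IsSchemeTheoreticallyDominant f] : Epi f := by
  constructor
  intro Z a b h
  have hb : a.base = b.base := by
    ext y
    obtain ⟨x, rfl⟩ := f.surjective y
    have := congr($h x)
    simpa using this
  refine Scheme.Hom.ext hb ?_
  intro U
  have inj := f.app_injective (b ⁻¹ᵁ U)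
  ext s
  apply inj
  have := Scheme.Hom.congr_app h U
  simp only [Scheme.Hom.comp_app] at this
  rw [← ConcreteCategory.comp_apply, ← ConcreteCategory.comp_apply]
  have key : (a.app U ≫ Y.presheaf.map (eqToHom (by rw [hb])).op) ≫ f.app (b ⁻¹ᵁ U) =
      b.app U ≫ f.app (b ⁻¹ᵁ U) := by
    rw [Category.assoc, f.naturality, ← Category.assoc, this]
    refine (Category.assoc _ _ _).trans ?_
    refine (congrArg (_ ≫ ·) ((X.presheaf.map_comp _ _).symm.trans ?_)).trans (Category.comp_id _)
    exact X.presheaf.map_id _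
  exact congr($key s)

lemma isSchemeTheoreticallyDominant_specMap {A B : CommRingCat.{u}} (f : A ⟶ B)
    (hf : Function.Injective f.hom) : IsSchemeTheoreticallyDominant (Spec.map f) := by
  rw [isSchemeTheoreticallyDominant_iff, Scheme.ker_of_isAffine]
  have : RingHom.ker (Spec.map f).appTop.hom = ⊥ := by
    rw [← RingHom.injective_iff_ker_eq_bot]
    have h := Scheme.ΓSpecIso_naturality f
    have h2 : (Spec.map f).appTop = (Scheme.ΓSpecIso A).hom ≫ f ≫ (Scheme.ΓSpecIso B).inv := by
      rw [← Category.assoc, Iso.eq_comp_inv]; exact h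
    rw [h2]
    simp only [CommRingCat.hom_comp, RingHom.coe_comp]
    exact ((ConcreteCategory.bijective_of_isIso (Scheme.ΓSpecIso B).inv).1.comp hf).comp
      (ConcreteCategory.bijective_of_isIso (Scheme.ΓSpecIso A).hom).1
  rw [this]
  exact le_bot_iff.mp (Scheme.IdealSheafData.le_of_isAffine (by simp))

/-- The spectrum does not change under a surjection with nilpotent kernel. -/
lemma surjective_specMap_of_nilpotent {A B : CommRingCat.{u}} (f : A ⟶ B)
    (hf : Function.Surjective f.hom) (h : ∀ a, f.hom a = 0 → IsNilpotent a) :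
    Surjective (Spec.map f) := by
  refine ⟨fun p => ?_⟩
  have hp : p ∈ Set.range (PrimeSpectrum.comap f.hom) := by
    rw [range_comap_of_surjective _ _ hf]
    refine (PrimeSpectrum.mem_zeroLocus (R := A) p _).mpr ?_
    intro a ha
    obtain ⟨n, hn⟩ := h a ha
    exact p.2.mem_of_pow_mem n (by rw [hn]; exact zero_mem _)
  exact hp

lemma pullback_fst_ext {T Y D Z W : Scheme.{u}} (g : Z ⟶ T) (a b : Z ⟶ W) (i : Y ⟶ T) (c : D ⟶ Y)
    (j : D ⟶ T) (hc : c ≫ i = j) (h : pullback.fst g j ≫ a = pullback.fst g j ≫ b) :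
    pullback.fst (pullback.snd g i) c ≫ pullback.fst g i ≫ a =
      pullback.fst (pullback.snd g i) c ≫ pullback.fst g i ≫ b := by
  subst hc
  let l : pullback (pullback.snd g i) c ⟶ pullback g (c ≫ i) :=
    pullback.lift (pullback.fst (pullback.snd g i) c ≫ pullback.fst g i) (pullback.snd _ _)
      (by rw [Category.assoc, pullback.condition, pullback.condition_assoc])
  have hl : l ≫ pullback.fst g (c ≫ i) = pullback.fst (pullback.snd g i) c ≫ pullback.fst g i :=
    pullback.lift_fst _ _ _
  rw [← Category.assoc, ← Category.assoc, ← hl, Category.assoc, Category.assoc, h]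

lemma pullback_fst_id_ext {T D W : Scheme.{u}} (j : D ⟶ T) (a b : T ⟶ W) (h : j ≫ a = j ≫ b) :
    pullback.fst (𝟙 T) j ≫ a = pullback.fst (𝟙 T) j ≫ b := by
  have : pullback.fst (𝟙 T) j = pullback.snd (𝟙 T) j ≫ j := by
    rw [← pullback.condition, Category.comp_id]
  rw [this, Category.assoc, Category.assoc, h]

/-- Let `A → A₁` and `A → A₂` be jointly injective homomorphisms such that `Spec A₁ ⟶ Spec A` is
surjective. Morphisms out of a flat `Spec A`-scheme are determined by the restrictions to the base
changes along `Spec A₁` and `Spec A₂`. -/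
lemma hom_ext_of_flat {A A₁ A₂ : Type u} [CommRing A] [CommRing A₁] [CommRing A₂] (p₁ : A →+* A₁)
    (p₂ : A →+* A₂) (hinj : ∀ x, p₁ x = 0 → p₂ x = 0 → x = 0)
    [Surjective (Spec.map (CommRingCat.ofHom p₁))] {Z W : Scheme.{u}}
    (g : Z ⟶ Spec (.of A)) [Flat g] (a b : Z ⟶ W)
    (h₁ : pullback.fst g (Spec.map (CommRingCat.ofHom p₁)) ≫ a =
      pullback.fst g (Spec.map (CommRingCat.ofHom p₁)) ≫ b)
    (h₂ : pullback.fst g (Spec.map (CommRingCat.ofHom p₂)) ≫ a =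
      pullback.fst g (Spec.map (CommRingCat.ofHom p₂)) ≫ b) : a = b := by
  let i : Spec (.of A₁) ⨿ Spec (.of A₂) ⟶ Spec (.of A) :=
    coprodSpec A₁ A₂ ≫ Spec.map (CommRingCat.ofHom (p₁.prod p₂))
  have hl : coprod.inl ≫ i = Spec.map (CommRingCat.ofHom p₁) := by
    simp only [i, coprodSpec_inl_assoc, ← Spec.map_comp, ← CommRingCat.ofHom_comp]
    rfl
  have hr : coprod.inr ≫ i = Spec.map (CommRingCat.ofHom p₂) := by
    simp only [i, coprodSpec_inr_assoc, ← Spec.map_comp, ← CommRingCat.ofHom_comp]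
    rfl
  have : IsSchemeTheoreticallyDominant (Spec.map (CommRingCat.ofHom (p₁.prod p₂))) := by
    refine isSchemeTheoreticallyDominant_specMap _ ?_
    refine (injective_iff_map_eq_zero (p₁.prod p₂)).mpr fun x hx => ?_
    exact hinj x (congrArg Prod.fst hx) (congrArg Prod.snd hx)
  have : IsSchemeTheoreticallyDominant i := inferInstance
  have : Surjective i := by
    have : Surjective (coprod.inl ≫ i) := by rw [hl]; infer_instance
    exact Surjective.of_comp coprod.inl i
  have : Epi (pullback.fst g i) := epi_of_surjective_of_isSchemeTheoreticallyDominant _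
  rw [← cancel_epi (pullback.fst g i)]
  let 𝒱 := (coprodOpenCover.{u, 0} (Spec (.of A₁)) (Spec (.of A₂))).pullback₁ (pullback.snd g i)
  refine Scheme.Cover.hom_ext 𝒱 _ _ fun k => ?_
  rcases k with k | k
  · exact pullback_fst_ext g a b i coprod.inl _ hl h₁
  · exact pullback_fst_ext g a b i coprod.inr _ hr h₂

end Epi

section GroupScheme

variable {M N : Type u} [AddCommGroup M] [Module C M] [AddCommGroup N] [Module C N]

instance surjective_specMap_aug :
    Surjective (Spec.map (CommRingCat.ofHom (DualRing.aug R C M).toRingHom)) := by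
  refine surjective_specMap_of_nilpotent _ (fun c => ⟨⟨c, 0⟩, rfl⟩) fun x hx => ⟨2, ?_⟩
  have hx : x.fst = 0 := hx
  ext <;> simp [pow_two, hx]

instance surjective_specMap_mapMod (g : M →ₗ[C] N) :
    Surjective (Spec.map (CommRingCat.ofHom (DualRing.mapMod R g).toRingHom)) := by
  have : Surjective (Spec.map (CommRingCat.ofHom (DualRing.aug R C N).toRingHom) ≫
      Spec.map (CommRingCat.ofHom (DualRing.mapMod R g).toRingHom)) := by
    rw [← Spec.map_comp]
    exact surjective_specMap_aug (R := R) (C := C) (M := M)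
  exact Surjective.of_comp (Spec.map (CommRingCat.ofHom (DualRing.aug R C N).toRingHom)) _

lemma eq_zero_of_fst_of_snd (x : DualRing C (M × N))
    (h₁ : (DualRing.mapMod R (LinearMap.fst C M N)).toRingHom x = 0)
    (h₂ : (DualRing.mapMod R (LinearMap.snd C M N)).toRingHom x = 0) : x = 0 := by
  ext
  · exact (DualRing.ext_iff.mp h₁).1
  · exact (DualRing.ext_iff.mp h₁).2
  · exact (DualRing.ext_iff.mp h₂).2

instance (G : Over S) [GrpObj G] : InfLinear (yonedaGrpObj G) where
  ext {R} _ σ {C M N} _ _ _ _ _ _ y z h₁ h₂ := by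
    refine Over.OverMorphism.ext ?_
    refine hom_ext_of_flat (DualRing.mapMod R (LinearMap.fst C M N)).toRingHom
      (DualRing.mapMod R (LinearMap.snd C M N)).toRingHom eq_zero_of_fst_of_snd (𝟙 _) _ _ ?_ ?_
    · exact pullback_fst_id_ext _ _ _ (congrArg CommaMorphism.left h₁)
    · exact pullback_fst_id_ext _ _ _ (congrArg CommaMorphism.left h₂)

lemma autSection_ext_of_flat {G : Over S} [GrpObj G] {T : Over S} {Z : Over S} (p : Z ⟶ G)
    (q : Z ⟶ T) (hZ : ∀ (T' : Over S) (a : T' ⟶ G) (f : T' ⟶ T), ∃ m : T' ⟶ Z, a = m ≫ p ∧ f = m ≫ q)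
    (s t : AutSection (yonedaGrpObj G) T)
    (h : (s.app Z q p : Z ⟶ G) = (t.app Z q p : Z ⟶ G)) : s = t := by
  ext T' f a
  obtain ⟨m, ha, hf⟩ := hZ T' a f
  subst hf
  have ha : a = (yonedaGrpObj G).map m.op p := ha
  rw [ha]
  refine (s.naturality q m p).symm.trans (Eq.trans ?_ (t.naturality q m p))
  exact congrArg _ h

instance (G : Over S) [GrpObj G] [Flat G.hom] : InfLinear (autPresheaf (yonedaGrpObj G)) where
  ext {R} _ σ {C M N} _ _ _ _ _ _ s t h₁ h₂ := by
    let T := specOver σ (DualRing C (M × N))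
    let Z : Over S := Over.mk (pullback.fst G.hom T.hom ≫ G.hom)
    let p : Z ⟶ G := Over.homMk (pullback.fst G.hom T.hom)
    let q : Z ⟶ T := Over.homMk (pullback.snd G.hom T.hom) pullback.condition.symm
    refine autSection_ext_of_flat p q (fun T' a f => ⟨Over.homMk (pullback.lift a.left f.left
      (by rw [Over.w, Over.w])) ((pullback.lift_fst_assoc _ _ _ _).trans (Over.w a)),
      Over.OverMorphism.ext (pullback.lift_fst _ _ _).symm,
      Over.OverMorphism.ext (pullback.lift_snd _ _ _).symm⟩) s t ?_
    have key : ∀ {C' : Type u} [CommRing C'] [Algebra R C'] (φ : DualRing C (M × N) →ₐ[R] C'),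
        ptsMap σ (autPresheaf (yonedaGrpObj G)) φ s = ptsMap σ (autPresheaf (yonedaGrpObj G)) φ t →
        pullback.fst q.left (Spec.map (CommRingCat.ofHom φ.toRingHom)) ≫
          CommaMorphism.left (s.app Z q p : Z ⟶ G) =
        pullback.fst q.left (Spec.map (CommRingCat.ofHom φ.toRingHom)) ≫
          CommaMorphism.left (t.app Z q p : Z ⟶ G) := by
      intro C' _ _ φ h
      let P : Over S := Over.mk (pullback.fst q.left (specOverMap σ φ).left ≫ Z.hom)
      let g : P ⟶ Z := Over.homMk (pullback.fst q.left (specOverMap σ φ).left)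
      let f : P ⟶ specOver σ C' := Over.homMk (pullback.snd q.left (specOverMap σ φ).left) (by
        rw [← Over.w (specOverMap σ φ), ← pullback.condition_assoc, Over.w q]; rfl)
      have hgf : g ≫ q = f ≫ specOverMap σ φ := by
        ext1
        exact pullback.condition
      have hs := s.naturality q g p
      have ht := t.naturality q g p
      have hst : s.app P (f ≫ specOverMap σ φ) = t.app P (f ≫ specOverMap σ φ) :=
        congrArg (fun r : AutSection (yonedaGrpObj G) _ => r.app P f) h
      rw [hgf] at hs ht
      rw [hst] at hs
      exact congrArg CommaMorphism.left (hs.trans ht.symm)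
    refine Over.OverMorphism.ext ?_
    have : @Flat Z.left (Spec (.of (DualRing C (M × N)))) q.left :=
      inferInstanceAs (Flat (pullback.snd G.hom T.hom))
    exact hom_ext_of_flat (DualRing.mapMod R (LinearMap.fst C M N)).toRingHom
      (DualRing.mapMod R (LinearMap.snd C M N)).toRingHom eq_zero_of_fst_of_snd q.left _ _
      (key _ h₁) (key _ h₂)

end GroupScheme

/-! ### Group schemes are good -/

section Localization

/-- The homomorphism `f` is a localization at the powers of `b`. -/
structure IsLocAway {A A' : Type u} [CommRing A] [CommRing A'] (f : A →+* A') (b : A) : Prop where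
  unit : IsUnit (f b)
  surj : ∀ x', ∃ n x, f b ^ n * x' = f x
  inj : ∀ x, f x = 0 → ∃ n, b ^ n * x = 0

lemma isLocAway_algebraMap (A : Type u) [CommRing A] (b : A) :
    IsLocAway (algebraMap A (Localization.Away b)) b where
  unit := IsLocalization.Away.algebraMap_isUnit b
  surj x' := by
    obtain ⟨n, x, h⟩ := IsLocalization.Away.surj b x'
    exact ⟨n, x, by rw [mul_comm]; exact h⟩
  inj x hx := by
    obtain ⟨⟨_, n, rfl⟩, h⟩ :=
      (IsLocalization.map_eq_zero_iff (.powers b) (Localization.Away b) x).mp hx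
    exact ⟨n, h⟩

lemma IsLocAway.mapRing {f : C →ₐ[R] C'} {b : C} (h : IsLocAway f.toRingHom b) :
    IsLocAway (DualRing.mapRing f).toRingHom (DualRing.inl R C C b) where
  unit := by
    have : (DualRing.mapRing f).toRingHom (DualRing.inl R C C b) = DualRing.inl R C' C' (f b) := by
      ext <;> simp
    rw [this]
    exact h.unit.map _
  surj x' := by
    have : (DualRing.mapRing f).toRingHom (DualRing.inl R C C b) = DualRing.inl R C' C' (f b) := by
      ext <;> simp
    obtain ⟨n, x, hx⟩ := h.surj x'.fst
    obtain ⟨m, y, hy⟩ := h.surj x'.snd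
    simp only [AlgHom.toRingHom_eq_coe, RingHom.coe_coe] at hx hy
    refine ⟨n + m, ⟨b ^ m * x, b ^ n * y⟩, ?_⟩
    rw [this, ← map_pow]
    ext
    · simp only [DualRing.fst_mul, DualRing.fst_inl, AlgHom.toRingHom_eq_coe, RingHom.coe_coe,
        DualRing.fst_mapRing]
      rw [map_mul, map_pow, ← hx]
      ring
    · simp only [DualRing.snd_mul, DualRing.fst_inl, DualRing.snd_inl, AlgHom.toRingHom_eq_coe,
        RingHom.coe_coe, DualRing.snd_mapRing, smul_eq_mul]
      rw [map_mul, map_pow, ← hy]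
      ring
  inj x hx := by
    obtain ⟨n, hn⟩ := h.inj x.fst (DualRing.ext_iff.mp hx).1
    obtain ⟨m, hm⟩ := h.inj x.snd (DualRing.ext_iff.mp hx).2
    refine ⟨n + m, ?_⟩
    rw [← map_pow]
    ext
    · simp only [DualRing.fst_mul, DualRing.fst_inl, DualRing.fst_zero]
      linear_combination b ^ m * hn
    · simp only [DualRing.snd_mul, DualRing.fst_inl, DualRing.snd_inl, DualRing.snd_zero,
        smul_eq_mul]
      linear_combination b ^ n * hm

lemma IsLocAway.isLocalization {A A' : Type u} [CommRing A] [CommRing A'] {f : A →+* A'} {b : A}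
    (h : IsLocAway f b) : @IsLocalization.Away A _ b A' _ f.toAlgebra := by
  let _ := f.toAlgebra
  exact
    { map_units := by
        rintro ⟨_, n, rfl⟩
        have : IsUnit (f b ^ n) := h.unit.pow n
        rw [← map_pow] at this
        exact this
      surj := by
        intro z
        obtain ⟨n, x, hx⟩ := h.surj z
        refine ⟨⟨x, ⟨_, n, rfl⟩⟩, ?_⟩
        rw [mul_comm]
        change f (b ^ n) * z = f x
        rw [map_pow, hx]
      exists_of_eq := by
        intro x y hxy
        obtain ⟨n, hn⟩ := h.inj (x - y) (by rw [map_sub, sub_eq_zero]; exact hxy)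
        refine ⟨⟨_, n, rfl⟩, ?_⟩
        rw [← sub_eq_zero, ← mul_sub]
        exact hn }

lemma IsLocAway.isOpenImmersion {A A' : Type u} [CommRing A] [CommRing A'] {f : A →+* A'} {b : A}
    (h : IsLocAway f b) : IsOpenImmersion (Spec.map (CommRingCat.ofHom f)) := by
  let _ := f.toAlgebra
  have := h.isLocalization
  exact IsOpenImmersion.of_isLocalization b

lemma IsLocAway.range {A A' : Type u} [CommRing A] [CommRing A'] {f : A →+* A'} {b : A}
    (h : IsLocAway f b) :
    Set.range (Spec.map (CommRingCat.ofHom f)) = {p | b ∉ (p : PrimeSpectrum A).asIdeal} := by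
  let _ := f.toAlgebra
  have := h.isLocalization
  exact PrimeSpectrum.localization_away_comap_range A' b

lemma isPullback_of_isLocAway {A A' E E' : Type u} [CommRing A] [CommRing A'] [CommRing E]
    [CommRing E'] {f : A →+* A'} {b : A} (h : IsLocAway f b) (ι : A →+* E) {g : E →+* E'}
    (ι' : A' →+* E') (h' : IsLocAway g (ι b)) (H : g.comp ι = ι'.comp f) :
    IsPullback (Spec.map (CommRingCat.ofHom ι')) (Spec.map (CommRingCat.ofHom g))
      (Spec.map (CommRingCat.ofHom f)) (Spec.map (CommRingCat.ofHom ι)) := by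
  have := h.isOpenImmersion
  have := h'.isOpenImmersion
  refine IsOpenImmersion.isPullback _ _ _ _ ?_ ?_
  · rw [← Spec.map_comp, ← Spec.map_comp, ← CommRingCat.ofHom_comp, ← CommRingCat.ofHom_comp, H]
  · refine TopologicalSpace.Opens.ext ?_
    change Spec.map (CommRingCat.ofHom ι) ⁻¹' Set.range (Spec.map (CommRingCat.ofHom f)) =
      Set.range (Spec.map (CommRingCat.ofHom g))
    rw [h.range, h'.range]
    rfl

/-- Morphisms out of `Spec E` which locally descend along a scheme theoretically dominant
homeomorphism `Spec E ⟶ Spec A` descend. -/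
lemma exists_descent {A E : Type u} [CommRing A] [CommRing E] (ι : A →+* E)
    (hι : Function.Injective ι) [Surjective (Spec.map (CommRingCat.ofHom ι))]
    {W : Scheme.{u}} (w : Spec (.of E) ⟶ W)
    (H : ∀ p : PrimeSpectrum A, ∃ b ∉ p.asIdeal, ∃ (A' E' : Type u) (_ : CommRing A')
      (_ : CommRing E') (f : A →+* A') (g : E →+* E') (ι' : A' →+* E') (z : Spec (.of A') ⟶ W),
      IsLocAway f b ∧ IsLocAway g (ι b) ∧ g.comp ι = ι'.comp f ∧
        Spec.map (CommRingCat.ofHom ι') ≫ z = Spec.map (CommRingCat.ofHom g) ≫ w) :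
    ∃ z : Spec (.of A) ⟶ W, Spec.map (CommRingCat.ofHom ι) ≫ z = w := by
  choose b hb A' E' iA iE f g ι' z hf hg hc hz using H
  have hP : ∀ p, IsPullback (Spec.map (CommRingCat.ofHom (ι' p))) (Spec.map (CommRingCat.ofHom (g p)))
      (Spec.map (CommRingCat.ofHom (f p))) (Spec.map (CommRingCat.ofHom ι)) := fun p =>
    isPullback_of_isLocAway (hf p) ι (ι' p) (hg p) (hc p)
  have hO : ∀ p, IsOpenImmersion (Spec.map (CommRingCat.ofHom (f p))) := fun p =>
    (hf p).isOpenImmersion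
  let 𝒰 : (Spec (.of A)).OpenCover := {
    I₀ := PrimeSpectrum A
    X p := Spec (.of (A' p))
    f p := Spec.map (CommRingCat.ofHom (f p))
    mem₀ := by
      rw [Scheme.presieve₀_mem_precoverage_iff]
      refine ⟨fun (p : PrimeSpectrum A) => ⟨p, ?_⟩, hO⟩
      exact (Set.ext_iff.mp (hf p).range p).mpr (hb p) }
  have := isSchemeTheoreticallyDominant_specMap (CommRingCat.ofHom ι) hι
  -- the morphism `z p`, on every scheme over `Spec A'` and `Spec E`
  have key : ∀ (p) (Q : Scheme.{u}) (s : Q ⟶ Spec (.of (A' p))) (t : Q ⟶ Spec (.of E)),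
      s ≫ Spec.map (CommRingCat.ofHom (f p)) = t ≫ Spec.map (CommRingCat.ofHom ι) →
      s ≫ z p = t ≫ w := by
    intro p Q s t hst
    have h₁ := (hP p).lift_fst s t hst
    have h₂ := (hP p).lift_snd s t hst
    generalize (hP p).lift s t hst = l at h₁ h₂
    rw [← h₁, ← h₂, Category.assoc, Category.assoc, hz]
  have hov : ∀ p q, pullback.fst (𝒰.f p) (𝒰.f q) ≫ z p = pullback.snd (𝒰.f p) (𝒰.f q) ≫ z q := by
    intro p q
    have hfp : IsOpenImmersion (𝒰.f p) := hO p
    have hfq : IsOpenImmersion (𝒰.f q) := hO q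
    let c : pullback (𝒰.f p) (𝒰.f q) ⟶ Spec (.of A) := pullback.fst (𝒰.f p) (𝒰.f q) ≫ 𝒰.f p
    let i := Spec.map (CommRingCat.ofHom ι)
    have : Epi (pullback.fst c i) := epi_of_surjective_of_isSchemeTheoreticallyDominant _
    rw [← cancel_epi (pullback.fst c i), ← Category.assoc, ← Category.assoc]
    refine (key p _ _ (pullback.snd c i) ?_).trans (key q _ _ (pullback.snd c i) ?_).symm
    · rw [← pullback.condition, Category.assoc]
    · rw [← pullback.condition, Category.assoc]
      congr 1
      exact pullback.condition.symm
  refine ⟨𝒰.glueMorphisms z hov, ?_⟩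
  refine Scheme.Cover.hom_ext (𝒰.pullback₁ (Spec.map (CommRingCat.ofHom ι))) _ _ fun p => ?_
  change pullback.fst _ (𝒰.f p) ≫ _ ≫ _ = pullback.fst _ (𝒰.f p) ≫ _
  rw [pullback.condition_assoc]
  exact (congrArg (_ ≫ ·) (𝒰.ι_glueMorphisms z hov p)).trans
    (key p _ _ _ pullback.condition.symm)

end Localization

section Good

variable {G : Over S} [GrpObj G]

/-- The morphism of schemes underlying a point of a group scheme. -/
abbrev ptsLeft (y : Pts σ (yonedaGrpObj G) C) : Spec (.of C) ⟶ G.left :=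
  CommaMorphism.left (show specOver σ C ⟶ G from y)

lemma ptsLeft_ptsMap (f : C →ₐ[R] C') (y : Pts σ (yonedaGrpObj G) C) :
    ptsLeft σ (ptsMap σ (yonedaGrpObj G) f y) =
      Spec.map (CommRingCat.ofHom f.toRingHom) ≫ ptsLeft σ y := rfl

variable {σ} in
lemma ptsLeft_injective {y z : Pts σ (yonedaGrpObj G) C} (h : ptsLeft σ y = ptsLeft σ z) :
    y = z := Over.OverMorphism.ext h

lemma smashHom_injective : Function.Injective (smashHom R C).toRingHom := by
  intro x y h
  ext
  · exact (DualRing.ext_iff.mp (DualRing.ext_iff.mp h).1).1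
  · exact (DualRing.ext_iff.mp (DualRing.ext_iff.mp h).2).2

lemma surjective_specMap_dualAug : Surjective (Spec.map (CommRingCat.ofHom
    ((DualRing.aug R C C).comp (DualRing.aug R (DualRing C C) (DualRing C C))).toRingHom)) := by
  have h1 := surjective_specMap_aug (R := R) (C := C) (M := C)
  have h2 := surjective_specMap_aug (R := R) (C := DualRing C C) (M := DualRing C C)
  have h3 : Surjective (Spec.map (CommRingCat.ofHom (DualRing.aug R C C).toRingHom) ≫
    Spec.map (CommRingCat.ofHom (DualRing.aug R (DualRing C C) (DualRing C C)).toRingHom)) :=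
    inferInstance
  rw [← Spec.map_comp] at h3
  exact h3

instance surjective_specMap_smashHom :
    Surjective (Spec.map (CommRingCat.ofHom (smashHom R C).toRingHom)) := by
  have : Surjective (Spec.map (CommRingCat.ofHom
      ((DualRing.aug R C C).comp (DualRing.aug R (DualRing C C) (DualRing C C))).toRingHom) ≫
      Spec.map (CommRingCat.ofHom (smashHom R C).toRingHom)) := by
    rw [← Spec.map_comp]
    exact surjective_specMap_aug (R := R) (C := C) (M := C)
  exact Surjective.of_comp (Spec.map (CommRingCat.ofHom
      ((DualRing.aug R C C).comp (DualRing.aug R (DualRing C C) (DualRing C C))).toRingHom)) _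

instance epi_specMap_smashHom :
    Epi (Spec.map (CommRingCat.ofHom (smashHom R C).toRingHom)) := by
  have := isSchemeTheoreticallyDominant_specMap (CommRingCat.ofHom (smashHom R C).toRingHom)
    (smashHom_injective (R := R) (C := C))
  exact epi_of_surjective_of_isSchemeTheoreticallyDominant _

/-- The descent for a section with values in an affine open subscheme. -/
lemma exists_descent_affine (w : Pts σ (yonedaGrpObj G) (DualRing (DualRing C C) (DualRing C C)))
    (h₁ : ptsMap σ (yonedaGrpObj G) (DualRing.aug R (DualRing C C) (DualRing C C)) w = 1)
    (h₂ : ptsMap σ (yonedaGrpObj G) (DualRing.mapRing (DualRing.aug R C C)) w = 1)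
    {B : CommRingCat.{u}} (j : Spec B ⟶ G.left) [IsOpenImmersion j]
    (hj : Set.range (ptsLeft σ (1 : Pts σ (yonedaGrpObj G) C)) ⊆ Set.range j) :
    ∃ z : Spec (.of (DualRing C C)) ⟶ G.left,
      Spec.map (CommRingCat.ofHom (smashHom R C).toRingHom) ≫ z = ptsLeft σ w := by
  have hw : Set.range (ptsLeft σ w) ⊆ Set.range j := by
    rintro _ ⟨x, rfl⟩
    obtain ⟨y, rfl⟩ := (surjective_specMap_dualAug (R := R) (C := C)).surj x
    refine hj ⟨y, ?_⟩
    rw [← Scheme.Hom.comp_apply, ← ptsLeft_ptsMap, ← ptsMap_ptsMap, h₁, map_one]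
  obtain ⟨g0, hg0⟩ := Spec.map_surjective (IsOpenImmersion.lift j _ hj)
  obtain ⟨g, hg⟩ := Spec.map_surjective (IsOpenImmersion.lift j _ hw)
  have e0 : Spec.map g0 ≫ j = ptsLeft σ (1 : Pts σ (yonedaGrpObj G) C) := by
    rw [hg0, IsOpenImmersion.lift_fac]
  have e : Spec.map g ≫ j = ptsLeft σ w := by rw [hg, IsOpenImmersion.lift_fac]
  have key : ∀ (q : DualRing (DualRing C C) (DualRing C C) →ₐ[R] DualRing C C),
      ptsMap σ (yonedaGrpObj G) q w = 1 → ∀ f, q (g.hom f) = DualRing.inl R C C (g0.hom f) := by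
    intro q hq f
    have h3 : ptsLeft σ (ptsMap σ (yonedaGrpObj G) q w) =
        ptsLeft σ (ptsMap σ (yonedaGrpObj G) (DualRing.inl R C C) 1) := by
      rw [hq, map_one]
    rw [ptsLeft_ptsMap, ptsLeft_ptsMap, ← e, ← e0, ← Category.assoc, ← Category.assoc,
      cancel_mono, ← Spec.map_comp, ← Spec.map_comp] at h3
    have h4 := Spec.map_injective h3
    exact congr($h4 f)
  have hs : ∀ f, smashHom R C ⟨(g.hom f).fst.fst, (g.hom f).snd.snd⟩ = g.hom f := by
    intro f
    have k1 := key _ h₁ f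
    have k2 := key _ h₂ f
    ext
    · rfl
    · exact ((DualRing.ext_iff.mp k1).2).symm
    · exact ((DualRing.ext_iff.mp k2).2).symm
    · rfl
  let h : B →+* DualRing C C :=
    { toFun f := ⟨(g.hom f).fst.fst, (g.hom f).snd.snd⟩
      map_zero' := by ext <;> simp
      map_one' := by ext <;> simp
      map_add' x y := by ext <;> simp
      map_mul' x y := by
        apply smashHom_injective (R := R)
        refine Eq.trans ?_ (map_mul _ _ _).symm
        refine (hs (x * y)).trans ?_
        rw [map_mul, ← hs x, ← hs y]
        rfl }
  refine ⟨Spec.map (CommRingCat.ofHom h) ≫ j, ?_⟩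
  rw [← e, ← Category.assoc, ← Spec.map_comp]
  congr 2
  exact CommRingCat.hom_ext (RingHom.ext hs)

instance : IsGood (yonedaGrpObj G) where
  existsUnique {R} _ σ {C} _ _ w h₁ h₂ := by
    have ex : ∃ z : Spec (.of (DualRing C C)) ⟶ G.left,
        Spec.map (CommRingCat.ofHom (smashHom R C).toRingHom) ≫ z = ptsLeft σ w := by
      refine exists_descent _ smashHom_injective _ fun P => ?_
      let p : PrimeSpectrum C := PrimeSpectrum.comap (DualRing.inl R C C).toRingHom P
      let u := ptsLeft σ (1 : Pts σ (yonedaGrpObj G) C)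
      let j := G.left.affineOpenCover.f (G.left.affineOpenCover.idx (u p))
      have hp : p ∈ u ⁻¹' Set.range j := G.left.affineOpenCover.covers (u p)
      obtain ⟨_, ⟨b, rfl⟩, hpb, hb⟩ :=
        PrimeSpectrum.isTopologicalBasis_basic_opens.exists_subset_of_mem_open hp
          (j.opensRange.2.preimage u.continuous)
      let l : C →ₐ[R] Localization.Away b := IsScalarTower.toAlgHom R C _
      have hl : IsLocAway l.toRingHom b := isLocAway_algebraMap C b
      obtain ⟨z, hz⟩ := exists_descent_affine σ
        (ptsMap σ (yonedaGrpObj G) (DualRing.mapRing (DualRing.mapRing l)) w)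
        (by
          rw [ptsMap_ptsMap]
          refine (ptsMap_ptsMap σ (yonedaGrpObj G) (DualRing.aug R (DualRing C C) (DualRing C C))
            (DualRing.mapRing l) w).symm.trans ?_
          rw [h₁, map_one])
        (by
          rw [ptsMap_ptsMap]
          refine (ptsMap_ptsMap σ (yonedaGrpObj G) (DualRing.mapRing (DualRing.aug R C C))
            (DualRing.mapRing l) w).symm.trans ?_
          rw [h₂, map_one]) j (by
          rintro _ ⟨x, rfl⟩
          rw [← map_one (ptsMap σ (yonedaGrpObj G) l), ptsLeft_ptsMap, Scheme.Hom.comp_apply]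
          refine hb ?_
          exact (Set.ext_iff.mp hl.range _).mp ⟨x, rfl⟩)
      refine ⟨DualRing.inl R C C b, hpb, _, _, inferInstance, inferInstance,
        (DualRing.mapRing l).toRingHom, (DualRing.mapRing (DualRing.mapRing l)).toRingHom,
        (smashHom R (Localization.Away b)).toRingHom, z, hl.mapRing, hl.mapRing.mapRing, ?_, hz⟩
      ext x <;> simp
    obtain ⟨z, hz⟩ := ex
    refine ⟨Over.homMk z ?_, ptsLeft_injective hz, ?_⟩
    · refine (cancel_epi (Spec.map (CommRingCat.ofHom (smashHom R C).toRingHom))).mp ?_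
      refine (Category.assoc _ _ _).symm.trans ((congrArg (· ≫ G.hom) hz).trans ?_)
      exact (Over.w (show specOver σ _ ⟶ G from w)).trans (Over.w (specOverMap σ (smashHom R C))).symm
    · intro z' hz'
      refine ptsLeft_injective ?_
      rw [← cancel_epi (Spec.map (CommRingCat.ofHom (smashHom R C).toRingHom))]
      exact (congrArg (ptsLeft σ) hz').trans hz.symm

end Good

end Presheaves

/-! ### Differential forms on affine schemes -/

section Forms

variable (R : Type u) (B : Type u) [CommRing R] [CommRing B] [Algebra R B]

/-- The module `Ωⁿ` of relative differential forms of degree `n` of the `R`-algebra `B`. -/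
abbrev Forms (n : ℕ) : Type u := ⋀[B]^n Ω[B⁄R]

variable {R B}

/-- The exterior product of forms. -/
def wedge (m n k : ℕ) (h : m + n = k) : Forms R B m →ₗ[B] Forms R B n →ₗ[B] Forms R B k :=
  LinearMap.mk₂ B
    (fun x y => ⟨x.1 * y.1, by
      subst h
      rw [ExteriorAlgebra.exteriorPower, pow_add]
      exact Submodule.mul_mem_mul x.2 y.2⟩)
    (fun x y z => Subtype.ext (add_mul _ _ _))
    (fun c x y => Subtype.ext (smul_mul_assoc _ _ _))
    (fun x y z => Subtype.ext (mul_add _ _ _))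
    (fun c x y => Subtype.ext (mul_smul_comm _ _ _))

@[simp] lemma coe_wedge {m n k : ℕ} (h : m + n = k) (x : Forms R B m) (y : Forms R B n) :
    (wedge m n k h x y : ExteriorAlgebra B Ω[B⁄R]) = x * y := rfl

/-- A Kähler differential as a form of degree `1`. -/
def oneForm : Ω[B⁄R] →ₗ[B] Forms R B 1 :=
  LinearMap.codRestrict _ (ExteriorAlgebra.ι B) fun x => by
    rw [ExteriorAlgebra.exteriorPower, pow_one]
    exact ⟨x, rfl⟩

@[simp] lemma coe_oneForm (x : Ω[B⁄R]) :
    (oneForm x : ExteriorAlgebra B Ω[B⁄R]) = ExteriorAlgebra.ι B x := rfl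

/-- The form `db₁ ∧ … ∧ dbₙ`. -/
def dForm {n : ℕ} (b : Fin n → B) : Forms R B n :=
  exteriorPower.ιMulti B n fun i => KaehlerDifferential.D R B (b i)

/-- The group `Ωⁿ⁺¹ × Ωⁿ`, with the action of `B` given by
`b • (w, v) = (b w + db ∧ v, b v)`. A map `d : Ωⁿ → Ωⁿ⁺¹` satisfies the Leibniz rule
`d(b v) = b dv + db ∧ v` if and only if `v ↦ (dv, v)` is linear. -/
@[ext]
structure Twisted (R B : Type u) [CommRing R] [CommRing B] [Algebra R B] (n : ℕ) : Type u where
  fst : Forms R B (n + 1)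
  snd : Forms R B n

namespace Twisted

variable {n : ℕ}

instance : Zero (Twisted R B n) := ⟨⟨0, 0⟩⟩
instance : Add (Twisted R B n) := ⟨fun x y => ⟨x.fst + y.fst, x.snd + y.snd⟩⟩
instance : Neg (Twisted R B n) := ⟨fun x => ⟨-x.fst, -x.snd⟩⟩
instance : SMul B (Twisted R B n) :=
  ⟨fun b x => ⟨b • x.fst +
    wedge 1 n (n + 1) (add_comm 1 n) (oneForm (KaehlerDifferential.D R B b)) x.snd, b • x.snd⟩⟩

@[simp] lemma fst_zero : (0 : Twisted R B n).fst = 0 := rfl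
@[simp] lemma snd_zero : (0 : Twisted R B n).snd = 0 := rfl
@[simp] lemma fst_add (x y : Twisted R B n) : (x + y).fst = x.fst + y.fst := rfl
@[simp] lemma snd_add (x y : Twisted R B n) : (x + y).snd = x.snd + y.snd := rfl
@[simp] lemma fst_neg (x : Twisted R B n) : (-x).fst = -x.fst := rfl
@[simp] lemma snd_neg (x : Twisted R B n) : (-x).snd = -x.snd := rfl
@[simp] lemma fst_smul (b : B) (x : Twisted R B n) : (b • x).fst = b • x.fst +
    wedge 1 n (n + 1) (add_comm 1 n) (oneForm (KaehlerDifferential.D R B b)) x.snd := rfl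
@[simp] lemma snd_smul (b : B) (x : Twisted R B n) : (b • x).snd = b • x.snd := rfl

instance : AddCommGroup (Twisted R B n) where
  add_assoc x y z := by ext1 <;> simp [add_assoc]
  zero_add x := by ext1 <;> simp
  add_zero x := by ext1 <;> simp
  add_comm x y := by ext1 <;> simp [add_comm]
  neg_add_cancel x := by ext1 <;> simp
  nsmul := nsmulRec
  zsmul := zsmulRec

instance : Module B (Twisted R B n) where
  one_smul x := by ext1 <;> simp
  mul_smul b c x := by
    ext1
    · simp only [fst_smul, snd_smul, Derivation.leibniz, map_add, LinearMap.add_apply, map_smul,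
        LinearMap.smul_apply, smul_add, mul_smul]
      abel
    · simp [mul_smul]
  smul_zero b := by ext1 <;> simp
  smul_add b x y := by
    ext1
    · simp only [fst_smul, fst_add, snd_add, smul_add, map_add]
      abel
    · simp
  add_smul b c x := by
    ext1
    · simp only [fst_smul, fst_add, map_add, LinearMap.add_apply, add_smul]
      abel
    · simp [add_smul]
  zero_smul x := by ext1 <;> simp

instance : Module R (Twisted R B n) := Module.compHom _ (algebraMap R B)

lemma algebra_smul (r : R) (x : Twisted R B n) : r • x = algebraMap R B r • x := rfl

instance : IsScalarTower R B (Twisted R B n) :=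
  ⟨fun r b x => by rw [algebra_smul, Algebra.smul_def, mul_smul]⟩

@[simp] lemma fst_algebra_smul (r : R) (x : Twisted R B n) : (r • x).fst = r • x.fst := by
  rw [algebra_smul, fst_smul, Derivation.map_algebraMap, map_zero, map_zero, LinearMap.zero_apply,
    add_zero, algebraMap_smul]

@[simp] lemma snd_algebra_smul (r : R) (x : Twisted R B n) : (r • x).snd = r • x.snd := by
  rw [algebra_smul, snd_smul, algebraMap_smul]

end Twisted

lemma ι_mul_ι_comm (x y : Ω[B⁄R]) : ExteriorAlgebra.ι B x * ExteriorAlgebra.ι B y =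
    -(ExteriorAlgebra.ι B y * ExteriorAlgebra.ι B x) :=
  eq_neg_of_add_eq_zero_left (ExteriorAlgebra.ι_add_mul_swap x y)

lemma twoForm_mul_ι (v : Forms R B 2) (x : Ω[B⁄R]) :
    (v : ExteriorAlgebra B Ω[B⁄R]) * ExteriorAlgebra.ι B x = ExteriorAlgebra.ι B x * v := by
  obtain ⟨v, hv⟩ := v
  rw [ExteriorAlgebra.exteriorPower, pow_two] at hv
  refine Submodule.mul_induction_on (C := fun v => v * ExteriorAlgebra.ι B x =
    ExteriorAlgebra.ι B x * v) hv ?_ ?_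
  · rintro _ ⟨a, rfl⟩ _ ⟨b, rfl⟩
    rw [mul_assoc, ι_mul_ι_comm b x, mul_neg, ← mul_assoc, ι_mul_ι_comm a x, neg_mul, neg_neg,
      mul_assoc]
  · intro y z hy hz
    rw [add_mul, mul_add, hy, hz]

variable (R B) in
/-- The exterior derivative on forms of degree `1`, in the form `ω ↦ (dω, ω)`. -/
def dOneAux : Ω[B⁄R] →ₗ[B] Twisted R B 1 :=
  Derivation.liftKaehlerDifferential
    { toFun b := ⟨0, oneForm (KaehlerDifferential.D R B b)⟩
      map_add' b c := by ext1 <;> simp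
      map_smul' r b := by
        ext1 <;> simp
      map_one_eq_zero' := by ext1 <;> simp
      leibniz' b c := by
        ext1
        · refine Subtype.ext ?_
          simp [ExteriorAlgebra.ι_add_mul_swap]
        · simp }

lemma dOneAux_snd (x : Ω[B⁄R]) : (dOneAux R B x).snd = oneForm x := by
  have : (⟨⟨Twisted.snd, fun _ _ => rfl⟩, fun _ _ => rfl⟩ : Twisted R B 1 →ₗ[B] Forms R B 1) ∘ₗ
      dOneAux R B = oneForm := by
    apply Derivation.liftKaehlerDifferential_unique
    ext b
    simp [dOneAux]
  exact congr($this x)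

/-- The exterior derivative `d : Ω¹ → Ω²`. -/
def dOne (x : Ω[B⁄R]) : Forms R B 2 := (dOneAux R B x).fst

lemma dOne_add (x y : Ω[B⁄R]) : dOne (x + y) = dOne x + dOne y := by simp [dOne]

lemma dOne_smul (b : B) (x : Ω[B⁄R]) : dOne (b • x) = b • dOne x +
    wedge 1 1 2 rfl (oneForm (KaehlerDifferential.D R B b)) (oneForm x) := by
  simp [dOne, dOneAux_snd]

lemma dOne_D (b : B) : dOne (KaehlerDifferential.D R B b) = 0 := by
  simp [dOne, dOneAux]

variable (R B) in
/-- The exterior derivative on forms of degree `2`, in the form `ω ↦ (dω, ω)`, as the alternating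
map `(x, y) ↦ (dx ∧ y - x ∧ dy, x ∧ y)`. -/
def dTwoAux : Ω[B⁄R] [⋀^Fin 2]→ₗ[B] Twisted R B 2 where
  toFun v := ⟨wedge 2 1 3 rfl (dOne (v 0)) (oneForm (v 1)) -
    wedge 1 2 3 rfl (oneForm (v 0)) (dOne (v 1)), wedge 1 1 2 rfl (oneForm (v 0)) (oneForm (v 1))⟩
  map_update_add' {inst} v i x y := by
    obtain rfl : inst = instDecidableEqFin 2 := Subsingleton.elim _ _
    fin_cases i
    · ext1
      · simp [dOne_add]; abel
      · simp
    · ext1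
      · simp [dOne_add]; abel
      · simp
  map_update_smul' {inst} v i b x := by
    obtain rfl : inst = instDecidableEqFin 2 := Subsingleton.elim _ _
    fin_cases i
    · ext1
      · refine Subtype.ext ?_
        simp [dOne_smul, smul_sub, mul_assoc]
        abel
      · simp
    · ext1
      · refine Subtype.ext ?_
        simp [dOne_smul, smul_sub, ← mul_assoc]
        rw [ι_mul_ι_comm]
        simp
        abel
      · simp
  map_eq_zero_of_eq' v i j hv hij := by
    have h : v 0 = v 1 := by
      fin_cases i <;> fin_cases j <;> simp_all
    ext1
    · refine Subtype.ext ?_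
      simp [h, twoForm_mul_ι]
    · refine Subtype.ext ?_
      simp [h]

variable (R B) in
/-- The exterior derivative `d : Ω² → Ω³`. -/
def dTwo : Forms R B 2 →ₗ[R] Forms R B 3 where
  toFun v := (exteriorPower.alternatingMapLinearEquiv (dTwoAux R B) v).fst
  map_add' v w := by simp
  map_smul' r v := by
    rw [← algebraMap_smul B r v, map_smul, ← Twisted.algebra_smul, Twisted.fst_algebra_smul]
    rfl

/-- The exterior derivative is determined by `d(b da ∧ dc) = db ∧ da ∧ dc`. -/
lemma dTwo_smul_dForm (b : B) (a : Fin 2 → B) :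
    dTwo R B (b • dForm a) = dForm (Fin.cons b a) := by
  refine Subtype.ext ?_
  have h : exteriorPower.alternatingMapLinearEquiv (dTwoAux R B) (dForm a) =
      dTwoAux R B fun i => KaehlerDifferential.D R B (a i) :=
    exteriorPower.alternatingMapLinearEquiv_apply_ιMulti _ _
  simp only [dTwo, LinearMap.coe_mk, AddHom.coe_mk, map_smul, h]
  simp [dTwoAux, dOne_D, dForm, ExteriorAlgebra.ιMulti_apply]
  rfl

end Forms

/-! ### Infinitesimal simplices and combinatorial differential forms -/

section Simplices

/-- The homomorphisms `a₀, …, aₙ : B → C` are infinitesimally close to each other. -/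
structure IsStronglyClose {B C : Type u} [CommRing B] [CommRing C] {n : ℕ}
    (a : Fin (n + 1) → (B →+* C)) : Prop where
  sq_zero : ∀ i j b b', (a i b - a j b) * (a i b' - a j b') = 0
  mul_zero : ∀ i j b, (a i b - a 0 b) * (a j b - a 0 b) = 0

lemma IsStronglyClose.reindex {B C : Type u} [CommRing B] [CommRing C] {m n : ℕ}
    {a : Fin (n + 1) → (B →+* C)} (ha : IsStronglyClose a) (τ : Fin (m + 1) → Fin (n + 1)) :
    IsStronglyClose fun i => a (τ i) where
  sq_zero i j := ha.sq_zero _ _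
  mul_zero i j b := by
    have h1 := ha.mul_zero (τ i) (τ j) b
    have h2 := ha.mul_zero (τ i) (τ 0) b
    have h3 := ha.mul_zero (τ 0) (τ j) b
    have h4 := ha.mul_zero (τ 0) (τ 0) b
    linear_combination h1 - h2 - h3 + h4

variable {S : Scheme.{u}} {X T T' : Over S} {m n : ℕ}

/-- The `T`-valued points `x₀, …, xₙ` of the `S`-scheme `X` are infinitesimally close to each other,
that is they define a `T`-valued point of the scheme `Δⁿ` of infinitesimal `n`-simplices of `X`:
they have the same underlying map of topological spaces, and they are given by infinitesimally close
homomorphisms of rings wherever they are described by maps between affine schemes. -/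
structure IsClose (x : Fin (n + 1) → (T ⟶ X)) : Prop where
  base : ∀ i j (p : T.left), (x i).left p = (x j).left p
  affine : ∀ (B C : Type u) [CommRing B] [CommRing C] (υ : Spec (.of B) ⟶ X.left)
    [IsOpenImmersion υ] (t : Spec (.of C) ⟶ T.left) (a : Fin (n + 1) → (B →+* C)),
    (∀ i, t ≫ (x i).left = Spec.map (CommRingCat.ofHom (a i)) ≫ υ) → IsStronglyClose a

/-- The `T`-valued points of the scheme `Δⁿ` of infinitesimal `n`-simplices of `X`. -/
def Simplex (X : Over S) (n : ℕ) (T : Over S) : Type u := {x : Fin (n + 1) → (T ⟶ X) // IsClose x}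

namespace Simplex

/-- The simplex `(x_τ(0), …, x_τ(m))`. -/
def reindex (x : Simplex X n T) (τ : Fin (m + 1) → Fin (n + 1)) : Simplex X m T :=
  ⟨fun i => x.1 (τ i), fun _ _ _ => x.2.base _ _ _, fun B C _ _ υ _ t a h => by
    have h0 : ∀ k, ∃ c : B →+* C,
        t ≫ (x.1 k).left = Spec.map (CommRingCat.ofHom c) ≫ υ := by
      intro k
      have hr : Set.range (t ≫ (x.1 k).left) ⊆ Set.range υ := by
        rintro _ ⟨p, rfl⟩
        refine ⟨Spec.map (CommRingCat.ofHom (a 0)) p, ?_⟩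
        rw [← Scheme.Hom.comp_apply, ← h 0, Scheme.Hom.comp_apply, Scheme.Hom.comp_apply]
        exact x.2.base _ _ _
      obtain ⟨c, hc⟩ := Spec.map_surjective (IsOpenImmersion.lift υ _ hr)
      exact ⟨c.hom, by rw [CommRingCat.ofHom_hom, hc, IsOpenImmersion.lift_fac]⟩
    choose c hc using h0
    have e : a = fun i => c (τ i) := by
      funext i
      have := (h i).symm.trans (hc (τ i))
      rw [cancel_mono] at this
      exact congrArg CommRingCat.Hom.hom (Spec.map_injective this)
    rw [e]
    exact (x.2.affine B C υ t c hc).reindex τ⟩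

/-- The restriction of a simplex along a morphism `T' ⟶ T`. -/
def pull (x : Simplex X n T) (g : T' ⟶ T) : Simplex X n T' :=
  ⟨fun i => g ≫ x.1 i, fun _ _ _ => x.2.base _ _ _, fun B C _ _ υ _ t a h =>
    x.2.affine B C υ (t ≫ g.left) a fun i => by
      rw [Category.assoc, ← Over.comp_left]; exact h i⟩

end Simplex

/-- A rule which assigns an element of `F(T)` to every `T`-valued point of `Δⁿ`. -/
def Cochain (F : (Over S)ᵒᵖ ⥤ GrpCat.{v}) (X : Over S) (n : ℕ) : Type (max (u + 1) v) :=
  ∀ T : Over S, Simplex X n T → F.obj (op T)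

/-- A combinatorial `F`-valued `n`-form on `X`: a morphism `f : Δⁿ ⟶ F` with `f(x₀, …, xₙ) = 1`
whenever `xᵢ = xᵢ₊₁` for some `i`. -/
structure IsForm {F : (Over S)ᵒᵖ ⥤ GrpCat.{v}} (f : Cochain F X n) : Prop where
  natural : ∀ {T T' : Over S} (g : T' ⟶ T) (x : Simplex X n T),
    F.map g.op (f T x) = f T' (x.pull g)
  degenerate : ∀ {T : Over S} (x : Simplex X n T) (i : Fin n), x.1 i.castSucc = x.1 i.succ →
    f T x = 1

/-- The combinatorial differential
`δ²_χ(φ)(x, y, z, u) = χ(x, y)(φ(y, z, u)) φ(x, y, u) φ(x, u, z) φ(x, z, y)`. -/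
def delta2 {F : (Over S)ᵒᵖ ⥤ GrpCat.{v}} (χ : Cochain (autPresheaf F) X 1) (φ : Cochain F X 2) :
    Cochain F X 3 := fun T x =>
  AutSection.eval (χ T (x.reindex ![0, 1])) (φ T (x.reindex ![1, 2, 3])) *
    φ T (x.reindex ![0, 1, 3]) * φ T (x.reindex ![0, 3, 2]) * φ T (x.reindex ![0, 2, 1])

end Simplices

/-! ### Classical forms and the combinatorial forms which they define -/

section Evaluation

variable {R B C : Type u} [CommRing R] [CommRing B] [CommRing C] [Algebra R B] [Algebra R C]

/-- The ring `C`, regarded as an algebra over `B` through `f : B → C`. -/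
def Along (_ : B →ₐ[R] C) : Type u := C

namespace Along

variable (f : B →ₐ[R] C)

instance : CommRing (Along f) := inferInstanceAs (CommRing C)
instance : Algebra R (Along f) := inferInstanceAs (Algebra R C)
instance : Algebra B (Along f) := f.toRingHom.toAlgebra
instance : IsScalarTower R B (Along f) := IsScalarTower.of_algebraMap_eq fun r => (f.commutes r).symm

lemma smul_def (b : B) (c : Along f) : b • c = (show Along f from f b) * c := rfl

end Along

variable {n : ℕ} (x : Fin (n + 1) → (B →ₐ[R] C))
  (hx : IsStronglyClose fun i => (x i : B →+* C))

/-- The `B`-linear map `Ω → C` with `db ↦ xᵢ(b) - x₀(b)`, where `B` acts on `C` through `x₀`. -/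
def evalOne (i : Fin (n + 1)) : Ω[B⁄R] →ₗ[B] Along (x 0) :=
  Derivation.liftKaehlerDifferential
    { toFun b := (show Along (x 0) from x i b - x 0 b)
      map_add' b c := by
        change (x i (b + c) - x 0 (b + c) : C) = (x i b - x 0 b) + (x i c - x 0 c)
        rw [map_add, map_add]; ring
      map_smul' r b := by
        change (x i (r • b) - x 0 (r • b) : C) = r • (x i b - x 0 b)
        rw [map_smul, map_smul, smul_sub]
      map_one_eq_zero' := by
        change (x i 1 - x 0 1 : C) = 0
        rw [map_one, map_one, sub_self]
      leibniz' b c := by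
        change (x i (b * c) - x 0 (b * c) : C) =
          x 0 b * (x i c - x 0 c) + x 0 c * (x i b - x 0 b)
        have := hx.sq_zero i 0 b c
        simp only [RingHom.coe_coe] at this
        rw [map_mul, map_mul]
        linear_combination this }

lemma evalOne_D (i : Fin (n + 1)) (b : B) :
    evalOne x hx i (KaehlerDifferential.D R B b) = (show Along (x 0) from x i b - x 0 b) :=
  Derivation.liftKaehlerDifferential_comp_D _ _

lemma evalOne_mul_self (i : Fin (n + 1)) (ω η : Ω[B⁄R]) :
    evalOne x hx i ω * evalOne x hx i η = 0 := by
  have h : (LinearMap.mul B (Along (x 0))).compl₁₂ (evalOne x hx i) (evalOne x hx i) = 0 := by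
    apply Derivation.liftKaehlerDifferential_unique
    ext b : 1
    apply Derivation.liftKaehlerDifferential_unique
    ext c
    simp [evalOne_D]
    exact hx.sq_zero i 0 b c
  exact congr($h ω η)

lemma evalOne_mul_swap (i j : Fin (n + 1)) (ω η : Ω[B⁄R]) :
    evalOne x hx i ω * evalOne x hx j η + evalOne x hx i η * evalOne x hx j ω = 0 := by
  have h : (LinearMap.mul B (Along (x 0))).compl₁₂ (evalOne x hx i) (evalOne x hx j) +
      (LinearMap.mul B (Along (x 0))).compl₁₂ (evalOne x hx j) (evalOne x hx i) = 0 := by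
    apply Derivation.liftKaehlerDifferential_unique
    ext b : 1
    apply Derivation.liftKaehlerDifferential_unique
    ext c
    simp [evalOne_D]
    change (x i b - x 0 b) * (x j c - x 0 c) + (x j b - x 0 b) * (x i c - x 0 c) = 0
    have h1 := hx.mul_zero i j (b + c)
    have h2 := hx.mul_zero i j b
    have h3 := hx.mul_zero i j c
    simp only [RingHom.coe_coe, map_add] at h1 h2 h3
    linear_combination h1 - h2 - h3
  have := congr($h ω η)
  rw [mul_comm (evalOne x hx i η)]
  exact this

lemma evalOne_mul (i j : Fin (n + 1)) (ω : Ω[B⁄R]) :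
    evalOne x hx i ω * evalOne x hx j ω = 0 := by
  have hω : ω ∈ Submodule.span B (Set.range (KaehlerDifferential.D R B)) := by
    rw [KaehlerDifferential.span_range_derivation]; trivial
  induction hω using Submodule.span_induction with
  | mem ω h =>
    obtain ⟨b, rfl⟩ := h
    rw [evalOne_D, evalOne_D]
    exact hx.mul_zero i j b
  | zero => simp
  | add ω η _ _ h1 h2 =>
    rw [map_add, map_add]
    linear_combination h1 + h2 + evalOne_mul_swap x hx i j ω η
  | smul b ω _ h =>
    rw [map_smul, map_smul, smul_mul_smul_comm, h, smul_zero]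

/-- The map `Ωⁿ → C` with `c db₁ ∧ … ∧ dbₙ ↦ x₀(c) (x₁(b₁) - x₀(b₁)) ⋯ (xₙ(bₙ) - x₀(bₙ))`. -/
def evalForm : Forms R B n →ₗ[B] Along (x 0) :=
  exteriorPower.alternatingMapLinearEquiv
    { (MultilinearMap.mkPiAlgebra B (Fin n) (Along (x 0))).compLinearMap
        fun i => evalOne x hx i.succ with
      map_eq_zero_of_eq' v i j hv hij := by
        have h : ∏ k ∈ {i, j}, evalOne x hx k.succ (v k) ∣ ∏ k, evalOne x hx k.succ (v k) :=
          Finset.prod_dvd_prod_of_subset _ _ _ (Finset.subset_univ _)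
        rw [Finset.prod_pair hij, hv, evalOne_mul, zero_dvd_iff] at h
        exact h }

lemma evalForm_ιMulti (ω : Fin n → Ω[B⁄R]) : evalForm x hx (exteriorPower.ιMulti B n ω) =
    ∏ i : Fin n, evalOne x hx i.succ (ω i) :=
  exteriorPower.alternatingMapLinearEquiv_apply_ιMulti _ _

lemma evalForm_smul_dForm (c : B) (b : Fin n → B) : evalForm x hx (c • dForm b) =
    (show Along (x 0) from x 0 c * ∏ i : Fin n, (x i.succ (b i) - x 0 (b i))) := by
  rw [map_smul, dForm, evalForm_ιMulti, Along.smul_def]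
  simp only [evalOne_D]
  rfl

lemma evalForm_mul [NeZero n] (v w : Forms R B n) : evalForm x hx v * evalForm x hx w = 0 := by
  have h : (LinearMap.mul B (Along (x 0))).compl₁₂ (evalForm x hx) (evalForm x hx) = 0 := by
    ext ω : 2
    refine exteriorPower.linearMap_ext ?_
    ext η
    have h : evalOne x hx (Fin.succ 0) (ω 0) * evalOne x hx (Fin.succ 0) (η 0) ∣
        (∏ i : Fin n, evalOne x hx i.succ (ω i)) * ∏ i : Fin n, evalOne x hx i.succ (η i) :=
      mul_dvd_mul (Finset.dvd_prod_of_mem _ (Finset.mem_univ _))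
        (Finset.dvd_prod_of_mem _ (Finset.mem_univ _))
    rw [evalOne_mul_self, zero_dvd_iff, ← evalForm_ιMulti, ← evalForm_ιMulti] at h
    exact h
  exact congr($h v w)

/-- The homomorphism `D_B(Ωⁿ) → C` given by `x₀ : B → C` and the evaluation of forms
on `(x₀, …, xₙ)`. -/
def evalHom [NeZero n] : DualRing B (Forms R B n) →ₐ[R] C :=
  DualRing.lift (x 0) (evalForm x hx).toAddMonoidHom
    (fun c v => (evalForm x hx).map_smul c v) (evalForm_mul x hx)

end Evaluation

section LieForms

variable {S : Scheme.{u}} {R B : Type u} [CommRing R] [CommRing B] [Algebra R B]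
  (σ : Spec (.of R) ⟶ S) (F : (Over S)ᵒᵖ ⥤ GrpCat.{v})

/-- The forms `Lie(F)(R) ⊗ Ωⁿ` of degree `n` of the `R`-algebra `B` with values in the Lie algebra
of `F`. -/
abbrev LieForms (R B : Type u) [CommRing R] [CommRing B] [Algebra R B] (σ : Spec (.of R) ⟶ S)
    (F : (Over S)ᵒᵖ ⥤ GrpCat.{v}) [InfLinear F] (n : ℕ) : Type (max u v) :=
  LieMod σ F R R ⊗[R] Forms R B n

/-- The forms `Lie(F)(B) ⊗ Ωⁿ` of degree `n` of the `R`-algebra `B` with values in the pullback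
of the Lie algebra of `F`. -/
abbrev LieFormsOn (R B : Type u) [CommRing R] [CommRing B] [Algebra R B] (σ : Spec (.of R) ⟶ S)
    (F : (Over S)ᵒᵖ ⥤ GrpCat.{v}) [InfLinear F] (n : ℕ) : Type (max u v) :=
  LieMod σ F B B ⊗[B] Forms R B n

variable {σ F} in
/-- The map `Lie(F)(R) ⊗_R Ωⁿ → Lie(F)(B) ⊗_B Ωⁿ`. -/
def toOn [InfLinear F] {n : ℕ} : LieForms R B σ F n →+ LieFormsOn R B σ F n :=
  TensorProduct.liftAddHom
    { toFun Y := ((TensorProduct.mk B (LieMod σ F B B) (Forms R B n))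
        (LieMod.mapRing (Algebra.ofId R B) Y)).toAddMonoidHom
      map_zero' := by ext; simp
      map_add' Y Z := by ext; simp }
    (fun r Y ω => by
      change _ ⊗ₜ[B] _ = _ ⊗ₜ[B] _
      rw [LieMod.mapRing_smul, TensorProduct.smul_tmul, Algebra.ofId_apply, algebraMap_smul])

@[simp] lemma toOn_tmul [InfLinear F] {n : ℕ} (Y : LieMod σ F R R) (ω : Forms R B n) :
    toOn (Y ⊗ₜ[R] ω) = LieMod.mapRing (Algebra.ofId R B) Y ⊗ₜ[B] ω := rfl

variable {σ F} in
/-- The classical differential `d(Y ⊗ ω) = Y ⊗ dω`. -/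
def dLie [InfLinear F] : LieForms R B σ F 2 →ₗ[R] LieForms R B σ F 3 :=
  LinearMap.lTensor (LieMod σ F R R) (dTwo R B)

variable {σ F} in
/-- The bracket `[Y ⊗ ω, Z ⊗ η] = [Y, Z] ⊗ (ω ∧ η)` of forms with values in `Lie(Aut(F))` and in
`Lie(F)`. -/
def bracketForms [InfLinear F] [InfLinear (autPresheaf F)] [IsGood F] (m n k : ℕ) (h : m + n = k) :
    LieFormsOn R B σ (autPresheaf F) m →ₗ[B] LieFormsOn R B σ F n →ₗ[B] LieFormsOn R B σ F k :=
  TensorProduct.map₂ (LieMod.bracketₗ (σ := σ) (F := F) (C := B)) (wedge m n k h)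

variable {σ F} in
lemma bracketForms_tmul [InfLinear F] [InfLinear (autPresheaf F)] [IsGood F] {m n k : ℕ}
    (h : m + n = k) (Y : LieMod σ (autPresheaf F) B B) (Z : LieMod σ F B B) (ω : Forms R B m)
    (η : Forms R B n) : bracketForms m n k h (Y ⊗ₜ[B] ω) (Z ⊗ₜ[B] η) =
      LieMod.bracket Y Z ⊗ₜ[B] wedge m n k h ω η := rfl

end LieForms

/-- An affine chart of the `S`-scheme `X`: an affine open subscheme `Spec R` of `S` and an affine
open subscheme `Spec B` of `X` that lies over it. -/
structure AffineChart {S : Scheme.{u}} (X : Over S) (R B : Type u) [CommRing R] [CommRing B]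
    [Algebra R B] where
  base : Spec (.of R) ⟶ S
  map : Spec (.of B) ⟶ X.left
  isOpenImmersion_base : IsOpenImmersion base
  isOpenImmersion_map : IsOpenImmersion map
  comp_hom : map ≫ X.hom = Spec.map (CommRingCat.ofHom (algebraMap R B)) ≫ base

namespace AffineChart

variable {S : Scheme.{u}} {X : Over S} {R B : Type u} [CommRing R] [CommRing B] [Algebra R B]
  (c : AffineChart X R B)

/-- The `C`-valued point of `X` given by a homomorphism of `R`-algebras `B → C`. -/
def point {C : Type u} [CommRing C] [Algebra R C] (a : B →ₐ[R] C) : specOver c.base C ⟶ X :=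
  Over.homMk (Spec.map (CommRingCat.ofHom a.toRingHom) ≫ c.map) (by
    refine (Category.assoc _ _ _).trans ?_
    rw [c.comp_hom]
    exact Over.w (specOverMap c.base a))

lemma isStronglyClose {C : Type u} [CommRing C] [Algebra R C] {n : ℕ}
    {x : Fin (n + 1) → (B →ₐ[R] C)} (hx : IsClose fun i => c.point (x i)) :
    IsStronglyClose fun i => (x i : B →+* C) :=
  have := c.isOpenImmersion_map
  hx.affine B C c.map (𝟙 _) (fun i => (x i : B →+* C)) fun _ => Category.id_comp _

/-- The restriction of `f` to the chart is the combinatorial form defined by the classical form `v`: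
for `v = Y ⊗ (c db₁ ∧ … ∧ dbₙ)` and homomorphisms `x₀, …, xₙ : B → C` that are infinitesimally close
to each other, `f(x₀, …, xₙ)` is the image of `Y ∈ F(B[ε])` under the homomorphism `B[ε] → C` which is
`x₀` on `B` and sends `ε` to `x₀(c) (x₁(b₁) - x₀(b₁)) ⋯ (xₙ(bₙ) - x₀(bₙ))`. -/
def Represents {F : (Over S)ᵒᵖ ⥤ GrpCat.{v}} [InfLinear F] {n : ℕ} [NeZero n]
    (v : LieFormsOn R B c.base F n) (f : Cochain F X n) : Prop :=
  ∀ (C : Type u) [CommRing C] [Algebra R C] (x : Fin (n + 1) → (B →ₐ[R] C))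
    (hx : IsClose fun i => c.point (x i)),
    f (specOver c.base C) ⟨fun i => c.point (x i), hx⟩ =
      ptsMap c.base F (evalHom x (c.isStronglyClose hx))
        (LieMod.ofTensor (σ := c.base) (F := F) (C := B) (M := Forms R B n) v).val

end AffineChart

end CombForms

end

/-! The formula. On an affine chart, the value of a Lie-valued form on infinitesimally close points
comes from an element of `Lie(F)(C) ⊗ J` through the homomorphism `LieMod.value`, where `J` is an
ideal of square zero containing the values of the scalar forms. For the faces of a tetrahedron `x₀,
…, x₃` one `J` serves all four: the ideal generated by the products `(xᵢ(a) - x₀(a)) (xⱼ(b) -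
x₀(b))`. It has square zero since four indices taken from 1, 2, 3 must repeat (`faceIdeal_mul`). So
the face values commute, and their product in `G(C)` is a sum in `Lie(G)(C) ⊗ J`. Write `χ(g) = {χ,
g} g`, where `{u, g} = u(g) g⁻¹`. Then `δ²_χ(φ)` is a commutator times the product of the four face
values. The product is the value of `dφ`, by expanding differences (`formValue_dTwo`); the
coefficients of `φ` come from `Lie(G)(R)`, so the face which starts at `x₁` rather than `x₀` needs
no change of coefficients. The commutator is the value of `[χ, φ]`, because `{Y(s), Z(t)} = [Y, Z](s
t)` (`LieMod.autComm_value`) and the value of a wedge is a product of values (`formValue_wedge`).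
This gives `AffineChart.represents_delta2`.

Existence of the representing forms. A combinatorial form is evaluated on a universal simplex. For
1-forms the universal edge lives over `D_B(Ω¹)`, and infinitesimal linearity is all that is needed;
this matters because `Aut(G)` has no chart of its own. For 2-forms the universal triangle lives over
`B ⊕ Ω e₁ ⊕ Ω e₂ ⊕ Ω² e₁ e₂`. The value there is a homomorphism out of an affine neighbourhood of
the unit of `G`, and the two degeneracy conditions remove its edge components, leaving a derivation
with values in `Ω²`. For the 3-form `δ²_χ(φ)` existence is the formula itself.

Uniqueness. For 1-forms the evaluation at the universal edge is the identity. For `G`-valued forms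
of any positive degree, the universal simplex inside `Λ(Ω) ⊗ Λ(Bⁿ)` sends `v` to `v ⊗ e₁ ∧ … ∧ eₙ`,
which is injective. Coordinates on `Lie(G)` from a basis of `Ω[A⁄R]` identify `Lie(G)(R) ⊗ Ωⁿ` with
`Lie(G)(B) ⊗ Ωⁿ` (`UnitChart.toOn_bijective`).

Finally, the value of a classical form vanishes on degenerate simplices, so local representability
of `δ²_χ(φ)` makes it a combinatorial form (`isForm_of_represents`). -/

noncomputable section

namespace CombForms

/-! ### Lie algebras with coefficients -/

section LieModules

variable {S : Scheme.{u}} {R : Type u} [CommRing R] {σ : Spec (.of R) ⟶ S}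
  {F : (Over S)ᵒᵖ ⥤ GrpCat.{v}} {B C C' C'' M N : Type u} [CommRing B] [Algebra R B] [CommRing C]
  [Algebra R C] [CommRing C'] [Algebra R C'] [CommRing C''] [Algebra R C'']
  [AddCommGroup M] [AddCommGroup N]

namespace LieMod

lemma mapRing_mapRing (f : C →ₐ[R] C') (g : C' →ₐ[R] C'') (y : LieMod σ F C C) :
    mapRing g (mapRing f y) = mapRing (g.comp f) y := by
  ext
  simp only [val_mapRing, ptsMap_ptsMap]
  rfl

@[simp] lemma ofTensor_tmul [InfLinear F] [Module C M] (Y : LieMod σ F C C) (m : M) :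
    ofTensor σ C F M (Y ⊗ₜ[C] m) = mapMod (LinearMap.toSpanSingleton C M m) Y := rfl

lemma mapMod_sum [InfLinear F] [Module C M] [Module C N] {ι : Type*} (s : Finset ι)
    (g : ι → M →ₗ[C] N) (y : LieMod σ F C M) :
    mapMod (∑ i ∈ s, g i) y = ∑ i ∈ s, mapMod (g i) y := by
  classical
  induction s using Finset.induction_on with
  | empty => simp [mapMod_zero]
  | insert i s hi ih => rw [Finset.sum_insert hi, Finset.sum_insert hi, mapMod_add, ih]

/-- `Lie(F)(C) ⊗ M = Lie(F, M)` for a finite free module `M`. -/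
lemma ofTensor_bijective [InfLinear F] [Module C M] [Module.Free C M] [Module.Finite C M] :
    Function.Bijective (ofTensor σ C F M) := by
  let b := Module.Free.chooseBasis C M
  -- A basis writes the identity of `M` as a finite sum of maps `M → C → M`, and `Lie(F, -)` is
  -- additive in linear maps.
  let inv (y : LieMod σ F C M) : LieMod σ F C C ⊗[C] M := ∑ i, mapMod (b.coord i) y ⊗ₜ[C] b i
  refine Function.bijective_iff_has_inverse.mpr ⟨inv, fun t => ?_, fun y => ?_⟩
  · induction t with
    | zero => simp [inv]
    | add s t hs ht =>
      simp only [inv, map_add, TensorProduct.add_tmul, Finset.sum_add_distrib] at hs ht ⊢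
      rw [hs, ht]
    | tmul Y m =>
      have h : ∀ i, mapMod (b.coord i) (mapMod (LinearMap.toSpanSingleton C M m) Y) =
          b.coord i m • Y := fun i => by
        rw [← mapMod_comp, smul_def]
        refine mapMod_congr ?_ _
        ext; simp
      simp only [inv, ofTensor_tmul, h, TensorProduct.smul_tmul, ← TensorProduct.tmul_sum]
      congr 1
      exact b.sum_repr m
  · simp only [inv, map_sum, ofTensor_tmul, ← mapMod_comp, ← mapMod_sum]
    refine (mapMod_congr ?_ y).trans (mapMod_id y)
    ext m
    simp

/-- The map `Lie(F)(B) ⊗ M → Lie(F)(C) ⊗ N` attached to a homomorphism `g : B → C` and a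
`g`-linear map `M → N`. -/
def baseChange [InfLinear F] [Module B M] [Module C N] (g : B →ₐ[R] C) (f : M →+ N)
    (hf : ∀ b m, f (b • m) = g b • f m) :
    LieMod σ F B B ⊗[B] M →+ LieMod σ F C C ⊗[C] N :=
  TensorProduct.liftAddHom
    { toFun Y := ((TensorProduct.mk C (LieMod σ F C C) N (mapRing g Y)).toAddMonoidHom).comp f
      map_zero' := by ext; simp
      map_add' Y Z := by ext; simp }
    (fun b Y m => by
      change _ ⊗ₜ[C] _ = _ ⊗ₜ[C] _
      rw [mapRing_smul, TensorProduct.smul_tmul, hf])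

@[simp] lemma baseChange_tmul [InfLinear F] [Module B M] [Module C N] (g : B →ₐ[R] C) (f : M →+ N)
    (hf) (Y : LieMod σ F B B) (m : M) :
    baseChange g f hf (Y ⊗ₜ[B] m) = mapRing g Y ⊗ₜ[C] f m := rfl

variable (R) in
/-- The homomorphism `D_C(J) → C` for an ideal `J` of square zero. -/
def idealHom (J : Ideal C) (hJ : ∀ a ∈ J, ∀ b ∈ J, a * b = 0) : DualRing C J →ₐ[R] C :=
  DualRing.lift (AlgHom.id R C) J.subtype.toAddMonoidHom (fun _ _ => rfl)
    fun m m' => hJ _ m.2 _ m'.2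

@[simp] lemma idealHom_apply (J : Ideal C) (hJ) (x : DualRing C J) :
    idealHom R J hJ x = x.fst + (x.snd : C) := rfl

/-- The homomorphism `Lie(F)(C) ⊗ J → F(C)` for an ideal `J` of square zero, which sends `Y ⊗ s`
to `Y(s)`. -/
def value [InfLinear F] (J : Ideal C) (hJ : ∀ a ∈ J, ∀ b ∈ J, a * b = 0)
    (t : LieMod σ F C C ⊗[C] J) : Pts σ F C :=
  ptsMap σ F (idealHom R J hJ) (ofTensor σ C F J t).val

section Value

variable [InfLinear F] (J : Ideal C) (hJ : ∀ a ∈ J, ∀ b ∈ J, a * b = 0)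

@[simp] lemma value_zero : value J hJ (0 : LieMod σ F C C ⊗[C] J) = 1 := by
  simp [value]

lemma value_add (s t : LieMod σ F C C ⊗[C] J) :
    value J hJ (s + t) = value J hJ s * value J hJ t := by
  simp [value]

/-- `F(C)` need not be commutative, but these elements are images of a commutative group. -/
lemma value_mul_comm (s t : LieMod σ F C C ⊗[C] J) :
    value J hJ s * value J hJ t = value J hJ t * value J hJ s := by
  rw [← value_add, add_comm, value_add]

lemma value_tmul (Y : LieMod σ F C C) (s : J) : value J hJ (Y ⊗ₜ[C] s) =
    ptsMap σ F ((idealHom R J hJ).comp (DualRing.mapMod R (LinearMap.toSpanSingleton C J s)))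
      Y.val := by
  simp [value, ptsMap_ptsMap]

/-- Moves an evaluation out of `D_B(M)` into `Lie(F)(C) ⊗ J`. There the values of one form at
several simplices, whose evaluation homomorphisms differ, can be added. -/
lemma ptsMap_ofTensor_val [Module B M] (h : DualRing B M →ₐ[R] C) (g : B →ₐ[R] C) (f : M →+ J) (hf)
    (hfg : ∀ x, h x = g x.fst + f x.snd) (t : LieMod σ F B B ⊗[B] M) :
    ptsMap σ F h (ofTensor σ B F M t).val = value J hJ (baseChange g f hf t) := by
  induction t with
  | zero => simp
  | add s t hs ht => rw [map_add, val_add, map_mul, hs, ht, map_add, value_add]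
  | tmul Y m =>
    rw [baseChange_tmul, value_tmul, ofTensor_tmul, val_mapMod, val_mapRing, ptsMap_ptsMap,
      ptsMap_ptsMap]
    congr 2
    ext x
    simp [hfg, hf]

end Value

variable [InfLinear F] [InfLinear (autPresheaf F)] [IsGood F]

/-- The defining identity over `C[ε₀, ε₁]` is stable under base change, and it determines the
bracket over `C'`. -/
lemma mapRing_bracket (f : C →ₐ[R] C') (Y : LieMod σ (autPresheaf F) C C) (Z : LieMod σ F C C) :
    mapRing f (bracket Y Z) = bracket (mapRing f Y) (mapRing f Z) := by
  refine eq_bracket _ _ _ ?_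
  have h := congrArg (ptsMap σ F (DualRing.mapRing (DualRing.mapRing f))) (smash_bracket Y Z)
  rw [preBracket, ptsMap_autComm, ptsMap_ptsMap, ptsMap_ptsMap, ptsMap_ptsMap] at h
  rw [val_mapRing, ptsMap_ptsMap, preBracket, val_mapRing, val_mapRing, ptsMap_ptsMap,
    ptsMap_ptsMap]
  have h1 : (DualRing.mapRing (DualRing.mapRing f)).comp (smashHom R C) =
      (smashHom R C').comp (DualRing.mapRing f) := by
    ext x <;> simp
  have h2 : (DualRing.mapRing (DualRing.mapRing f)).comp (DualRing.inl R _ _) =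
      (DualRing.inl R (DualRing C' C') (DualRing C' C')).comp (DualRing.mapRing f) := by
    ext x <;> simp
  have h3 : (DualRing.mapRing (DualRing.mapRing f)).comp (DualRing.mapRing (DualRing.inl R C C)) =
      (DualRing.mapRing (DualRing.inl R C' C')).comp (DualRing.mapRing f) := by
    ext x <;> simp
  rw [h1, h2, h3] at h
  exact h

/-- The bracket `Lie(Aut(F))(C) ⊗ I × Lie(F)(C) ⊗ J → Lie(F)(C) ⊗ J` with
`[Y ⊗ s, Z ⊗ t] = [Y, Z] ⊗ s t`. -/
def bracketIdeal (I J : Ideal C) : LieMod σ (autPresheaf F) C C ⊗[C] I →ₗ[C]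
    LieMod σ F C C ⊗[C] J →ₗ[C] LieMod σ F C C ⊗[C] J :=
  TensorProduct.map₂ (bracketₗ σ C F) ((LinearMap.lsmul C J).comp I.subtype)

@[simp] lemma bracketIdeal_tmul (I J : Ideal C) (Y : LieMod σ (autPresheaf F) C C) (s : I)
    (Z : LieMod σ F C C) (t : J) :
    bracketIdeal I J (Y ⊗ₜ[C] s) (Z ⊗ₜ[C] t) = bracket Y Z ⊗ₜ[C] ((s : C) • t) := rfl

/-- The scalar factor of a double bracket lies in `I · I = 0`. This is what makes the action of
`Y(s)` on a commutator `{Y'(s'), Z(t)}` trivial. -/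
lemma bracketIdeal_bracketIdeal (I J : Ideal C) (hI : ∀ a ∈ I, ∀ b ∈ I, a * b = 0)
    (s t : LieMod σ (autPresheaf F) C C ⊗[C] I) (w : LieMod σ F C C ⊗[C] J) :
    bracketIdeal I J s (bracketIdeal I J t w) = 0 := by
  induction s with
  | zero => simp
  | add s s' h h' => rw [map_add, LinearMap.add_apply, h, h', add_zero]
  | tmul Y a =>
    induction t with
    | zero => simp
    | add t t' h h' => rw [map_add, LinearMap.add_apply, map_add, h, h', add_zero]
    | tmul Y' b =>
      induction w with
      | zero => simp
      | add w w' h h' => rw [map_add, map_add, h, h', add_zero]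
      | tmul Z c =>
        rw [bracketIdeal_tmul, bracketIdeal_tmul, smul_smul, hI _ a.2 _ b.2, zero_smul,
          TensorProduct.tmul_zero]

/-- A specialization of `smash_bracket`. No relation between `I` and `J` is needed: `s² = 0` and `t²
= 0` define the specialization, and `s t` lies in `J`. -/
lemma autComm_value_tmul (I J : Ideal C) (hI : ∀ a ∈ I, ∀ b ∈ I, a * b = 0)
    (hJ : ∀ a ∈ J, ∀ b ∈ J, a * b = 0) (Y : LieMod σ (autPresheaf F) C C) (s : I)
    (Z : LieMod σ F C C) (t : J) :
    autComm (value I hI (Y ⊗ₜ[C] s)) (value J hJ (Z ⊗ₜ[C] t)) =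
      value J hJ (bracketIdeal I J (Y ⊗ₜ[C] s) (Z ⊗ₜ[C] t)) := by
  -- the homomorphism `C[ε₀, ε₁] → C` with `ε₀ ↦ s` and `ε₁ ↦ t`
  let θ₀ : DualRing C C →ₐ[R] C :=
    (idealHom R I hI).comp (DualRing.mapMod R (LinearMap.toSpanSingleton C I s))
  let θ : DualRing (DualRing C C) (DualRing C C) →ₐ[R] C :=
    DualRing.lift θ₀ ((AddMonoidHom.mulRight (t : C)).comp θ₀.toRingHom.toAddMonoidHom)
      (fun c m => by
        change θ₀ (c * m) * _ = _ * (θ₀ m * _)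
        rw [map_mul, mul_assoc])
      (fun m m' => by
        change θ₀ m * t * (θ₀ m' * t) = 0
        linear_combination θ₀ m * θ₀ m' * hJ _ t.2 _ t.2)
  have hθ : ∀ x, θ x = θ₀ x.fst + θ₀ x.snd * t := fun _ => rfl
  have hθ₀ : ∀ x, θ₀ x = x.fst + x.snd * s := fun _ => rfl
  have h := congrArg (ptsMap σ F θ) (smash_bracket Y Z)
  rw [preBracket, ptsMap_autComm, ptsMap_ptsMap, ptsMap_ptsMap, ptsMap_ptsMap] at h
  rw [bracketIdeal_tmul, value_tmul, value_tmul, value_tmul]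
  have h1 : θ.comp (smashHom R C) = (idealHom R J hJ).comp
      (DualRing.mapMod R (LinearMap.toSpanSingleton C J ((s : C) • t))) := by
    ext x
    simp [hθ, hθ₀]
    ring
  have h2 : θ.comp (DualRing.inl R _ _) = θ₀ := by
    ext x
    simp [hθ]
  have h3 : θ.comp (DualRing.mapRing (DualRing.inl R C C)) = (idealHom R J hJ).comp
      (DualRing.mapMod R (LinearMap.toSpanSingleton C J t)) := by
    ext x
    simp [hθ, hθ₀]
  rw [h1, h2, h3] at h
  exact h.symm

/-- `{Y(s), Z(t)} = [Y, Z](s t)`, extended to tensors. -/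
lemma autComm_value (I J : Ideal C) (hI : ∀ a ∈ I, ∀ b ∈ I, a * b = 0)
    (hJ : ∀ a ∈ J, ∀ b ∈ J, a * b = 0) (t : LieMod σ (autPresheaf F) C C ⊗[C] I)
    (w : LieMod σ F C C ⊗[C] J) :
    autComm (value I hI t) (value J hJ w) = value J hJ (bracketIdeal I J t w) := by
  -- `w` stays general because the additive case applies the hypothesis for `t` to the bracket of
  -- `t'` with `w`.
  induction t generalizing w with
  | zero => rw [map_zero, value_zero, LinearMap.zero_apply, value_zero, autComm_one_left]
  | tmul Y s =>
    induction w with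
    | zero => rw [map_zero, value_zero, autComm_one_right]
    | tmul Z t => exact autComm_value_tmul I J hI hJ Y s Z t
    | add w w' h h' =>
      -- `u ↦ {g, u}` is a homomorphism only up to conjugation by the first factor, which is trivial
      -- among values in `J`.
      rw [value_add, autComm_mul_right, h, h', map_add, value_add, value_mul_comm J hJ w,
        mul_inv_cancel_right]
  | add t t' h h' =>
    -- The automorphism given by `t` fixes the value of the bracket of `t'` with `w`, since the
    -- double bracket is zero. Hence the crossed product rule for `autComm` becomes additivity in
    -- the first argument.
    have hfix := h (bracketIdeal I J t' w)
    rw [bracketIdeal_bracketIdeal I J hI, value_zero, autComm, mul_inv_eq_one] at hfix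
    rw [value_add, autComm_mul_left, h, h', hfix, ← value_add, map_add, LinearMap.add_apply,
      add_comm]

end LieMod

end LieModules

/-! ### The combinatorial differential of represented forms -/

section EvaluationOfForms

variable {R B C : Type u} [CommRing R] [CommRing B] [CommRing C] [Algebra R B] [Algebra R C] {n : ℕ}

lemma span_range_dForm :
    Submodule.span B (Set.range (dForm : (Fin n → B) → Forms R B n)) = ⊤ := by
  have h := exteriorPower.ιMulti_span_of_span B n Ω[B⁄R] (KaehlerDifferential.span_range_derivation R B)
  rw [← h]
  congr 1
  ext v
  constructor
  · rintro ⟨b, rfl⟩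
    exact ⟨_, Set.range_subset_iff.mpr fun i => ⟨b i, rfl⟩, rfl⟩
  · rintro ⟨ω, hω, rfl⟩
    choose b hb using fun i => hω ⟨i, rfl⟩
    exact ⟨b, congrArg _ (funext hb)⟩

/-- Two additive maps agree if they agree on the forms `c db₁ ∧ … ∧ dbₙ`. -/
lemma Forms.induction {p : Forms R B n → Prop} (h0 : p 0) (hadd : ∀ v w, p v → p w → p (v + w))
    (h : ∀ (c : B) (b : Fin n → B), p (c • dForm b)) (v : Forms R B n) : p v := by
  have hv : v ∈ Submodule.span B (Set.range (dForm : (Fin n → B) → Forms R B n)) := by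
    rw [span_range_dForm]; trivial
  induction hv using Submodule.closure_induction with
  | zero => exact h0
  | add v w _ _ hv hw => exact hadd v w hv hw
  | smul_mem c x hx =>
    obtain ⟨b, rfl⟩ := hx
    exact h c b

lemma wedge_dForm (a : Fin 1 → B) (b : Fin 2 → B) :
    wedge 1 2 3 rfl (dForm a : Forms R B 1) (dForm b) = dForm ![a 0, b 0, b 1] := by
  refine Subtype.ext ?_
  simp [dForm, ExteriorAlgebra.ιMulti_apply]
  rfl

section

variable (x : Fin (n + 1) → (B →ₐ[R] C)) (hx : IsStronglyClose fun i => (x i : B →+* C))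

/-- The value of a form on infinitesimally close homomorphisms, as an element of `C`. -/
def formValue : Forms R B n →+ C := (evalForm x hx).toAddMonoidHom

lemma formValue_smul (b : B) (v : Forms R B n) :
    formValue x hx (b • v) = x 0 b * formValue x hx v := (evalForm x hx).map_smul b v

lemma formValue_smul_dForm (c : B) (b : Fin n → B) :
    formValue x hx (c • dForm b) = x 0 c * ∏ i : Fin n, (x i.succ (b i) - x 0 (b i)) :=
  evalForm_smul_dForm x hx c b

lemma evalHom_apply [NeZero n] (y : DualRing B (Forms R B n)) :
    evalHom x hx y = x 0 y.fst + formValue x hx y.snd := rfl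

/-- The values of a form in an ideal that contains them. -/
def idealValue (J : Ideal C) (h : ∀ v, formValue x hx v ∈ J) : Forms R B n →+ J where
  toFun v := ⟨formValue x hx v, h v⟩
  map_zero' := by ext; simp
  map_add' v w := by ext; simp

lemma idealValue_smul (J : Ideal C) (h) (b : B) (v : Forms R B n) :
    idealValue x hx J h (b • v) = x 0 b • idealValue x hx J h v :=
  Subtype.ext (formValue_smul x hx b v)

/-- All vertices agree on `R`, so over `R` the semilinearity no longer sees the first vertex. Faces
with different first vertices can then share the tensor product over `R`. -/
lemma idealValue_algebra_smul (J : Ideal C) (h) (r : R) (v : Forms R B n) :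
    idealValue x hx J h (r • v) = Algebra.ofId R C r • idealValue x hx J h v := by
  rw [← algebraMap_smul B r v, idealValue_smul, AlgHom.commutes]
  rfl

end

lemma Ideal.mul_eq_zero_of_mem_span {s : Set C} (h : ∀ a ∈ s, ∀ b ∈ s, a * b = 0) (a : C)
    (ha : a ∈ Ideal.span s) (b : C) (hb : b ∈ Ideal.span s) : a * b = 0 := by
  induction ha using Submodule.span_induction with
  | zero => simp
  | add a a' _ _ h h' => rw [add_mul, h, h', add_zero]
  | smul c a _ h => rw [smul_mul_assoc, h, smul_zero]
  | mem a ha =>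
    induction hb using Submodule.span_induction with
    | zero => simp
    | add b b' _ _ h h' => rw [mul_add, h, h', add_zero]
    | smul c a _ h => rw [mul_smul_comm, h, smul_zero]
    | mem b hb => exact h a ha b hb

namespace IsStronglyClose

variable {x : Fin (n + 1) → (B →+* C)} (hx : IsStronglyClose x)

include hx

/-- Polarization of `mul_zero` at `a + b`. -/
lemma sub_mul_sub_swap (i j : Fin (n + 1)) (a b : B) :
    (x i a - x 0 a) * (x j b - x 0 b) = -((x j a - x 0 a) * (x i b - x 0 b)) := by
  have h1 := hx.mul_zero i j (a + b)
  have h2 := hx.mul_zero i j a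
  have h3 := hx.mul_zero i j b
  simp only [map_add] at h1
  linear_combination h1 - h2 - h3

end IsStronglyClose

/-- The ideal generated by the differences `x₁(a) - x₀(a)`. -/
def edgeIdeal (x : Fin 4 → (B →+* C)) : Ideal C :=
  Ideal.span (Set.range fun a => x 1 a - x 0 a)

/-- The ideal generated by the products `(xᵢ(a) - x₀(a)) (xⱼ(b) - x₀(b))`. -/
def faceIdeal (x : Fin 4 → (B →+* C)) : Ideal C :=
  Ideal.span (Set.range fun p : (Fin 4 × Fin 4) × B × B =>
    (x p.1.1 p.2.1 - x 0 p.2.1) * (x p.1.2 p.2.2 - x 0 p.2.2))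

section

variable {x : Fin 4 → (B →+* C)} (hx : IsStronglyClose x)

include hx

lemma edgeIdeal_mul (a : C) (ha : a ∈ edgeIdeal x) (b : C) (hb : b ∈ edgeIdeal x) : a * b = 0 := by
  refine Ideal.mul_eq_zero_of_mem_span ?_ a ha b hb
  rintro _ ⟨a, rfl⟩ _ ⟨b, rfl⟩
  exact hx.sq_zero 1 0 a b

/-- A product of two generators has four factors `xᵢ(a) - x₀(a)`. An index 0 gives the factor zero;
otherwise two of the four indices in {1, 2, 3} coincide, and `sq_zero` kills the two corresponding
factors. -/
lemma faceIdeal_mul (a : C) (ha : a ∈ faceIdeal x) (b : C) (hb : b ∈ faceIdeal x) : a * b = 0 := by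
  refine Ideal.mul_eq_zero_of_mem_span ?_ a ha b hb
  rintro _ ⟨⟨⟨i, j⟩, a, b⟩, rfl⟩ _ ⟨⟨⟨k, l⟩, c, d⟩, rfl⟩
  have hs := fun i => hx.sq_zero i 0
  have key : ∀ i j k l : Fin 4, (i = 0 ∨ j = 0 ∨ k = 0 ∨ l = 0) ∨
      (i = j ∨ i = k ∨ i = l ∨ j = k ∨ j = l ∨ k = l) := by decide
  rcases key i j k l with (rfl | rfl | rfl | rfl) | rfl | rfl | rfl | rfl | rfl | rfl
  · simp
  · simp
  · simp
  · simp
  · simp [hs]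
  · linear_combination (x j b - x 0 b) * (x l d - x 0 d) * hs i a c
  · linear_combination (x j b - x 0 b) * (x k c - x 0 c) * hs i a d
  · linear_combination (x i a - x 0 a) * (x l d - x 0 d) * hs j b c
  · linear_combination (x i a - x 0 a) * (x k c - x 0 c) * hs j b d
  · simp [hs]

end

/-- Needed for the face `(x₁, x₂, x₃)`, whose differences are taken from `x₁` although the ideal is
generated by differences from `x₀`. -/
lemma sub_mul_sub_mem_faceIdeal (x : Fin 4 → (B →+* C)) (i j k l : Fin 4) (a b : B) :
    (x i a - x k a) * (x j b - x l b) ∈ faceIdeal x := by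
  have h : ∀ i j, (x i a - x 0 a) * (x j b - x 0 b) ∈ faceIdeal x := fun i j =>
    Ideal.subset_span ⟨⟨⟨i, j⟩, a, b⟩, rfl⟩
  have e : (x i a - x k a) * (x j b - x l b) =
      (x i a - x 0 a) * (x j b - x 0 b) - (x k a - x 0 a) * (x j b - x 0 b) -
      ((x i a - x 0 a) * (x l b - x 0 b) - (x k a - x 0 a) * (x l b - x 0 b)) := by ring
  rw [e]
  exact sub_mem (sub_mem (h _ _) (h _ _)) (sub_mem (h _ _) (h _ _))

section

variable (x : Fin 4 → (B →ₐ[R] C)) (hx : IsStronglyClose fun i => (x i : B →+* C))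

lemma formValue_one_mem (v : Forms R B 1) :
    formValue (fun i => x (![0, 1] i)) (hx.reindex ![0, 1]) v ∈
      edgeIdeal fun i => (x i : B →+* C) := by
  induction v using Forms.induction with
  | h0 => simp
  | hadd v w hv hw => rw [map_add]; exact add_mem hv hw
  | h c b =>
    rw [formValue_smul_dForm, Fin.prod_univ_one]
    exact Ideal.mul_mem_left _ _ (Ideal.subset_span ⟨b 0, rfl⟩)

lemma formValue_two_mem (τ : Fin 3 → Fin 4) (v : Forms R B 2) :
    formValue (fun i => x (τ i)) (hx.reindex τ) v ∈ faceIdeal fun i => (x i : B →+* C) := by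
  induction v using Forms.induction with
  | h0 => simp
  | hadd v w hv hw => rw [map_add]; exact add_mem hv hw
  | h c b =>
    rw [formValue_smul_dForm, Fin.prod_univ_two]
    exact Ideal.mul_mem_left _ _
      (sub_mul_sub_mem_faceIdeal (fun i => (x i : B →+* C)) _ _ _ _ _ _)

lemma formValue_three_mem (v : Forms R B 3) :
    formValue x hx v ∈ faceIdeal fun i => (x i : B →+* C) := by
  induction v using Forms.induction with
  | h0 => simp
  | hadd v w hv hw => rw [map_add]; exact add_mem hv hw
  | h c b =>
    rw [formValue_smul_dForm, Fin.prod_univ_three]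
    exact Ideal.mul_mem_left _ _ (Ideal.mul_mem_right _ _
      (sub_mul_sub_mem_faceIdeal (fun i => (x i : B →+* C)) _ _ _ _ _ _))

/-- The alternating sum of the values of `v` on the faces of `x` is the value of `dv` on `x`. -/
lemma formValue_dTwo (v : Forms R B 2) :
    formValue (fun i => x (![1, 2, 3] i)) (hx.reindex ![1, 2, 3]) v +
      formValue (fun i => x (![0, 1, 3] i)) (hx.reindex ![0, 1, 3]) v +
      formValue (fun i => x (![0, 3, 2] i)) (hx.reindex ![0, 3, 2]) v +
      formValue (fun i => x (![0, 2, 1] i)) (hx.reindex ![0, 2, 1]) v =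
      formValue x hx (dTwo R B v) := by
  induction v using Forms.induction with
  | h0 => simp
  | hadd v w hv hw => simp only [map_add, ← hv, ← hw]; abel
  | h c b =>
    have h := formValue_smul_dForm x hx 1 (Fin.cons c b)
    rw [one_smul] at h
    rw [dTwo_smul_dForm, h]
    simp only [formValue_smul_dForm, Fin.prod_univ_two, Fin.prod_univ_three]
    -- Expand everything in differences from `x₀`, with `x₁(c) = x₀(c) + (x₁(c) - x₀(c))`. The terms
    -- with coefficient `x₀(c)` cancel over the four faces after one exchange of `x₂` and `x₃`; two
    -- differences `x₁ - x₀` multiply to zero; the product of the differences of `c`, `b 0`, `b 1`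
    -- along `x₁`, `x₂`, `x₃` remains.
    have h1 := hx.sub_mul_sub_swap 3 2 (b 0) (b 1)
    have hsq := hx.sq_zero 1 0
    simp only [RingHom.coe_coe] at h1 hsq
    change x 1 c * ((x 2 (b 0) - x 1 (b 0)) * (x 3 (b 1) - x 1 (b 1))) +
      x 0 c * ((x 1 (b 0) - x 0 (b 0)) * (x 3 (b 1) - x 0 (b 1))) +
      x 0 c * ((x 3 (b 0) - x 0 (b 0)) * (x 2 (b 1) - x 0 (b 1))) +
      x 0 c * ((x 2 (b 0) - x 0 (b 0)) * (x 1 (b 1) - x 0 (b 1))) =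
      x 0 1 * ((x 1 c - x 0 c) * (x 2 (b 0) - x 0 (b 0)) * (x 3 (b 1) - x 0 (b 1)))
    rw [map_one]
    linear_combination x 0 c * h1 + x 1 c * hsq (b 0) (b 1) -
      (x 2 (b 0) - x 0 (b 0)) * hsq c (b 1) - (x 3 (b 1) - x 0 (b 1)) * hsq c (b 0)

/-- The value of `η ∧ v` on `(x₀, x₁, x₂, x₃)` is the product of the values of `η` on `(x₀, x₁)`
and of `v` on `(x₁, x₂, x₃)`. -/
lemma formValue_wedge (η : Forms R B 1) (v : Forms R B 2) :
    formValue x hx (wedge 1 2 3 rfl η v) =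
      formValue (fun i => x (![0, 1] i)) (hx.reindex ![0, 1]) η *
        formValue (fun i => x (![1, 2, 3] i)) (hx.reindex ![1, 2, 3]) v := by
  induction η using Forms.induction with
  | h0 => simp
  | hadd η η' h h' => simp only [map_add, LinearMap.add_apply, h, h', add_mul]
  | h e a =>
    induction v using Forms.induction with
    | h0 => simp
    | hadd v w hv hw => simp only [map_add, hv, hw, mul_add]
    | h c b =>
      rw [(wedge 1 2 3 rfl _).map_smul, (wedge 1 2 3 rfl).map_smul, LinearMap.smul_apply,
        wedge_dForm, smul_smul, formValue_smul_dForm,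
        formValue_smul_dForm, formValue_smul_dForm]
      simp only [Fin.prod_univ_one, Fin.prod_univ_two, Fin.prod_univ_three]
      -- The factor `x₁(a 0) - x₀(a 0)` kills every other difference `x₁ - x₀`, so in the second
      -- factor the base vertex `x₁` may be replaced by `x₀`.
      have hsq := hx.sq_zero 1 0 (a 0)
      simp only [RingHom.coe_coe] at hsq
      change x 0 (c * e) * ((x 1 (a 0) - x 0 (a 0)) * (x 2 (b 0) - x 0 (b 0)) *
        (x 3 (b 1) - x 0 (b 1))) = x 0 e * (x 1 (a 0) - x 0 (a 0)) *
        (x 1 c * ((x 2 (b 0) - x 1 (b 0)) * (x 3 (b 1) - x 1 (b 1))))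
      rw [map_mul]
      linear_combination -x 0 e * (x 2 (b 0) - x 1 (b 0)) * (x 3 (b 1) - x 1 (b 1)) * hsq c +
        x 0 e * x 0 c * ((x 3 (b 1) - x 1 (b 1)) * hsq (b 0) + (x 2 (b 0) - x 0 (b 0)) * hsq (b 1))

end

end EvaluationOfForms

/-! ### Values on the faces of a tetrahedron and the formula for the combinatorial differential. -/

section Delta

variable {S : Scheme.{u}} {X : Over S} {R B : Type u} [CommRing R] [CommRing B] [Algebra R B]
  {F : (Over S)ᵒᵖ ⥤ GrpCat.{v}} [InfLinear F]

lemma AffineChart.ptsMap_evalHom_val (c : AffineChart X R B) {C : Type u} [CommRing C] [Algebra R C] {n : ℕ} [NeZero n]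
    (x : Fin (n + 1) → (B →ₐ[R] C)) (hx : IsStronglyClose fun i => (x i : B →+* C))
    (J : Ideal C) (hJ) (h : ∀ v, formValue x hx v ∈ J) (v : LieFormsOn R B c.base F n) :
    ptsMap c.base F (evalHom x hx) (LieMod.ofTensor c.base B F (Forms R B n) v).val =
      LieMod.value J hJ (LieMod.baseChange (x 0) (idealValue x hx J h)
        (idealValue_smul x hx J h) v) :=
  LieMod.ptsMap_ofTensor_val J hJ _ _ _ _ (fun _ => rfl) v

lemma mapRing_ofId_apply {C : Type u} [CommRing C] [Algebra R C] {σ : Spec (.of R) ⟶ S}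
    (g : B →ₐ[R] C) (Y : LieMod σ F R R) :
    LieMod.mapRing g (LieMod.mapRing (Algebra.ofId R B) Y) =
      LieMod.mapRing (Algebra.ofId R C) Y := by
  rw [LieMod.mapRing_mapRing]
  exact congrArg (LieMod.mapRing · Y) (AlgHom.ext fun r => g.commutes r)

/-- The value of a form in `Lie(F)(R) ⊗ Ωⁿ` depends on `x₀` only through the value of the
differential forms. -/
lemma baseChange_toOn {C : Type u} [CommRing C] [Algebra R C] {σ : Spec (.of R) ⟶ S} {n : ℕ}
    (x : Fin (n + 1) → (B →ₐ[R] C)) (hx : IsStronglyClose fun i => (x i : B →+* C))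
    (J : Ideal C) (h : ∀ v, formValue x hx v ∈ J) (w : LieForms R B σ F n) :
    LieMod.baseChange (x 0) (idealValue x hx J h) (idealValue_smul x hx J h) (toOn w) =
      LieMod.baseChange (Algebra.ofId R C) (idealValue x hx J h)
        (idealValue_algebra_smul x hx J h) w := by
  induction w using TensorProduct.induction_on with
  | zero => simp
  | add v w hv hw => simp only [map_add, hv, hw]
  | tmul Y ω =>
    rw [toOn_tmul, LieMod.baseChange_tmul, LieMod.baseChange_tmul, mapRing_ofId_apply]

section

variable {C : Type u} [CommRing C] [Algebra R C] {σ : Spec (.of R) ⟶ S}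
  (x : Fin 4 → (B →ₐ[R] C)) (hx : IsStronglyClose fun i => (x i : B →+* C))

/-- The value of `w` on a face of the simplex `x`. -/
abbrev faceValue (τ : Fin 3 → Fin 4) :
    LieForms R B σ F 2 →+ LieMod σ F C C ⊗[C] (faceIdeal fun i => (x i : B →+* C)) :=
  LieMod.baseChange (Algebra.ofId R C) (idealValue (fun i => x (τ i)) (hx.reindex τ) _
    (formValue_two_mem x hx τ)) (idealValue_algebra_smul _ _ _ _)

/-- With coefficients from `Lie(F)(R)`, the element `Y` contributes the same factor in `Lie(F)(C)`
to every face, so the identity reduces to scalar forms. -/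
lemma faceValue_sum (w : LieForms R B σ F 2) :
    faceValue x hx ![1, 2, 3] w + faceValue x hx ![0, 1, 3] w + faceValue x hx ![0, 3, 2] w +
      faceValue x hx ![0, 2, 1] w =
    LieMod.baseChange (x 0) (idealValue x hx _ (formValue_three_mem x hx))
      (idealValue_smul _ _ _ _) (toOn (dLie w)) := by
  rw [baseChange_toOn]
  induction w using TensorProduct.induction_on with
  | zero => simp
  | add v w hv hw => simp only [map_add, ← hv, ← hw]; abel
  | tmul Y ω =>
    change _ = LieMod.baseChange _ _ _ (Y ⊗ₜ[R] dTwo R B ω)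
    simp only [LieMod.baseChange_tmul, ← TensorProduct.tmul_add]
    congr 1
    exact Subtype.ext (formValue_dTwo x hx ω)

/-- On pure tensors this is base change for the bracket in the Lie factor and `formValue_wedge` in
the scalar factor. -/
lemma bracketIdeal_faceValue [InfLinear (autPresheaf F)] [IsGood F]
    (t : LieFormsOn R B σ (autPresheaf F) 1) (w : LieForms R B σ F 2) :
    LieMod.bracketIdeal _ _ (LieMod.baseChange (x 0) (idealValue (fun i => x (![0, 1] i))
        (hx.reindex ![0, 1]) _ (formValue_one_mem x hx)) (idealValue_smul _ _ _ _) t)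
      (faceValue x hx ![1, 2, 3] w) =
    LieMod.baseChange (x 0) (idealValue x hx _ (formValue_three_mem x hx))
      (idealValue_smul _ _ _ _) (bracketForms 1 2 3 rfl t (toOn w)) := by
  induction t using TensorProduct.induction_on with
  | zero => simp
  | add t t' h h' => simp only [map_add, LinearMap.add_apply, h, h']
  | tmul Y η =>
    induction w using TensorProduct.induction_on with
    | zero => simp
    | add w w' h h' => simp only [map_add, h, h']
    | tmul Z ω =>
      rw [toOn_tmul, bracketForms_tmul]
      refine (LieMod.bracketIdeal_tmul _ _ _ _ _ _).trans ?_
      rw [LieMod.baseChange_tmul, LieMod.mapRing_bracket, mapRing_ofId_apply]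
      congr 1
      exact Subtype.ext (formValue_wedge x hx η ω).symm

end

/-- If `w` represents `φ` and `t` represents `χ`, then `dw + [t, w]` represents `δ²_χ(φ)`. -/
theorem AffineChart.represents_delta2 [InfLinear (autPresheaf F)] [IsGood F]
    (c : AffineChart X R B) {φ : Cochain F X 2} {χ : Cochain (autPresheaf F) X 1}
    (w : LieForms R B c.base F 2) (t : LieFormsOn R B c.base (autPresheaf F) 1)
    (hφ : c.Represents (toOn w) φ) (hχ : c.Represents t χ) :
    c.Represents (toOn (dLie w) + bracketForms 1 2 3 rfl t (toOn w)) (delta2 χ φ) := by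
  intro C _ _ x hx
  have hx' := c.isStronglyClose hx
  let J := faceIdeal fun i => (x i : B →+* C)
  have hJ := faceIdeal_mul hx'
  -- All faces, including those that do not start at `x₀`, get values from the one group `Lie(F)(C)
  -- ⊗ J`.
  have key : ∀ τ : Fin 3 → Fin 4, φ (specOver c.base C)
      (Simplex.reindex (⟨fun i => c.point (x i), hx⟩ : Simplex X 3 _) τ) =
      LieMod.value J hJ (faceValue x hx' τ w) := by
    intro τ
    refine (hφ C (fun i => x (τ i)) (Simplex.reindex ⟨_, hx⟩ τ).2).trans ?_
    rw [← baseChange_toOn (fun i => x (τ i)) (hx'.reindex τ) J (formValue_two_mem x hx' τ)]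
    exact c.ptsMap_evalHom_val (fun i => x (τ i)) (hx'.reindex τ) J hJ
      (formValue_two_mem x hx' τ) _
  have keyχ : χ (specOver c.base C)
      (Simplex.reindex (⟨fun i => c.point (x i), hx⟩ : Simplex X 3 _) ![0, 1]) =
      LieMod.value _ (edgeIdeal_mul hx') (LieMod.baseChange (x 0)
        (idealValue (fun i => x (![0, 1] i)) (hx'.reindex ![0, 1]) _ (formValue_one_mem x hx'))
        (idealValue_smul _ _ _ _) t) := by
    refine (hχ C (fun i => x (![0, 1] i)) (Simplex.reindex ⟨_, hx⟩ ![0, 1]).2).trans ?_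
    exact c.ptsMap_evalHom_val _ _ _ (edgeIdeal_mul hx') (formValue_one_mem x hx') _
  -- The value of the sum becomes a product, and commutativity brings the bracket to the front.
  -- There it is the commutator `χ(g) g⁻¹` with `g` the value on `(x₁, x₂, x₃)`, and the next factor
  -- is `g`.
  rw [c.ptsMap_evalHom_val x hx' J hJ (formValue_three_mem x hx'), map_add, ← faceValue_sum,
    ← bracketIdeal_faceValue, LieMod.value_add, LieMod.value_mul_comm, LieMod.value_add,
    LieMod.value_add, LieMod.value_add, ← LieMod.autComm_value _ _ (edgeIdeal_mul hx') hJ, ← keyχ, ← key,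
    ← key, ← key, ← key]
  simp only [autComm, ← mul_assoc, inv_mul_cancel_right]
  rfl

end Delta

/-! ### Group schemes near the unit section -/

section UnitSection

variable {S : Scheme.{u}} {R : Type u} [CommRing R]

/-- An affine chart `Spec A` of the group scheme `G` over an affine open subscheme `Spec R` of `S`,
which contains the unit section over `Spec R`. -/
structure UnitChart (G : Over S) [GrpObj G] (σ : Spec (.of R) ⟶ S) (A : Type u) [CommRing A]
    [Algebra R A] where
  map : Spec (.of A) ⟶ G.left
  isOpenImmersion_map : IsOpenImmersion map
  mono_base : Mono σ
  map_hom : map ≫ G.hom = Spec.map (CommRingCat.ofHom (algebraMap R A)) ≫ σ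
  unit : A →ₐ[R] R
  unit_comp : Spec.map (CommRingCat.ofHom unit.toRingHom) ≫ map =
    ptsLeft σ (1 : Pts σ (yonedaGrpObj G) R)

namespace UnitChart

variable {G : Over S} [GrpObj G] {σ : Spec (.of R) ⟶ S} {A : Type u} [CommRing A] [Algebra R A]
  (U : UnitChart G σ A) {C C' M N : Type u} [CommRing C] [Algebra R C] [CommRing C'] [Algebra R C']
  [AddCommGroup M] [Module C M] [AddCommGroup N] [Module C N]

/-- The point of `G` given by a homomorphism of `R`-algebras `A → C`. -/
def pt (g : A →ₐ[R] C) : Pts σ (yonedaGrpObj G) C :=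
  (Over.homMk (Spec.map (CommRingCat.ofHom g.toRingHom) ≫ U.map) (by
    refine (Category.assoc _ _ _).trans ?_
    rw [U.map_hom]
    exact Over.w (specOverMap σ g)) : specOver σ C ⟶ G)

lemma ptsLeft_pt (g : A →ₐ[R] C) :
    ptsLeft σ (U.pt g) = Spec.map (CommRingCat.ofHom g.toRingHom) ≫ U.map := rfl

lemma ptsMap_pt (f : C →ₐ[R] C') (g : A →ₐ[R] C) :
    ptsMap σ (yonedaGrpObj G) f (U.pt g) = U.pt (f.comp g) := by
  refine ptsLeft_injective ?_
  rw [ptsLeft_ptsMap, ptsLeft_pt, ptsLeft_pt, ← Category.assoc, ← Spec.map_comp]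
  rfl

lemma pt_injective : Function.Injective (U.pt : (A →ₐ[R] C) → _) := by
  intro g h e
  have := U.isOpenImmersion_map
  have e := congrArg (ptsLeft σ) e
  rw [ptsLeft_pt, ptsLeft_pt, cancel_mono] at e
  ext a
  exact congr($(Spec.map_injective e) a)

/-- The homomorphism `A → C` that gives the unit of `G(C)`. -/
def unitHom (C : Type u) [CommRing C] [Algebra R C] : A →ₐ[R] C := (Algebra.ofId R C).comp U.unit

lemma comp_unitHom (f : C →ₐ[R] C') : f.comp (U.unitHom C) = U.unitHom C' :=
  AlgHom.ext fun a => f.commutes (U.unit a)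

lemma pt_unitHom : U.pt (U.unitHom C) = 1 := by
  have h : U.pt U.unit = 1 := ptsLeft_injective U.unit_comp
  rw [unitHom, ← ptsMap_pt, h, map_one]

/-- Topologically such a point factors through the unit section, since `Spec q` is surjective. So it
lands in the affine chart and is a ring homomorphism, which is `R`-linear because `σ` is a
monomorphism. -/
lemma exists_pt (q : C →ₐ[R] C') [Surjective (Spec.map (CommRingCat.ofHom q.toRingHom))]
    (y : Pts σ (yonedaGrpObj G) C) (hy : ptsMap σ (yonedaGrpObj G) q y = 1) :
    ∃ g, U.pt g = y := by
  have := U.isOpenImmersion_map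
  have := U.mono_base
  have hr : Set.range (ptsLeft σ y) ⊆ Set.range U.map := by
    rintro _ ⟨p, rfl⟩
    obtain ⟨p, rfl⟩ := (Spec.map (CommRingCat.ofHom q.toRingHom)).surjective p
    rw [← Scheme.Hom.comp_apply, ← ptsLeft_ptsMap, hy, ← U.pt_unitHom, ptsLeft_pt,
      Scheme.Hom.comp_apply]
    exact ⟨_, rfl⟩
  obtain ⟨g, hg⟩ := Spec.map_surjective (IsOpenImmersion.lift U.map _ hr)
  have e : Spec.map g ≫ U.map = ptsLeft σ y := by rw [hg, IsOpenImmersion.lift_fac]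
  have hR : CommRingCat.ofHom (algebraMap R A) ≫ g = CommRingCat.ofHom (algebraMap R C) := by
    apply Spec.map_injective
    rw [← cancel_mono σ, Spec.map_comp, Category.assoc, ← U.map_hom, ← Category.assoc, e]
    exact Over.w (show specOver σ C ⟶ G from y)
  refine ⟨{ g.hom with commutes' := fun r => congr($hR r) }, ptsLeft_injective e⟩

/-- The homomorphism `A → D_C(M)` attached to an element of `Lie(G, M)`. -/
def lieHom (y : LieMod σ (yonedaGrpObj G) C M) : A →ₐ[R] DualRing C M :=
  (U.exists_pt (DualRing.aug R C M) y.val y.aug_val).choose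

lemma pt_lieHom (y : LieMod σ (yonedaGrpObj G) C M) : U.pt (U.lieHom y) = y.val :=
  (U.exists_pt (DualRing.aug R C M) y.val y.aug_val).choose_spec

lemma lieHom_eq (y : LieMod σ (yonedaGrpObj G) C M) (g : A →ₐ[R] DualRing C M)
    (h : U.pt g = y.val) : U.lieHom y = g :=
  U.pt_injective ((U.pt_lieHom y).trans h.symm)

lemma lieHom_injective :
    Function.Injective (U.lieHom : LieMod σ (yonedaGrpObj G) C M → _) := by
  intro y z h
  ext1
  rw [← U.pt_lieHom, h, U.pt_lieHom]

lemma fst_lieHom (y : LieMod σ (yonedaGrpObj G) C M) (a : A) :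
    (U.lieHom y a).fst = U.unitHom C a := by
  have h : (DualRing.aug R C M).comp (U.lieHom y) = U.unitHom C := by
    apply U.pt_injective
    rw [← ptsMap_pt, pt_lieHom, y.aug_val, pt_unitHom]
  exact congr($h a)

lemma lieHom_mapMod (g : M →ₗ[C] N) (y : LieMod σ (yonedaGrpObj G) C M) :
    U.lieHom (LieMod.mapMod g y) = (DualRing.mapMod R g).comp (U.lieHom y) :=
  U.lieHom_eq _ _ (by rw [← ptsMap_pt, pt_lieHom]; rfl)

lemma lieHom_mapRing (f : C →ₐ[R] C') (y : LieMod σ (yonedaGrpObj G) C C) :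
    U.lieHom (LieMod.mapRing f y) = (DualRing.mapRing f).comp (U.lieHom y) :=
  U.lieHom_eq _ _ (by rw [← ptsMap_pt, pt_lieHom]; rfl)

/-- An element of `Lie(G, M)` from a derivation, in the form of a homomorphism to `D_C(M)`. -/
def ofHom (g : A →ₐ[R] DualRing C M) (hg : ∀ a, (g a).fst = U.unitHom C a) :
    LieMod σ (yonedaGrpObj G) C M :=
  LieMod.mk (U.pt g) (by
    rw [ptsMap_pt, ← U.pt_unitHom]
    exact congrArg _ (AlgHom.ext hg))

lemma lieHom_ofHom (g : A →ₐ[R] DualRing C M) (hg : ∀ a, (g a).fst = U.unitHom C a) :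
    U.lieHom (U.ofHom g hg) = g := U.lieHom_eq _ _ rfl

/-- The homomorphism `A → D_C(M)` given by a map which is a derivation along the unit section. -/
def derivHom (d : A → M) (hadd : ∀ a b, d (a + b) = d a + d b)
    (hmul : ∀ a b, d (a * b) = U.unitHom C a • d b + U.unitHom C b • d a)
    (halg : ∀ r : R, d (algebraMap R A r) = 0) : A →ₐ[R] DualRing C M where
  toFun a := ⟨U.unitHom C a, d a⟩
  map_one' := by
    ext
    · simp
    · simpa using halg 1
  map_mul' a b := by ext <;> simp [hmul]
  map_zero' := by
    ext
    · simp
    · simpa using halg 0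
  map_add' a b := by ext <;> simp [hadd]
  commutes' r := by
    ext
    · simp [DualRing.algebraMap_eq]
    · simp [DualRing.algebraMap_eq, halg]

lemma snd_lieHom_mul (y : LieMod σ (yonedaGrpObj G) C M) (a b : A) : (U.lieHom y (a * b)).snd =
    U.unitHom C a • (U.lieHom y b).snd + U.unitHom C b • (U.lieHom y a).snd := by
  rw [map_mul, DualRing.snd_mul, fst_lieHom, fst_lieHom]

lemma snd_lieHom_algebraMap (y : LieMod σ (yonedaGrpObj G) C M) (r : R) :
    (U.lieHom y (algebraMap R A r)).snd = 0 := by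
  rw [AlgHom.commutes]; rfl

/-- No formula for the multiplication of `G` is used. The pair of derivations is a point over `D_C(M
× M)`; infinitesimal linearity splits it as a sum in the group, and the addition map `M × M → M`
turns this into `y + z`. -/
lemma snd_lieHom_add (y z : LieMod σ (yonedaGrpObj G) C M) (a : A) :
    (U.lieHom (y + z) a).snd = (U.lieHom y a).snd + (U.lieHom z a).snd := by
  let g : A →ₐ[R] DualRing C (M × M) :=
    U.derivHom (fun a => ((U.lieHom y a).snd, (U.lieHom z a).snd)) (fun a b => by simp)
      (fun a b => by simp only [snd_lieHom_mul]; rfl)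
      (fun r => by simp only [snd_lieHom_algebraMap]; rfl)
  have hg : ∀ a, (g a).fst = U.unitHom C a := fun _ => rfl
  have h := LieMod.mapMod_inl_add_inr y z (U.ofHom g hg) (by
      apply U.lieHom_injective
      rw [lieHom_mapMod, lieHom_ofHom]
      ext a
      · exact (U.fst_lieHom y a).symm
      · rfl) (by
      apply U.lieHom_injective
      rw [lieHom_mapMod, lieHom_ofHom]
      ext a
      · exact (U.fst_lieHom z a).symm
      · rfl)
  have h' := congrArg (LieMod.mapMod (LinearMap.coprod LinearMap.id LinearMap.id)) h
  rw [map_add, ← LieMod.mapMod_comp, ← LieMod.mapMod_comp, LinearMap.coprod_inl,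
    LinearMap.coprod_inr, LieMod.mapMod_id, LieMod.mapMod_id] at h'
  rw [← h', lieHom_mapMod, lieHom_ofHom]
  simp [g, derivHom]

lemma snd_lieHom_smul (c : C) (y : LieMod σ (yonedaGrpObj G) C M) (a : A) :
    (U.lieHom (c • y) a).snd = c • (U.lieHom y a).snd := by
  rw [LieMod.smul_def, lieHom_mapMod]
  simp

/-- The derivation of `A` attached to an element of `Lie(G)(C)`. -/
def lieDeriv (y : LieMod σ (yonedaGrpObj G) C C) : Derivation R A (Along (U.unitHom C)) where
  toFun a := (show Along (U.unitHom C) from (U.lieHom y a).snd)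
  map_add' a b := by simp; rfl
  map_smul' r a := by
    rw [Algebra.smul_def, snd_lieHom_mul, snd_lieHom_algebraMap, smul_zero, add_zero,
      AlgHom.commutes, RingHom.id_apply]
    exact (Algebra.smul_def (A := C) r _).symm
  map_one_eq_zero' := by
    change (U.lieHom y 1).snd = 0
    rw [map_one]
    rfl
  leibniz' a b := U.snd_lieHom_mul y a b

variable {ι : Type u} [Finite ι] (b : Module.Basis ι A Ω[A⁄R])

/-- The linear map on differentials attached to an element of `Lie(G)(C)`. -/
def lieForm (y : LieMod σ (yonedaGrpObj G) C C) : Ω[A⁄R] →ₗ[A] Along (U.unitHom C) :=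
  (U.lieDeriv y).liftKaehlerDifferential

lemma lieForm_D (y : LieMod σ (yonedaGrpObj G) C C) (a : A) :
    U.lieForm y (KaehlerDifferential.D R A a) = (U.lieHom y a).snd :=
  Derivation.liftKaehlerDifferential_comp_D _ _

/-- Serves both scalars (`f` is multiplication by `c`) and base change (`f` is a ring homomorphism).
-/
lemma lieForm_map (y : LieMod σ (yonedaGrpObj G) C C) (z : LieMod σ (yonedaGrpObj G) C' C')
    (f : C →+ C') (hf : ∀ a c, f (U.unitHom C a * c) = U.unitHom C' a * f c)
    (h : ∀ a, (U.lieHom z a).snd = f (U.lieHom y a).snd) (ω : Ω[A⁄R]) :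
    U.lieForm z ω = f (U.lieForm y ω) := by
  have hω : ω ∈ Submodule.span A (Set.range (KaehlerDifferential.D R A)) := by
    rw [KaehlerDifferential.span_range_derivation]; trivial
  induction hω using Submodule.span_induction with
  | mem ω hω =>
    obtain ⟨a, rfl⟩ := hω
    rw [lieForm_D, lieForm_D, h]
  | zero => rw [map_zero, map_zero]; exact (map_zero f).symm
  | add ω η _ _ h1 h2 => rw [map_add, map_add, h1, h2]; exact (map_add f _ _).symm
  | smul a ω _ h1 =>
    rw [map_smul, map_smul, Along.smul_def, Along.smul_def, h1]
    exact (hf _ _).symm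

/-- The coordinates of an element of `Lie(G)(C)`, for a basis of the differentials of `A`. -/
def lieCoord : LieMod σ (yonedaGrpObj G) C C →ₗ[C] (ι → C) where
  toFun y i := U.lieForm y (b i)
  map_add' y z := by
    have h : U.lieForm (y + z) = U.lieForm y + U.lieForm z := by
      apply Derivation.liftKaehlerDifferential_unique
      ext a
      change U.lieForm (y + z) (KaehlerDifferential.D R A a) =
        U.lieForm y (KaehlerDifferential.D R A a) + U.lieForm z (KaehlerDifferential.D R A a)
      rw [lieForm_D, lieForm_D, lieForm_D]
      exact U.snd_lieHom_add y z a
    funext i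
    exact congr($h (b i))
  map_smul' c y := by
    funext i
    exact U.lieForm_map y (c • y) (AddMonoidHom.mulLeft c) (fun a d => mul_left_comm _ _ _)
      (U.snd_lieHom_smul c y) (b i)

lemma lieCoord_injective : Function.Injective (U.lieCoord b (C := C)) := by
  intro y z h
  have h' : U.lieForm y = U.lieForm z := b.ext fun i => congrFun h i
  apply U.lieHom_injective
  ext a
  · rw [fst_lieHom, fst_lieHom]
  · rw [← lieForm_D, h', lieForm_D]

/-- Prescribed values on the basis extend to a linear map on differentials; its composite with `D`
is a derivation along the unit section, hence a point over the dual numbers. -/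
lemma lieCoord_surjective : Function.Surjective (U.lieCoord b (C := C)) := by
  intro f
  let d := (b.constr A (M' := Along (U.unitHom C)) f).compDer (KaehlerDifferential.D R A)
  let g : A →ₐ[R] DualRing C C := U.derivHom d (map_add d) d.leibniz d.map_algebraMap
  have hg : ∀ a, (g a).fst = U.unitHom C a := fun _ => rfl
  refine ⟨U.ofHom g hg, funext fun i => ?_⟩
  have h : U.lieForm (U.ofHom g hg) = b.constr A (M' := Along (U.unitHom C)) f := by
    apply Derivation.liftKaehlerDifferential_unique
    ext a
    refine (U.lieForm_D _ a).trans ?_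
    rw [lieHom_ofHom]
    rfl
  exact congr($h (b i)).trans (b.constr_basis A _ i)

lemma lieCoord_mapRing (f : C →ₐ[R] C') (y : LieMod σ (yonedaGrpObj G) C C) (i : ι) :
    U.lieCoord b (LieMod.mapRing f y) i = f (U.lieCoord b y i) :=
  U.lieForm_map y (LieMod.mapRing f y) f.toRingHom.toAddMonoidHom
    (fun a c => (map_mul f _ _).trans (congrArg (· * f c) congr($(U.comp_unitHom f) a)))
    (fun a => by rw [lieHom_mapRing]; rfl) (b i)

/-- The coordinates as an isomorphism `Lie(G)(C) = C ^ ι`. -/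
def lieEquiv (C : Type u) [CommRing C] [Algebra R C] :
    LieMod σ (yonedaGrpObj G) C C ≃ₗ[C] (ι → C) :=
  LinearEquiv.ofBijective (U.lieCoord b) ⟨U.lieCoord_injective b, U.lieCoord_surjective b⟩

/-- The basis of `Lie(G)(C)` dual to a basis of the differentials of `A`. -/
def lieBasis (C : Type u) [CommRing C] [Algebra R C] :
    Module.Basis ι C (LieMod σ (yonedaGrpObj G) C C) :=
  Module.Basis.ofEquivFun (U.lieEquiv b C)

lemma lieCoord_lieBasis [DecidableEq ι] (i : ι) :
    U.lieCoord b (U.lieBasis b C i) = Pi.single i 1 := by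
  rw [lieBasis, Module.Basis.coe_ofEquivFun]
  exact (U.lieEquiv b C).apply_symm_apply _

/-- The basis over every `C` is dual to the same basis of `Ω[A⁄R]`. This compatibility is what lets
coefficients descend from `B` to `R`. -/
lemma mapRing_lieBasis (f : C →ₐ[R] C') (i : ι) :
    LieMod.mapRing f (U.lieBasis b C i) = U.lieBasis b C' i := by
  classical
  apply U.lieCoord_injective b
  funext j
  rw [lieCoord_mapRing, lieCoord_lieBasis, lieCoord_lieBasis]
  by_cases h : j = i
  · subst h; simp
  · simp [h]

include U b in
/-- `Lie(G)(R) ⊗_R Ωⁿ = Lie(G)(B) ⊗_B Ωⁿ`. -/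
lemma toOn_bijective {B : Type u} [CommRing B] [Algebra R B] (n : ℕ) :
    Function.Bijective (toOn : LieForms R B σ (yonedaGrpObj G) n →+ _) := by
  classical
  let eR := TensorProduct.equivFinsuppOfBasisLeft (N := Forms R B n) (U.lieBasis b R)
  let eB := TensorProduct.equivFinsuppOfBasisLeft (N := Forms R B n) (U.lieBasis b B)
  -- In the two compatible bases both sides are families of forms indexed by `ι`, and the map is the
  -- identity on families.
  have h : ∀ f : ι →₀ Forms R B n, toOn (eR.symm f) = eB.symm f := by
    intro f
    induction f using Finsupp.induction_linear with
    | zero => simp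
    | add f g hf hg => simp only [map_add, hf, hg]
    | single i ω =>
      simp [eR, eB, mapRing_lieBasis]
  have h' : (toOn : LieForms R B σ (yonedaGrpObj G) n →+ _) = eB.symm ∘ eR := by
    funext w
    rw [Function.comp_apply, ← h, LinearEquiv.symm_apply_apply]
  rw [h']
  exact eB.symm.bijective.comp eR.bijective

end UnitChart

end UnitSection

/-! ### Infinitesimal closeness is local -/

section Closeness

namespace IsStronglyClose

variable {B B' C C' E : Type u} [CommRing B] [CommRing B'] [CommRing C] [CommRing C'] [CommRing E]
  {n : ℕ}

lemma map {x : Fin (n + 1) → (B →+* C)} (hx : IsStronglyClose x) (g : C →+* C') :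
    IsStronglyClose fun i => g.comp (x i) where
  sq_zero i j b b' := by
    simp only [RingHom.comp_apply, ← map_sub, ← map_mul, hx.sq_zero, map_zero]
  mul_zero i j b := by
    simp only [RingHom.comp_apply, ← map_sub, ← map_mul, hx.mul_zero, map_zero]

lemma comp {x : Fin (n + 1) → (B →+* C)} (hx : IsStronglyClose x) (g : B' →+* B) :
    IsStronglyClose fun i => (x i).comp g where
  sq_zero i j _ _ := hx.sq_zero i j _ _
  mul_zero i j _ := hx.mul_zero i j _

/-- Clear denominators: up to a unit, a difference at `a / f ^ m` is a combination of the
differences at `a` and at `f ^ m`. -/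
lemma of_isLocAway {x : Fin (n + 1) → (B →+* C)} (hx : IsStronglyClose x) {l : B →+* E} {f : B}
    (hl : IsLocAway l f) {z : Fin (n + 1) → (E →+* C)} (hz : ∀ i, (z i).comp l = x i) :
    IsStronglyClose z := by
  have hz : ∀ i b, z i (l b) = x i b := fun i b => congr($(hz i) b)
  have hu : ∀ i m, IsUnit (x i (f ^ m)) := fun i m => by
    rw [← hz, map_pow, map_pow]
    exact (hl.unit.map _).pow m
  have hsq : ∀ i j b b', (z i b - z j b) * (z i b' - z j b') = 0 := by
    intro i j b b'
    obtain ⟨m, a, ha⟩ := hl.surj b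
    obtain ⟨m', a', ha'⟩ := hl.surj b'
    rw [← map_pow] at ha ha'
    have h1 : ∀ k, x k (f ^ m) * z k b = x k a := fun k => by rw [← hz, ← hz, ← map_mul, ha]
    have h2 : ∀ k, x k (f ^ m') * z k b' = x k a' := fun k => by rw [← hz, ← hz, ← map_mul, ha']
    have hs := hx.sq_zero i j
    refine (((hu j m).mul (hu j m')).mul_right_eq_zero).mp ?_
    have e1 : x j (f ^ m) * (z i b - z j b) =
        (x i a - x j a) - (x i (f ^ m) - x j (f ^ m)) * z i b := by
      linear_combination h1 i - h1 j
    have e2 : x j (f ^ m') * (z i b' - z j b') =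
        (x i a' - x j a') - (x i (f ^ m') - x j (f ^ m')) * z i b' := by
      linear_combination h2 i - h2 j
    rw [mul_mul_mul_comm, e1, e2]
    linear_combination hs a a' - z i b' * hs a (f ^ m') - z i b * hs (f ^ m) a' +
      z i b * z i b' * hs (f ^ m) (f ^ m')
  refine ⟨hsq, fun i j b => ?_⟩
  obtain ⟨m, a, ha⟩ := hl.surj b
  rw [← map_pow] at ha
  have h1 : ∀ k, x k (f ^ m) * z k b = x k a := fun k => by rw [← hz, ← hz, ← map_mul, ha]
  -- The relations just proved replace `z k b` by `z 0 b` in the correction term. With the same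
  -- coefficient in both factors, the mixed terms cancel by `sub_mul_sub_swap`.
  have e : ∀ k, x 0 (f ^ m) * (z k b - z 0 b) =
      (x k a - x 0 a) - (x k (f ^ m) - x 0 (f ^ m)) * z 0 b := by
    intro k
    have h := hsq k 0 (l (f ^ m)) b
    rw [hz, hz] at h
    linear_combination h1 k - h1 0 - h
  refine (((hu 0 m).mul (hu 0 m)).mul_right_eq_zero).mp ?_
  rw [mul_mul_mul_comm, e, e]
  linear_combination hx.mul_zero i j a - z 0 b * hx.sub_mul_sub_swap i j a (f ^ m) +
    z 0 b * z 0 b * hx.mul_zero i j (f ^ m)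

/-- The relations are equations in `C`, and an element vanishes if its annihilator lies in no
maximal ideal. -/
lemma of_local {x : Fin (n + 1) → (B →+* C)}
    (H : ∀ q : PrimeSpectrum C, ∃ s ∉ q.asIdeal, ∃ (C' : Type u) (_ : CommRing C') (g : C →+* C'),
      IsLocAway g s ∧ IsStronglyClose fun i => g.comp (x i)) : IsStronglyClose x := by
  have key : ∀ v : C, (∀ (C' : Type u) (_ : CommRing C') (g : C →+* C'),
      (IsStronglyClose fun i => g.comp (x i)) → g v = 0) → v = 0 := by
    intro v hv
    by_contra hne
    have hI : Ideal.span {v} ≠ ⊥ := by simpa using hne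
    let I : Ideal C := Submodule.annihilator (Ideal.span {v})
    have hI : I ≠ ⊤ := by
      intro h
      apply hne
      have : (1 : C) ∈ I := by rw [h]; trivial
      simpa using Submodule.mem_annihilator.mp this v (Ideal.mem_span_singleton_self v)
    obtain ⟨q, hq, hle⟩ := Ideal.exists_le_maximal I hI
    obtain ⟨s, hs, C', _, g, hg, hx⟩ := H ⟨q, hq.isPrime⟩
    obtain ⟨m, hm⟩ := hg.inj v (hv C' _ g hx)
    refine hs (hq.isPrime.mem_of_pow_mem m (hle ?_))
    exact (Submodule.mem_annihilator_span_singleton v _).mpr hm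
  constructor
  · intro i j b b'
    refine key _ fun C' _ g hx => ?_
    simpa using hx.sq_zero i j b b'
  · intro i j b
    refine key _ fun C' _ g hx => ?_
    simpa using hx.mul_zero i j b

end IsStronglyClose

namespace AffineChart

variable {S : Scheme.{u}} {X : Over S} {R B C : Type u} [CommRing R] [CommRing B] [Algebra R B]
  [CommRing C] [Algebra R C] (c : AffineChart X R B) {n : ℕ}

/-- Infinitesimally close homomorphisms `B → C` define infinitesimally close points of `X`. -/
lemma isClose (x : Fin (n + 1) → (B →ₐ[R] C)) (hx : IsStronglyClose fun i => (x i : B →+* C)) :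
    IsClose fun i => c.point (x i) where
  base i j p := by
    change c.map (Spec.map (CommRingCat.ofHom (x i).toRingHom) p) =
      c.map (Spec.map (CommRingCat.ofHom (x j).toRingHom) p)
    refine congrArg c.map ?_
    refine PrimeSpectrum.ext (Ideal.ext fun b => ?_)
    change x i b ∈ (p : PrimeSpectrum C).asIdeal ↔ x j b ∈ (p : PrimeSpectrum C).asIdeal
    -- The difference has square zero, so it lies in every prime.
    have h : x i b - x j b ∈ (p : PrimeSpectrum C).asIdeal := by
      refine (p : PrimeSpectrum C).2.mem_of_pow_mem 2 ?_
      have h := hx.sq_zero i j b b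
      simp only [RingHom.coe_coe] at h
      rw [pow_two, h]
      exact zero_mem _
    exact ⟨fun h' => by simpa using sub_mem h' h, fun h' => by simpa using add_mem h h'⟩
  affine B' C' _ _ υ _ t a h := by
    obtain ⟨τ, rfl⟩ := Spec.map_surjective t
    let y i : B →+* C' := τ.hom.comp (x i : B →+* C)
    have hy : IsStronglyClose y := hx.map τ.hom
    have hya : ∀ i, Spec.map (CommRingCat.ofHom (y i)) ≫ c.map =
        Spec.map (CommRingCat.ofHom (a i)) ≫ υ := by
      intro i
      have e : Spec.map (CommRingCat.ofHom (y i)) =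
          Spec.map τ ≫ Spec.map (CommRingCat.ofHom (x i).toRingHom) :=
        Spec.map_comp (CommRingCat.ofHom (x i).toRingHom) τ
      rw [e]
      exact (Category.assoc _ _ _).trans (h i)
    -- The chart `υ` is unrelated to `c`. Near the image of `q` a basic open `D(f)` of `Spec B` maps
    -- into `υ`, and the two descriptions are compared over it.
    refine IsStronglyClose.of_local fun q => ?_
    have hp : Spec.map (CommRingCat.ofHom (y 0)) q ∈ c.map ⁻¹' Set.range υ :=
      ⟨Spec.map (CommRingCat.ofHom (a 0)) q, congr($(hya 0) q).symm⟩
    obtain ⟨_, ⟨f, rfl⟩, hpf, hf⟩ :=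
      PrimeSpectrum.isTopologicalBasis_basic_opens.exists_subset_of_mem_open hp
        (υ.opensRange.2.preimage c.map.continuous)
    let l := algebraMap B (Localization.Away f)
    have hl : IsLocAway l f := isLocAway_algebraMap B f
    have hr : Set.range (Spec.map (CommRingCat.ofHom l) ≫ c.map) ⊆ Set.range υ := by
      rintro _ ⟨p, rfl⟩
      rw [Scheme.Hom.comp_apply]
      refine hf ?_
      exact (Set.ext_iff.mp hl.range _).mp ⟨p, rfl⟩
    obtain ⟨l', hl'⟩ := Spec.map_surjective (IsOpenImmersion.lift υ _ hr)
    have hll' : Spec.map l' ≫ υ = Spec.map (CommRingCat.ofHom l) ≫ c.map := by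
      rw [hl', IsOpenImmersion.lift_fac]
    obtain ⟨g, hg⟩ : ∃ g : C' →+* Localization.Away (y 0 f), IsLocAway g (y 0 f) :=
      ⟨_, isLocAway_algebraMap C' (y 0 f)⟩
    refine ⟨y 0 f, hpf, _, inferInstance, g, hg, ?_⟩
    -- Inverting `y₀(f)` inverts every `yᵢ(f)`, as they differ by nilpotents. So all vertices extend
    -- to the localization of `B` at `f`.
    have hu : ∀ i, IsUnit (g (y i f)) := by
      intro i
      have h : g (y i f) = g (y 0 f) + g (y i f - y 0 f) := by rw [← map_add]; congr 1; ring
      rw [h]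
      refine IsNilpotent.isUnit_add_left_of_commute ?_ hg.unit (Commute.all _ _)
      exact ⟨2, by rw [pow_two, ← map_mul, hy.sq_zero, map_zero]⟩
    let z i : Localization.Away f →+* Localization.Away (y 0 f) :=
      IsLocalization.Away.lift f (g := g.comp (y i)) (hu i)
    have hz : ∀ i, (z i).comp l = g.comp (y i) := fun i => IsLocalization.Away.lift_comp f (hu i)
    have hzs : IsStronglyClose z := (hy.map g).of_isLocAway hl hz
    -- Both give the same point of `X`, and `υ` is a monomorphism; so closeness passes from the `zᵢ`
    -- to the `aᵢ`.
    have e : (fun i => g.comp (a i)) = fun i => (z i).comp l'.hom := by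
      funext i
      have e : Spec.map (CommRingCat.ofHom (g.comp (a i))) ≫ υ =
          Spec.map (CommRingCat.ofHom ((z i).comp l'.hom)) ≫ υ := by
        have e1 : Spec.map (CommRingCat.ofHom (g.comp (a i))) =
          Spec.map (CommRingCat.ofHom g) ≫ Spec.map (CommRingCat.ofHom (a i)) := Spec.map_comp _ _
        have e2 : Spec.map (CommRingCat.ofHom ((z i).comp l'.hom)) =
          Spec.map (CommRingCat.ofHom (z i)) ≫ Spec.map l' := Spec.map_comp _ _
        have e3 : Spec.map (CommRingCat.ofHom (z i)) ≫ Spec.map (CommRingCat.ofHom l) =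
          Spec.map (CommRingCat.ofHom g) ≫ Spec.map (CommRingCat.ofHom (y i)) := by
          rw [← Spec.map_comp, ← Spec.map_comp, ← CommRingCat.ofHom_comp, hz]; rfl
        rw [e1, e2, Category.assoc, Category.assoc, hll', ← hya, ← Category.assoc, ← e3,
          Category.assoc]
      rw [cancel_mono] at e
      exact congrArg CommRingCat.Hom.hom (Spec.map_injective e)
    rw [e]
    exact hzs.comp l'.hom

/-- The infinitesimal simplex given by infinitesimally close homomorphisms. -/
def simplex (x : Fin (n + 1) → (B →ₐ[R] C)) (hx : IsStronglyClose fun i => (x i : B →+* C)) :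
    Simplex X n (specOver c.base C) :=
  ⟨fun i => c.point (x i), c.isClose x hx⟩

variable {F : (Over S)ᵒᵖ ⥤ GrpCat.{v}} {f : Cochain F X n}

lemma specOverMap_point {C' : Type u} [CommRing C'] [Algebra R C'] (g : C →ₐ[R] C')
    (a : B →ₐ[R] C) : specOverMap c.base g ≫ c.point a = c.point (g.comp a) := by
  refine Over.OverMorphism.ext ?_
  refine (Category.assoc _ _ _).symm.trans ?_
  exact congrArg (· ≫ c.map) (Spec.map_comp _ _).symm

lemma ptsMap_simplex (hf : IsForm f) {C' : Type u} [CommRing C'] [Algebra R C'] (g : C →ₐ[R] C')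
    (x : Fin (n + 1) → (B →ₐ[R] C)) (hx : IsStronglyClose fun i => (x i : B →+* C))
    (x' : Fin (n + 1) → (B →ₐ[R] C')) (hx') (h : ∀ i, g.comp (x i) = x' i) :
    ptsMap c.base F g (f _ (c.simplex x hx)) = f _ (c.simplex x' hx') := by
  refine (hf.natural _ _).trans (congrArg (f _) (Subtype.ext (funext fun i => ?_)))
  exact (c.specOverMap_point g (x i)).trans (congrArg c.point (h i))

lemma simplex_degenerate (hf : IsForm f) (x : Fin (n + 1) → (B →ₐ[R] C)) (hx) (i : Fin n)
    (h : x i.castSucc = x i.succ) : f _ (c.simplex x hx) = 1 :=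
  hf.degenerate _ i (congrArg c.point h)

/-- Closeness of points of `X` is equivalent to the ring relations on the chart, so representing
becomes a condition on homomorphisms of algebras. -/
lemma represents_iff [InfLinear F] [NeZero n] (v : LieFormsOn R B c.base F n) :
    c.Represents v f ↔ ∀ (C : Type u) [CommRing C] [Algebra R C] (x : Fin (n + 1) → (B →ₐ[R] C))
      (hx : IsStronglyClose fun i => (x i : B →+* C)), f _ (c.simplex x hx) =
        ptsMap c.base F (evalHom x hx) (LieMod.ofTensor c.base B F (Forms R B n) v).val :=
  ⟨fun h C _ _ x hx => h C x (c.isClose x hx), fun h C _ _ x hx => h C x (c.isStronglyClose hx)⟩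

end AffineChart

end Closeness

/-! ### The universal infinitesimal edge -/

section UniversalEdge

variable {R B C : Type u} [CommRing R] [CommRing B] [Algebra R B] [CommRing C] [Algebra R C]

lemma oneForm_D (b : B) :
    oneForm (KaehlerDifferential.D R B b) = (dForm fun _ => b : Forms R B 1) := by
  refine Subtype.ext ?_
  simp [dForm, ExteriorAlgebra.ιMulti_apply]

variable (R B) in
/-- The second vertex of the universal infinitesimal edge: `b ↦ b + db`. -/
def edgeVertex : B →ₐ[R] DualRing B (Forms R B 1) where
  toFun b := ⟨b, oneForm (KaehlerDifferential.D R B b)⟩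
  map_one' := by ext1 <;> simp
  map_mul' b c := by ext1 <;> simp
  map_zero' := by ext1 <;> simp
  map_add' b c := by ext1 <;> simp
  commutes' r := by ext1 <;> simp [DualRing.algebraMap_eq]

@[simp] lemma fst_edgeVertex (b : B) : (edgeVertex R B b).fst = b := rfl
@[simp] lemma snd_edgeVertex (b : B) :
    (edgeVertex R B b).snd = oneForm (KaehlerDifferential.D R B b) := rfl

variable (R B) in
/-- The universal infinitesimal edge. -/
def edge : Fin 2 → (B →ₐ[R] DualRing B (Forms R B 1)) :=
  ![DualRing.inl R B (Forms R B 1), edgeVertex R B]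

lemma fst_edge (i : Fin 2) (b : B) : (edge R B i b).fst = b := by
  fin_cases i <;> rfl

variable (R B) in
lemma isStronglyClose_edge : IsStronglyClose fun i => (edge R B i : B →+* DualRing B (Forms R B 1)) := by
  have h : ∀ x y : DualRing B (Forms R B 1), x.fst = 0 → y.fst = 0 → x * y = 0 := by
    intro x y hx hy
    ext1 <;> simp [hx, hy]
  have h' : ∀ i j b, (edge R B i b - edge R B j b).fst = 0 := by
    intro i j b
    rw [sub_eq_add_neg, DualRing.fst_add, DualRing.fst_neg, fst_edge, fst_edge, add_neg_cancel]
  exact ⟨fun i j b b' => h _ _ (h' i j b) (h' i j b'), fun i j b => h _ _ (h' i 0 b) (h' j 0 b)⟩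

/-- Universality: every infinitesimal edge is the image of `edge` under its own evaluation
homomorphism. -/
lemma evalHom_comp_edge (x : Fin 2 → (B →ₐ[R] C)) (hx : IsStronglyClose fun i => (x i : B →+* C))
    (i : Fin 2) : (evalHom x hx).comp (edge R B i) = x i := by
  ext b
  rw [AlgHom.comp_apply, evalHom_apply, fst_edge]
  fin_cases i
  · exact (congrArg _ (map_zero (formValue x hx))).trans (add_zero _)
  · have h := formValue_smul_dForm x hx 1 fun _ => b
    rw [one_smul, map_one, one_mul, Fin.prod_univ_one] at h
    change x 0 b + formValue x hx (oneForm (KaehlerDifferential.D R B b)) = x 1 b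
    rw [oneForm_D, h]
    exact add_sub_cancel _ _

/-- Hence a representing form can be read off from the value on the universal edge, which gives
uniqueness in degree 1. -/
lemma evalHom_edge : evalHom (edge R B) (isStronglyClose_edge R B) = AlgHom.id R _ := by
  have h : ∀ v : Forms R B 1, formValue (edge R B) (isStronglyClose_edge R B) v = ⟨0, v⟩ := by
    intro v
    induction v using Forms.induction with
    | h0 => simp; rfl
    | hadd v w hv hw =>
      rw [map_add, hv, hw]
      ext1 <;> simp
    | h c b =>
      rw [formValue_smul_dForm, Fin.prod_univ_one]
      change DualRing.inl R B _ c * (edgeVertex R B (b 0) - DualRing.inl R B _ (b 0)) = _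
      have : b = fun _ => b 0 := funext fun i => by rw [Subsingleton.elim i 0]
      rw [this, ← oneForm_D]
      ext1 <;> simp [sub_eq_add_neg]
  refine AlgHom.ext fun y => DualRing.ext ?_ ?_
  · rw [evalHom_apply, h]
    exact add_zero _
  · rw [evalHom_apply, h, DualRing.snd_add]
    change (0 + y.snd : Forms R B 1) = _
    rw [zero_add]; rfl

variable {S : Scheme.{u}} {X : Over S} (c : AffineChart X R B) {F : (Over S)ᵒᵖ ⥤ GrpCat.{v}}
  [InfLinear F] {f : Cochain F X 1}

/-- Combinatorial `1`-forms are classical `1`-forms. -/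
lemma AffineChart.existsUnique_represents_one [Module.Free B Ω[B⁄R]] [Module.Finite B Ω[B⁄R]]
    (hf : IsForm f) : ∃! t : LieFormsOn R B c.base F 1, c.Represents t f := by
  have hbij := LieMod.ofTensor_bijective (σ := c.base) (F := F) (C := B) (M := Forms R B 1)
  have hE := isStronglyClose_edge R B
  let y := f _ (c.simplex (edge R B) hE)
  -- The augmentation collapses both vertices to the identity of `B`, so degeneracy places `y` in
  -- `Lie(F, Ω¹)`.
  have hy : ptsMap c.base F (DualRing.aug R B (Forms R B 1)) y = 1 := by
    have hi : ∀ i, (DualRing.aug R B (Forms R B 1)).comp (edge R B i) = AlgHom.id R B :=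
      fun i => AlgHom.ext fun b => fst_edge i b
    have h : IsStronglyClose fun _ : Fin 2 => ((AlgHom.id R B : B →ₐ[R] B) : B →+* B) :=
      ⟨fun _ _ _ _ => by simp, fun _ _ _ => by simp⟩
    exact (c.ptsMap_simplex hf _ _ hE _ h hi).trans (c.simplex_degenerate hf _ h 0 rfl)
  obtain ⟨t, ht⟩ := hbij.2 (LieMod.mk y hy)
  refine ⟨t, (c.represents_iff t).mpr fun C _ _ x hx => ?_, fun t' ht' => ?_⟩
  · rw [ht]
    exact (c.ptsMap_simplex hf _ _ hE x hx (evalHom_comp_edge x hx)).symm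
  · apply hbij.1
    rw [ht]
    ext1
    have h := (c.represents_iff t').mp ht' _ (edge R B) hE
    rw [evalHom_edge, ptsMap_id] at h
    exact h.symm

end UniversalEdge

/-! ### The universal infinitesimal triangle -/

section UniversalTriangle

/-- The ring `B ⊕ Ω e₁ ⊕ Ω e₂ ⊕ Ω² e₁ e₂` of functions on the scheme of infinitesimal triangles. -/
@[ext]
structure TriangleRing (R B : Type u) [CommRing R] [CommRing B] [Algebra R B] : Type u where
  vertex : B
  fst : Ω[B⁄R]
  snd : Ω[B⁄R]
  face : Forms R B 2

variable {R B C : Type u} [CommRing R] [CommRing B] [Algebra R B] [CommRing C] [Algebra R C]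

/-- The exterior product of two differentials. -/
def wedgeOne : Ω[B⁄R] →ₗ[B] Ω[B⁄R] →ₗ[B] Forms R B 2 := (wedge 1 1 2 rfl).compl₁₂ oneForm oneForm

lemma wedgeOne_swap (x y : Ω[B⁄R]) : wedgeOne x y + wedgeOne y x = 0 :=
  Subtype.ext (ExteriorAlgebra.ι_add_mul_swap x y)

lemma wedgeOne_self (x : Ω[B⁄R]) : wedgeOne x x = 0 :=
  Subtype.ext (ExteriorAlgebra.ι_sq_zero x)

namespace TriangleRing

instance : Zero (TriangleRing R B) := ⟨⟨0, 0, 0, 0⟩⟩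
instance : One (TriangleRing R B) := ⟨⟨1, 0, 0, 0⟩⟩
instance : Add (TriangleRing R B) :=
  ⟨fun x y => ⟨x.vertex + y.vertex, x.fst + y.fst, x.snd + y.snd, x.face + y.face⟩⟩
instance : Neg (TriangleRing R B) := ⟨fun x => ⟨-x.vertex, -x.fst, -x.snd, -x.face⟩⟩
instance : Mul (TriangleRing R B) := ⟨fun x y =>
  ⟨x.vertex * y.vertex, x.vertex • y.fst + y.vertex • x.fst, x.vertex • y.snd + y.vertex • x.snd,
    x.vertex • y.face + y.vertex • x.face + (wedgeOne x.fst y.snd + wedgeOne y.fst x.snd)⟩⟩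

@[simp] lemma vertex_zero : (0 : TriangleRing R B).vertex = 0 := rfl
@[simp] lemma fst_zero : (0 : TriangleRing R B).fst = 0 := rfl
@[simp] lemma snd_zero : (0 : TriangleRing R B).snd = 0 := rfl
@[simp] lemma face_zero : (0 : TriangleRing R B).face = 0 := rfl
@[simp] lemma vertex_one : (1 : TriangleRing R B).vertex = 1 := rfl
@[simp] lemma fst_one : (1 : TriangleRing R B).fst = 0 := rfl
@[simp] lemma snd_one : (1 : TriangleRing R B).snd = 0 := rfl
@[simp] lemma face_one : (1 : TriangleRing R B).face = 0 := rfl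
@[simp] lemma vertex_add (x y : TriangleRing R B) : (x + y).vertex = x.vertex + y.vertex := rfl
@[simp] lemma fst_add (x y : TriangleRing R B) : (x + y).fst = x.fst + y.fst := rfl
@[simp] lemma snd_add (x y : TriangleRing R B) : (x + y).snd = x.snd + y.snd := rfl
@[simp] lemma face_add (x y : TriangleRing R B) : (x + y).face = x.face + y.face := rfl
@[simp] lemma vertex_neg (x : TriangleRing R B) : (-x).vertex = -x.vertex := rfl
@[simp] lemma fst_neg (x : TriangleRing R B) : (-x).fst = -x.fst := rfl
@[simp] lemma snd_neg (x : TriangleRing R B) : (-x).snd = -x.snd := rfl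
@[simp] lemma face_neg (x : TriangleRing R B) : (-x).face = -x.face := rfl
@[simp] lemma vertex_mul (x y : TriangleRing R B) : (x * y).vertex = x.vertex * y.vertex := rfl
@[simp] lemma fst_mul (x y : TriangleRing R B) :
    (x * y).fst = x.vertex • y.fst + y.vertex • x.fst := rfl
@[simp] lemma snd_mul (x y : TriangleRing R B) :
    (x * y).snd = x.vertex • y.snd + y.vertex • x.snd := rfl
@[simp] lemma face_mul (x y : TriangleRing R B) : (x * y).face = x.vertex • y.face +
    y.vertex • x.face + (wedgeOne x.fst y.snd + wedgeOne y.fst x.snd) := rfl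

instance : CommRing (TriangleRing R B) where
  add_assoc x y z := by ext1 <;> simp [add_assoc]
  zero_add x := by ext1 <;> simp
  add_zero x := by ext1 <;> simp
  add_comm x y := by ext1 <;> simp [add_comm]
  neg_add_cancel x := by ext1 <;> simp
  nsmul := nsmulRec
  zsmul := zsmulRec
  left_distrib x y z := by
    ext1
    · simp [mul_add]
    · simp only [fst_mul, fst_add, vertex_add]; module
    · simp only [snd_mul, snd_add, vertex_add]; module
    · simp only [face_mul, face_add, fst_add, snd_add, vertex_add, map_add, LinearMap.add_apply]
      module
  right_distrib x y z := by
    ext1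
    · simp [add_mul]
    · simp only [fst_mul, fst_add, vertex_add]; module
    · simp only [snd_mul, snd_add, vertex_add]; module
    · simp only [face_mul, face_add, fst_add, snd_add, vertex_add, map_add, LinearMap.add_apply]
      module
  zero_mul x := by ext1 <;> simp
  mul_zero x := by ext1 <;> simp
  mul_assoc x y z := by
    ext1
    · simp [mul_assoc]
    · simp only [fst_mul, vertex_mul]; module
    · simp only [snd_mul, vertex_mul]; module
    · simp only [face_mul, fst_mul, snd_mul, vertex_mul, map_add, LinearMap.add_apply, map_smul,
        LinearMap.smul_apply]
      module
  one_mul x := by ext1 <;> simp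
  mul_one x := by ext1 <;> simp
  mul_comm x y := by
    ext1
    · simp [mul_comm]
    · simp only [fst_mul]; module
    · simp only [snd_mul]; module
    · simp only [face_mul]; module

/-- The inclusion `B → B ⊕ Ω e₁ ⊕ Ω e₂ ⊕ Ω² e₁ e₂`. -/
def inlRingHom (R B : Type u) [CommRing R] [CommRing B] [Algebra R B] : B →+* TriangleRing R B where
  toFun b := ⟨b, 0, 0, 0⟩
  map_zero' := rfl
  map_one' := rfl
  map_add' x y := by ext1 <;> simp
  map_mul' x y := by ext1 <;> simp

instance : Algebra R (TriangleRing R B) := ((inlRingHom R B).comp (algebraMap R B)).toAlgebra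

lemma algebraMap_eq (r : R) :
    algebraMap R (TriangleRing R B) r = ⟨algebraMap R B r, 0, 0, 0⟩ := rfl

/-- The homomorphism `b ↦ b + s db e₁ + t db e₂`. -/
def vertexHom (s t : B) : B →ₐ[R] TriangleRing R B where
  toFun b := ⟨b, s • KaehlerDifferential.D R B b, t • KaehlerDifferential.D R B b, 0⟩
  map_one' := by ext1 <;> simp
  map_mul' b c := by
    ext1
    · simp
    · simp only [fst_mul, Derivation.leibniz]; module
    · simp only [snd_mul, Derivation.leibniz]; module
    -- The extra term in the product is `s t (db ∧ dc + dc ∧ db)`, which vanishes.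
    · simp only [face_mul, map_smul, LinearMap.smul_apply, smul_zero, zero_add]
      rw [smul_comm t s, smul_comm t s, ← smul_add, ← smul_add, wedgeOne_swap, smul_zero, smul_zero]
  map_zero' := by ext1 <;> simp
  map_add' b c := by ext1 <;> simp
  commutes' r := by ext1 <;> simp [algebraMap_eq]

lemma vertexHom_sub (s t s' t' b : B) :
    (vertexHom s t b - vertexHom s' t' b : TriangleRing R B) =
      ⟨0, (s - s') • KaehlerDifferential.D R B b, (t - t') • KaehlerDifferential.D R B b, 0⟩ := by
  rw [sub_eq_add_neg]
  ext1
  · exact add_neg_cancel b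
  · change s • _ + -(s' • _) = _
    module
  · change t • _ + -(t' • _) = _
    module
  · exact add_neg_cancel _

variable (R B) in
/-- The universal infinitesimal triangle. -/
def triangle (i : Fin 3) : B →ₐ[R] TriangleRing R B := vertexHom (![0, 1, 0] i) (![0, 0, 1] i)

variable (R B) in
-- A difference of vertices at `b` is `db (s e₁ + t e₂)`. The first relation is antisymmetry of the
-- wedge for a fixed pair `(s, t)`, the second is `db ∧ db = 0`.
lemma isStronglyClose_triangle : IsStronglyClose fun i => (triangle R B i : B →+* TriangleRing R B) where
  sq_zero i j b b' := by
    simp only [RingHom.coe_coe, triangle, vertexHom_sub]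
    generalize (![0, 1, 0] i - ![0, 1, 0] j : B) = s
    generalize (![0, 0, 1] i - ![0, 0, 1] j : B) = t
    ext1
    · simp
    · simp
    · simp
    · simp only [face_mul, map_smul, LinearMap.smul_apply, smul_zero, zero_add, face_zero]
      rw [smul_comm t s, smul_comm t s, ← smul_add, ← smul_add, wedgeOne_swap, smul_zero, smul_zero]
  mul_zero i j b := by
    simp only [RingHom.coe_coe, triangle, vertexHom_sub]
    ext1 <;> simp [wedgeOne_self]

/-- The restriction to the triangles with `x₁ = x₀`. -/
def restrictLeft : TriangleRing R B →ₐ[R] DualRing B Ω[B⁄R] where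
  toFun x := ⟨x.vertex, x.snd⟩
  map_one' := rfl
  map_mul' _ _ := rfl
  map_zero' := rfl
  map_add' _ _ := rfl
  commutes' _ := rfl

/-- The restriction to the triangles with `x₁ = x₂`. -/
def restrictRight : TriangleRing R B →ₐ[R] DualRing B Ω[B⁄R] where
  toFun x := ⟨x.vertex, x.fst + x.snd⟩
  map_one' := by ext1 <;> simp
  map_mul' x y := by
    ext1
    · simp
    · simp only [fst_mul, snd_mul, DualRing.snd_mul]; module
  map_zero' := by ext1 <;> simp
  map_add' x y := by
    ext1
    · simp
    · simp only [fst_add, snd_add, DualRing.snd_add]; module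
  commutes' r := by ext1 <;> simp [algebraMap_eq, DualRing.algebraMap_eq]

/-- The inclusion `D_B(Ω²) → B ⊕ Ω e₁ ⊕ Ω e₂ ⊕ Ω² e₁ e₂`. -/
def ofFace : DualRing B (Forms R B 2) →ₐ[R] TriangleRing R B where
  toFun x := ⟨x.fst, 0, 0, x.snd⟩
  map_one' := rfl
  map_mul' x y := by ext1 <;> simp
  map_zero' := rfl
  map_add' x y := by ext1 <;> simp
  commutes' r := rfl

lemma ofFace_apply (x : DualRing B (Forms R B 2)) :
    (ofFace x : TriangleRing R B) = ⟨x.fst, 0, 0, x.snd⟩ := rfl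

/-- The kernel `Ω e₁ ⊕ Ω² e₁ e₂` has square zero. Surjectivity lets `UnitChart.exists_pt` describe
the value on the universal triangle in the chart of `G`. -/
instance surjective_specMap_restrictLeft :
    Surjective (Spec.map (CommRingCat.ofHom (restrictLeft (R := R) (B := B)).toRingHom)) := by
  refine surjective_specMap_of_nilpotent _ (fun x => ⟨⟨x.fst, 0, x.snd, 0⟩, rfl⟩)
    fun x hx => ⟨2, ?_⟩
  have h1 : x.vertex = 0 := congrArg DualRing.fst hx
  have h2 : x.snd = 0 := congrArg DualRing.snd hx
  ext1 <;> simp [pow_two, h1, h2]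

end TriangleRing

section

variable (x : Fin 3 → (B →ₐ[R] C)) (hx : IsStronglyClose fun i => (x i : B →+* C))

/-- The value of a differential on `(x₀, xᵢ)`, as an element of `C`. -/
def diffValue (i : Fin 3) : Ω[B⁄R] →+ C := (evalOne x hx i).toAddMonoidHom

lemma diffValue_D (i : Fin 3) (b : B) :
    diffValue x hx i (KaehlerDifferential.D R B b) = x i b - x 0 b := evalOne_D x hx i b

lemma diffValue_smul (i : Fin 3) (b : B) (ω : Ω[B⁄R]) :
    diffValue x hx i (b • ω) = x 0 b * diffValue x hx i ω := (evalOne x hx i).map_smul b ω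

lemma diffValue_mul_self (i : Fin 3) (ω η : Ω[B⁄R]) :
    diffValue x hx i ω * diffValue x hx i η = 0 := evalOne_mul_self x hx i ω η

lemma formValue_wedgeOne (ω η : Ω[B⁄R]) :
    formValue x hx (wedgeOne ω η) = diffValue x hx 1 ω * diffValue x hx 2 η := by
  have h : wedgeOne ω η = exteriorPower.ιMulti B 2 ![ω, η] := by
    refine Subtype.ext ?_
    simp [wedgeOne, ExteriorAlgebra.ιMulti_apply]
  rw [h]
  exact (evalForm_ιMulti x hx _).trans (Fin.prod_univ_two _)

/-- The value of a 2-form already contains a difference along each of the edges to `x₁` and `x₂`, so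
another difference along one of them kills it. -/
lemma diffValue_mul_formValue (i : Fin 3) (hi : i = 1 ∨ i = 2) (ω : Ω[B⁄R]) (v : Forms R B 2) :
    diffValue x hx i ω * formValue x hx v = 0 := by
  induction v using Forms.induction with
  | h0 => simp
  | hadd v w hv hw => rw [map_add, mul_add, hv, hw, add_zero]
  | h c b =>
    rw [formValue_smul_dForm, Fin.prod_univ_two]
    have h1 := diffValue_mul_self x hx i ω
    rcases hi with rfl | rfl
    · have h := h1 (KaehlerDifferential.D R B (b 0))
      rw [diffValue_D] at h
      change _ * (x 0 c * ((x 1 (b 0) - x 0 (b 0)) * (x 2 (b 1) - x 0 (b 1)))) = 0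
      linear_combination x 0 c * (x 2 (b 1) - x 0 (b 1)) * h
    · have h := h1 (KaehlerDifferential.D R B (b 1))
      rw [diffValue_D] at h
      change _ * (x 0 c * ((x 1 (b 0) - x 0 (b 0)) * (x 2 (b 1) - x 0 (b 1)))) = 0
      linear_combination x 0 c * (x 1 (b 0) - x 0 (b 0)) * h

/-- The homomorphism from the ring of the universal infinitesimal triangle given by an
infinitesimal triangle. -/
def triangleHom : TriangleRing R B →ₐ[R] C where
  toFun y := x 0 y.vertex + diffValue x hx 1 y.fst + diffValue x hx 2 y.snd +
    formValue x hx y.face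
  map_one' := by simp
  map_mul' y z := by
    simp only [TriangleRing.vertex_mul, TriangleRing.fst_mul, TriangleRing.snd_mul,
      TriangleRing.face_mul, map_add, map_mul, diffValue_smul, formValue_smul, formValue_wedgeOne]
    have h1 := diffValue_mul_self x hx 1 y.fst z.fst
    have h2 := diffValue_mul_self x hx 2 y.snd z.snd
    have h3 := diffValue_mul_formValue x hx 1 (.inl rfl) y.fst z.face
    have h4 := diffValue_mul_formValue x hx 1 (.inl rfl) z.fst y.face
    have h5 := diffValue_mul_formValue x hx 2 (.inr rfl) y.snd z.face
    have h6 := diffValue_mul_formValue x hx 2 (.inr rfl) z.snd y.face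
    have h7 : formValue x hx y.face * formValue x hx z.face = 0 := evalForm_mul x hx _ _
    linear_combination -h1 - h2 - h3 - h4 - h5 - h6 - h7
  map_zero' := by simp
  map_add' y z := by
    simp only [TriangleRing.vertex_add, TriangleRing.fst_add, TriangleRing.snd_add,
      TriangleRing.face_add, map_add]
    ring
  commutes' r := by simp [TriangleRing.algebraMap_eq]

lemma triangleHom_apply (y : TriangleRing R B) : triangleHom x hx y = x 0 y.vertex +
    diffValue x hx 1 y.fst + diffValue x hx 2 y.snd + formValue x hx y.face := rfl

lemma triangleHom_comp_ofFace : (triangleHom x hx).comp TriangleRing.ofFace = evalHom x hx := by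
  ext y
  rw [AlgHom.comp_apply, triangleHom_apply, evalHom_apply]
  simp [TriangleRing.ofFace_apply]

lemma triangleHom_comp_triangle (i : Fin 3) :
    (triangleHom x hx).comp (TriangleRing.triangle R B i) = x i := by
  ext b
  rw [AlgHom.comp_apply, triangleHom_apply]
  fin_cases i <;> simp [TriangleRing.triangle, TriangleRing.vertexHom, diffValue_D]

end

variable {S : Scheme.{u}} {X G : Over S} [GrpObj G] (c : AffineChart X R B)
  {f : Cochain (yonedaGrpObj G) X 2} {A : Type u} [CommRing A] [Algebra R A]

/-- Combinatorial `2`-forms are classical `2`-forms. -/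
lemma AffineChart.exists_represents_two (U : UnitChart G c.base A) [Module.Free B Ω[B⁄R]]
    [Module.Finite B Ω[B⁄R]] (hf : IsForm f) :
    ∃ v : LieFormsOn R B c.base (yonedaGrpObj G) 2, c.Represents v f := by
  have hT := TriangleRing.isStronglyClose_triangle R B
  let y := f _ (c.simplex (TriangleRing.triangle R B) hT)
  -- Setting `e₁ = 0` makes the first two vertices equal; setting `e₁ = e₂` below makes the last two
  -- equal.
  have hl : ptsMap c.base (yonedaGrpObj G) TriangleRing.restrictLeft y = 1 := by
    refine (c.ptsMap_simplex hf _ _ hT _ (hT.map (TriangleRing.restrictLeft (R := R)).toRingHom) fun i => rfl).trans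
      (c.simplex_degenerate hf _ _ 0 ?_)
    exact AlgHom.ext fun b => rfl
  have hr : ptsMap c.base (yonedaGrpObj G) TriangleRing.restrictRight y = 1 := by
    refine (c.ptsMap_simplex hf _ _ hT _ (hT.map (TriangleRing.restrictRight (R := R)).toRingHom) fun i => rfl).trans
      (c.simplex_degenerate hf _ _ 1 ?_)
    ext b <;> simp [TriangleRing.restrictRight, TriangleRing.triangle, TriangleRing.vertexHom]
  obtain ⟨g, hg⟩ := U.exists_pt _ y hl
  rw [← hg, U.ptsMap_pt, ← U.pt_unitHom] at hl hr
  have hl := U.pt_injective hl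
  have hr := U.pt_injective hr
  have h1 : ∀ a, (g a).vertex = U.unitHom B a := fun a => congrArg DualRing.fst congr($hl a)
  have h2 : ∀ a, (g a).snd = 0 := fun a => congrArg DualRing.snd congr($hl a)
  -- The left restriction kills the `e₂` component, the right one the sum of both edge components;
  -- so both vanish.
  have h3 : ∀ a, (g a).fst = 0 := fun a => by
    have : (g a).fst + (g a).snd = 0 := congrArg DualRing.snd congr($hr a)
    rwa [h2, add_zero] at this
  -- Without edge components the wedge terms of the multiplication disappear, and the face component
  -- is a derivation along the unit section.
  let h : A →ₐ[R] DualRing B (Forms R B 2) := U.derivHom (fun a => (g a).face)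
    (fun a b => by simp) (fun a b => by simp [h1, h2, h3])
    (fun r => by rw [AlgHom.commutes]; rfl)
  have hh : ∀ a, (h a).fst = U.unitHom B a := fun a => rfl
  have hgh : TriangleRing.ofFace.comp h = g := by
    ext a : 1
    exact TriangleRing.ext (h1 a).symm (h3 a).symm (h2 a).symm rfl
  obtain ⟨v, hv⟩ := (LieMod.ofTensor_bijective (σ := c.base) (F := yonedaGrpObj G) (C := B)
    (M := Forms R B 2)).2 (U.ofHom h hh)
  refine ⟨v, (c.represents_iff v).mpr fun C _ _ x hx => ?_⟩
  rw [hv]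
  refine (c.ptsMap_simplex hf _ _ hT x hx (triangleHom_comp_triangle x hx)).symm.trans ?_
  refine (congrArg _ hg.symm).trans ?_
  rw [U.ptsMap_pt, ← hgh, ← AlgHom.comp_assoc, triangleHom_comp_ofFace]
  exact (U.ptsMap_pt _ _).symm

end UniversalTriangle

/-! ### Classical forms are determined by the combinatorial forms which they define -/

section SimplexRing

variable (R B : Type u) [CommRing R] [CommRing B] [Algebra R B] (n : ℕ)

/-- The algebra `Λ(Ω) ⊗ Λ(Bⁿ)`. -/
abbrev BiExterior : Type u := ExteriorAlgebra B Ω[B⁄R] ⊗[B] ExteriorAlgebra B (Fin n → B)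

/-- The product of a differential and a vector in `Λ(Ω) ⊗ Λ(Bⁿ)`. -/
def biVector (ω : Ω[B⁄R]) (m : Fin n → B) : BiExterior R B n :=
  ExteriorAlgebra.ι B ω ⊗ₜ ExteriorAlgebra.ι B m

variable {R B n} in
lemma biVector_mul (ω η : Ω[B⁄R]) (m k : Fin n → B) :
    biVector R B n ω m * biVector R B n η k =
      (ExteriorAlgebra.ι B ω * ExteriorAlgebra.ι B η) ⊗ₜ
        (ExteriorAlgebra.ι B m * ExteriorAlgebra.ι B k) :=
  Algebra.TensorProduct.tmul_mul_tmul _ _ _ _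

variable {R B n} in
lemma biVector_mul_comm (ω η : Ω[B⁄R]) (m k : Fin n → B) :
    biVector R B n ω m * biVector R B n η k = biVector R B n η k * biVector R B n ω m := by
  have h : ExteriorAlgebra.ι B m * ExteriorAlgebra.ι B k =
      -(ExteriorAlgebra.ι B k * ExteriorAlgebra.ι B m) :=
    eq_neg_of_add_eq_zero_left (ExteriorAlgebra.ι_add_mul_swap m k)
  rw [biVector_mul, biVector_mul, ι_mul_ι_comm, h, TensorProduct.neg_tmul, TensorProduct.tmul_neg,
    neg_neg]

/-- The products of differentials and vectors. -/
def biVectors : Set (BiExterior R B n) :=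
  Set.range fun p : Ω[B⁄R] × (Fin n → B) => biVector R B n p.1 p.2

/-- The commutative subring of `Λ(Ω) ⊗ Λ(Bⁿ)` generated by the products of differentials and
vectors: the functions on the scheme of infinitesimal `n`-simplices. -/
def SimplexRing : Type u := Algebra.adjoin B (biVectors R B n)

namespace SimplexRing

instance : Ring (SimplexRing R B n) :=
  inferInstanceAs (Ring (Algebra.adjoin B (biVectors R B n)))

instance : CommRing (SimplexRing R B n) where
  mul_comm := by
    have h : IsMulCommutative (Algebra.adjoin B (biVectors R B n)) := by
      refine Algebra.isMulCommutative_adjoin B ?_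
      rintro _ ⟨p, rfl⟩ _ ⟨q, rfl⟩
      exact biVector_mul_comm _ _ _ _
    exact h.is_comm.comm

instance : Algebra B (SimplexRing R B n) :=
  inferInstanceAs (Algebra B (Algebra.adjoin B (biVectors R B n)))

instance : Algebra R (SimplexRing R B n) :=
  ((algebraMap B (SimplexRing R B n)).comp (algebraMap R B)).toAlgebra

variable {R B n}

/-- The inclusion into `Λ(Ω) ⊗ Λ(Bⁿ)`. -/
def incl : SimplexRing R B n →ₐ[B] BiExterior R B n := (Algebra.adjoin B (biVectors R B n)).val

lemma incl_injective : Function.Injective (incl : SimplexRing R B n → _) := Subtype.val_injective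

/-- The product of a differential and a vector. -/
def mk (ω : Ω[B⁄R]) (m : Fin n → B) : SimplexRing R B n :=
  ⟨biVector R B n ω m, Algebra.subset_adjoin ⟨(ω, m), rfl⟩⟩

lemma incl_mk (ω : Ω[B⁄R]) (m : Fin n → B) : incl (mk ω m) = biVector R B n ω m := rfl

lemma mk_add_left (ω η : Ω[B⁄R]) (m : Fin n → B) : mk (ω + η) m = mk ω m + mk η m := by
  apply incl_injective
  rw [map_add, incl_mk, incl_mk, incl_mk, biVector, map_add, TensorProduct.add_tmul]
  rfl

lemma mk_smul_left (b : B) (ω : Ω[B⁄R]) (m : Fin n → B) : mk (b • ω) m = b • mk ω m := by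
  apply incl_injective
  rw [map_smul, incl_mk, incl_mk, biVector, map_smul]
  rfl

lemma mk_sub_right (ω : Ω[B⁄R]) (m k : Fin n → B) : mk ω (m - k) = mk ω m - mk ω k := by
  apply incl_injective
  rw [map_sub, incl_mk, incl_mk, incl_mk, biVector, map_sub, TensorProduct.tmul_sub]
  rfl

lemma mk_mul_mk_right (ω η : Ω[B⁄R]) (m : Fin n → B) : mk ω m * mk η m = 0 := by
  apply incl_injective
  rw [map_mul, incl_mk, incl_mk, biVector_mul, ExteriorAlgebra.ι_sq_zero, TensorProduct.tmul_zero,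
    map_zero]

lemma mk_mul_mk_left (ω : Ω[B⁄R]) (m k : Fin n → B) : mk ω m * mk ω k = 0 := by
  apply incl_injective
  rw [map_mul, incl_mk, incl_mk, biVector_mul, ExteriorAlgebra.ι_sq_zero, TensorProduct.zero_tmul,
    map_zero]

lemma mk_zero_left (m : Fin n → B) : mk (0 : Ω[B⁄R]) m = 0 := by
  simpa using mk_smul_left 0 (0 : Ω[B⁄R]) m

/-- The homomorphism `b ↦ b + db m`. -/
def vertexHom (m : Fin n → B) : B →ₐ[R] SimplexRing R B n where
  toFun b := algebraMap B _ b + mk (KaehlerDifferential.D R B b) m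
  map_one' := by simp [mk_zero_left]
  map_mul' b c := by
    rw [Derivation.leibniz, mk_add_left, mk_smul_left, mk_smul_left, Algebra.smul_def,
      Algebra.smul_def, map_mul]
    linear_combination -mk_mul_mk_right (KaehlerDifferential.D R B b) (KaehlerDifferential.D R B c) m
  map_zero' := by simp [mk_zero_left]
  map_add' b c := by
    rw [map_add, map_add, mk_add_left]
    ring
  commutes' r := by
    rw [Derivation.map_algebraMap, mk_zero_left, add_zero]
    rfl

lemma vertexHom_sub (m k : Fin n → B) (b : B) :
    (vertexHom m b - vertexHom k b : SimplexRing R B n) =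
      mk (KaehlerDifferential.D R B b) (m - k) := by
  rw [mk_sub_right]
  exact add_sub_add_left_eq_sub _ _ _

variable (R B n) in
/-- The universal infinitesimal simplex. -/
def vertices (i : Fin (n + 1)) : B →ₐ[R] SimplexRing R B n :=
  vertexHom (Fin.cons (α := fun _ => Fin n → B) 0 (fun j => Pi.single j 1) i)

lemma vertices_zero (b : B) : vertices R B n 0 b = algebraMap B _ b := by
  change algebraMap B (SimplexRing R B n) b + mk (KaehlerDifferential.D R B b) (0 : Fin n → B) = _
  have h := mk_sub_right (n := n) (KaehlerDifferential.D R B b) 0 0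
  rw [sub_zero, sub_self] at h
  rw [h, add_zero]

variable (R B n) in
-- The two relations are the two ways a product of vectors `ω ⊗ m` vanishes: equal second factors
-- give `sq_zero`, equal first factors give `mul_zero`.
lemma isStronglyClose_vertices :
    IsStronglyClose fun i => (vertices R B n i : B →+* SimplexRing R B n) where
  sq_zero i j b b' := by
    simp only [RingHom.coe_coe, vertices, vertexHom_sub, mk_mul_mk_right]
  mul_zero i j b := by
    simp only [RingHom.coe_coe, vertices, vertexHom_sub, mk_mul_mk_left]

lemma prod_ofFn_tmul {E E' : Type u} [Ring E] [Algebra B E] [Ring E'] [Algebra B E'] {k : ℕ}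
    (a : Fin k → E) (b : Fin k → E') : (List.ofFn fun i => a i ⊗ₜ[B] b i).prod =
      (List.ofFn a).prod ⊗ₜ[B] (List.ofFn b).prod := by
  induction k with
  | zero => simp; rfl
  | succ k ih =>
    rw [List.ofFn_succ, List.ofFn_succ, List.ofFn_succ, List.prod_cons, List.prod_cons,
      List.prod_cons, ih, Algebra.TensorProduct.tmul_mul_tmul]

/-- The differences of the universal simplex are `db ⊗ eᵢ`. The tensor product multiplies factor by
factor without signs, so their product is `db₁ ∧ … ∧ dbₙ ⊗ e₁ ∧ … ∧ eₙ`. -/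
lemma incl_formValue (v : Forms R B n) :
    incl (formValue (vertices R B n) (isStronglyClose_vertices R B n) v) =
      (v : ExteriorAlgebra B Ω[B⁄R]) ⊗ₜ[B]
        ExteriorAlgebra.ιMulti B n (fun j => (Pi.single j 1 : Fin n → B)) := by
  induction v using Forms.induction with
  | h0 => simp
  | hadd v w hv hw => rw [map_add, map_add, hv, hw, Submodule.coe_add, TensorProduct.add_tmul]
  | h c b =>
    have h : ∀ i : Fin n, vertices R B n i.succ (b i) - vertices R B n 0 (b i) =
        mk (KaehlerDifferential.D R B (b i)) (Pi.single i 1) := by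
      intro i
      rw [vertices, vertices, vertexHom_sub]
      simp
    rw [formValue_smul_dForm]
    simp only [h]
    rw [vertices_zero, ← Algebra.smul_def, map_smul, ← List.prod_ofFn, map_list_prod,
      List.map_ofFn]
    have h' := prod_ofFn_tmul (B := B) (fun i => ExteriorAlgebra.ι B (KaehlerDifferential.D R B (b i)))
      (fun i => ExteriorAlgebra.ι B (Pi.single i 1 : Fin n → B))
    refine (congrArg (c • ·) h').trans ?_
    rw [Submodule.coe_smul, TensorProduct.smul_tmul']
    rfl

lemma formValue_injective : Function.Injective
    (formValue (vertices R B n) (isStronglyClose_vertices R B n)) := by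
  -- The determinant in degree `n`, and zero in the other degrees; it takes the value 1 on `e₁ ∧ … ∧
  -- eₙ` and so recovers `v`.
  let δ : ExteriorAlgebra B (Fin n → B) →ₗ[B] B := ExteriorAlgebra.liftAlternating
    (fun k => if h : k = n then h ▸ Matrix.detRowAlternating else 0)
  have hδ : δ (ExteriorAlgebra.ιMulti B n (fun j => (Pi.single j 1 : Fin n → B))) = 1 := by
    rw [ExteriorAlgebra.liftAlternating_apply_ιMulti, dif_pos rfl]
    change Matrix.det (Matrix.of fun j : Fin n => (Pi.single j 1 : Fin n → B)) = 1
    convert Matrix.det_one (R := B) (n := Fin n)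
    ext i j
    rw [Matrix.one_apply, Matrix.of_apply, Pi.single_apply]
    simp only [eq_comm]
  intro v w h
  have h' := congrArg (fun z => TensorProduct.rid B _
    (LinearMap.lTensor (ExteriorAlgebra B Ω[B⁄R]) δ (incl z))) h
  simp only [incl_formValue, LinearMap.lTensor_tmul, hδ, TensorProduct.rid_tmul, one_smul] at h'
  exact Subtype.ext h'

end SimplexRing

variable {R B n} {S : Scheme.{u}} {X G : Over S} [GrpObj G] (c : AffineChart X R B)
  {f : Cochain (yonedaGrpObj G) X n} {A : Type u} [CommRing A] [Algebra R A]

/-- A classical form is determined by the combinatorial form which it defines. -/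
lemma AffineChart.represents_unique [NeZero n] (U : UnitChart G c.base A) [Module.Free B Ω[B⁄R]]
    [Module.Finite B Ω[B⁄R]] {v w : LieFormsOn R B c.base (yonedaGrpObj G) n}
    (hv : c.Represents v f) (hw : c.Represents w f) : v = w := by
  have hV := SimplexRing.isStronglyClose_vertices R B n
  have h := ((c.represents_iff v).mp hv _ _ hV).symm.trans ((c.represents_iff w).mp hw _ _ hV)
  rw [← U.pt_lieHom, ← U.pt_lieHom, U.ptsMap_pt, U.ptsMap_pt] at h
  have h := U.pt_injective h
  refine (LieMod.ofTensor_bijective (σ := c.base) (F := yonedaGrpObj G) (C := B)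
    (M := Forms R B n)).1 (U.lieHom_injective (AlgHom.ext fun a => DualRing.ext ?_ ?_))
  · rw [U.fst_lieHom, U.fst_lieHom]
  -- In the unit chart the two points agree as homomorphisms on `A`; their first parts come from the
  -- unit section, so the values of their form parts on the universal simplex agree.
  · apply SimplexRing.formValue_injective
    have ha := congr($h a)
    rw [AlgHom.comp_apply, AlgHom.comp_apply, evalHom_apply, evalHom_apply, U.fst_lieHom,
      U.fst_lieHom] at ha
    exact add_left_cancel ha

end SimplexRing

/-! ### Local representability implies vanishing on degenerate simplices -/

section Degenerate

/-- If `x₀ = x₁` the first factor of the product is zero. If `xᵢ = xᵢ₊₁` with `i > 0`, two factors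
are differences along the same edge, and their product is zero. -/
lemma formValue_eq_zero {R B C : Type u} [CommRing R] [CommRing B] [Algebra R B] [CommRing C]
    [Algebra R C] {n : ℕ} (x : Fin (n + 1) → (B →ₐ[R] C))
    (hx : IsStronglyClose fun i => (x i : B →+* C)) (i : Fin n) (h : x i.castSucc = x i.succ)
    (v : Forms R B n) : formValue x hx v = 0 := by
  induction v using Forms.induction with
  | h0 => exact map_zero _
  | hadd v w hv hw => rw [map_add, hv, hw, add_zero]
  | h c b =>
    rw [formValue_smul_dForm]
    refine mul_eq_zero_of_right _ ?_
    obtain ⟨n, rfl⟩ : ∃ m, n = m + 1 := ⟨n - 1, by have := i.pos; omega⟩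
    induction i using Fin.cases with
    | zero =>
      refine Finset.prod_eq_zero (Finset.mem_univ 0) ?_
      rw [← h]
      exact sub_self _
    | succ j =>
      have hd := Finset.prod_dvd_prod_of_subset {j.castSucc, j.succ} Finset.univ
        (fun i : Fin (n + 1) => x i.succ (b i) - x 0 (b i)) (Finset.subset_univ _)
      rw [Finset.prod_pair Fin.castSucc_lt_succ.ne, ← h, ← Fin.succ_castSucc] at hd
      refine zero_dvd_iff.mp ?_
      have h0 := hx.sq_zero j.castSucc.succ 0 (b j.castSucc) (b j.succ)
      simp only [RingHom.coe_coe] at h0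
      rwa [h0] at hd

variable {S : Scheme.{u}} {X : Over S} {F : (Over S)ᵒᵖ ⥤ GrpCat.{v}} {n : ℕ} {f : Cochain F X n}

lemma AffineChart.simplex_eq_one {R B C : Type u} [CommRing R] [CommRing B] [Algebra R B]
    [CommRing C] [Algebra R C] (c : AffineChart X R B) [InfLinear F] [NeZero n]
    {v : LieFormsOn R B c.base F n} (hv : c.Represents v f) (x : Fin (n + 1) → (B →ₐ[R] C)) (hx)
    (i : Fin n) (h : x i.castSucc = x i.succ) : f _ (c.simplex x hx) = 1 := by
  rw [(c.represents_iff v).mp hv]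
  refine LieMod.map_val_eq_one _ _ fun y => ?_
  rw [evalHom_apply, evalHom_apply, formValue_eq_zero x hx i h, formValue_eq_zero x hx i h]

/-- The restriction of an infinitesimal simplex to an affine open subscheme which it maps to an
affine chart. -/
lemma AffineChart.exists_simplex {R B : Type u} [CommRing R] [CommRing B] [Algebra R B]
    (c : AffineChart X R B) {T : Over S} (x : Simplex X n T) {C : Type u} [CommRing C]
    (κ : Spec (.of C) ⟶ T.left) (hκ : ∀ q, (x.1 0).left (κ q) ∈ Set.range c.map) :
    ∃ (_ : Algebra R C) (k : specOver c.base C ⟶ T) (α : Fin (n + 1) → (B →ₐ[R] C))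
      (hα : IsStronglyClose fun i => (α i : B →+* C)), k.left = κ ∧ x.pull k = c.simplex α hα := by
  have := c.isOpenImmersion_map
  have := c.isOpenImmersion_base
  have hl : ∀ i, ∃ a : B →+* C, Spec.map (CommRingCat.ofHom a) ≫ c.map = κ ≫ (x.1 i).left := by
    intro i
    have hr : Set.range (κ ≫ (x.1 i).left) ⊆ Set.range c.map := by
      rintro _ ⟨q, rfl⟩
      rw [Scheme.Hom.comp_apply, x.2.base i 0]
      exact hκ q
    obtain ⟨a, ha⟩ := Spec.map_surjective (IsOpenImmersion.lift c.map _ hr)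
    exact ⟨a.hom, by rw [CommRingCat.ofHom_hom, ha, IsOpenImmersion.lift_fac]⟩
  choose a ha using hl
  have hb : ∀ i, Spec.map (CommRingCat.ofHom ((a i).comp (algebraMap R B))) ≫ c.base =
      κ ≫ T.hom := by
    intro i
    have e : Spec.map (CommRingCat.ofHom ((a i).comp (algebraMap R B))) =
        Spec.map (CommRingCat.ofHom (a i)) ≫ Spec.map (CommRingCat.ofHom (algebraMap R B)) :=
      Spec.map_comp (CommRingCat.ofHom (algebraMap R B)) (CommRingCat.ofHom (a i))
    rw [e, Category.assoc, ← c.comp_hom, ← Category.assoc, ha, Category.assoc, Over.w]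
  -- The choice of vertex is harmless: every vertex has the same composite to `S`, and `c.base` is a
  -- monomorphism.
  let _ : Algebra R C := ((a 0).comp (algebraMap R B)).toAlgebra
  have hc : ∀ i r, a i (algebraMap R B r) = algebraMap R C r := by
    intro i r
    have e := (hb i).trans (hb 0).symm
    rw [cancel_mono] at e
    exact congr(CommRingCat.Hom.hom $(Spec.map_injective e) r)
  let α i : B →ₐ[R] C := ⟨a i, hc i⟩
  have hα : ∀ i, Spec.map (CommRingCat.ofHom (α i : B →+* C)) ≫ c.map = κ ≫ (x.1 i).left := ha
  refine ⟨inferInstance, Over.homMk κ (hb 0).symm, α,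
    x.2.affine B C c.map κ _ fun i => (hα i).symm, rfl, Subtype.ext (funext fun i => ?_)⟩
  exact Over.OverMorphism.ext (hα i).symm

/-- Morphisms to a scheme agree if they agree on affine open neighbourhoods. -/
lemma hom_ext_of_affine {T W : Scheme.{u}} (a b : T ⟶ W)
    (H : ∀ q : T, ∃ (C : Type u) (_ : CommRing C) (κ : Spec (.of C) ⟶ T),
      IsOpenImmersion κ ∧ q ∈ Set.range κ ∧ κ ≫ a = κ ≫ b) : a = b := by
  choose C iC κ hκ hq h using H
  let 𝒰 : T.OpenCover := {
    I₀ := T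
    X q := Spec (.of (C q))
    f q := κ q
    mem₀ := by
      rw [Scheme.presieve₀_mem_precoverage_iff]
      exact ⟨fun q => ⟨q, hq q⟩, hκ⟩ }
  exact Scheme.Cover.hom_ext 𝒰 _ _ h

/-- Equality of morphisms to `G` is local on `T`. Near each point the simplex lies in one chart,
where it stays degenerate and a represented form takes the value 1. -/
lemma isForm_of_represents {G : Over S} [GrpObj G] {f : Cochain (yonedaGrpObj G) X n} [NeZero n]
    (hf : ∀ {T T' : Over S} (g : T' ⟶ T) (x : Simplex X n T),
      (yonedaGrpObj G).map g.op (f T x) = f T' (x.pull g))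
    (H : ∀ p : X.left, ∃ (R B : Type u) (_ : CommRing R) (_ : CommRing B) (_ : Algebra R B)
      (c : AffineChart X R B) (v : LieFormsOn R B c.base (yonedaGrpObj G) n),
      p ∈ Set.range c.map ∧ c.Represents v f) : IsForm f where
  natural := hf
  degenerate {T} x i hi := by
    refine Over.OverMorphism.ext (hom_ext_of_affine _ _ fun q => ?_)
    obtain ⟨R, B, _, _, _, c, v, hp, hv⟩ := H ((x.1 0).left q)
    have := c.isOpenImmersion_map
    obtain ⟨V, hV, hqV, hVs⟩ := T.left.isBasis_affineOpens.exists_subset_of_mem_open hp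
      (c.map.opensRange.2.preimage (x.1 0).left.continuous)
    obtain ⟨V, hV, rfl⟩ := hV
    have hV : IsAffineOpen V := hV
    have hr : Set.range hV.fromSpec = V := hV.range_fromSpec
    refine ⟨Γ(T.left, V), inferInstance, hV.fromSpec, inferInstance, by rwa [hr], ?_⟩
    obtain ⟨_, k, α, hα, hk, hxk⟩ := c.exists_simplex x hV.fromSpec fun q => hVs (by
      rw [← hr]; exact ⟨q, rfl⟩)
    have h := hf k x
    rw [hxk, c.simplex_eq_one hv α hα i] at h
    · have h := h.trans (map_one ((yonedaGrpObj G).map k.op).hom).symm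
      have h : k ≫ (f T x : T ⟶ G) = k ≫ (1 : (yonedaGrpObj G).obj (op T)) := h
      rw [← hk]
      exact congrArg CommaMorphism.left h
    · have e : (x.pull k).1 i.castSucc = (x.pull k).1 i.succ := congrArg (k ≫ ·) hi
      rw [hxk] at e
      have e : c.point (α i.castSucc) = c.point (α i.succ) := e
      have e : Spec.map (CommRingCat.ofHom (α i.castSucc).toRingHom) ≫ c.map =
          Spec.map (CommRingCat.ofHom (α i.succ).toRingHom) ≫ c.map := congrArg CommaMorphism.left e
      rw [cancel_mono] at e
      exact AlgHom.ext fun b => congr(CommRingCat.Hom.hom $(Spec.map_injective e) b)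

lemma delta2_natural {χ : Cochain (autPresheaf F) X 1} {φ : Cochain F X 2} (hφ : IsForm φ)
    (hχ : IsForm χ) {T T' : Over S} (g : T' ⟶ T) (x : Simplex X 3 T) :
    F.map g.op (delta2 χ φ T x) = delta2 χ φ T' (x.pull g) := by
  have h1 := (AutSection.map_eval g (χ T (x.reindex ![0, 1])) (φ T (x.reindex ![1, 2, 3]))).trans
    (congrArg₂ AutSection.eval (hχ.natural g (x.reindex ![0, 1]))
      (hφ.natural g (x.reindex ![1, 2, 3])))
  simp only [delta2, map_mul]
  exact congrArg₂ (· * ·) (congrArg₂ (· * ·) (congrArg₂ (· * ·) h1 (hφ.natural g _))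
    (hφ.natural g _)) (hφ.natural g _)

end Degenerate

/-! ### Charts of smooth schemes -/

section SmoothCharts

variable {S : Scheme.{u}}

/-- A smooth scheme has standard smooth affine charts over arbitrarily small open subschemes of
the base. -/
lemma exists_standardSmooth_chart (X : Over S) [Smooth X.hom] (p : X.left) (W : S.Opens)
    (hp : X.hom p ∈ W) : ∃ (R B : Type u) (_ : CommRing R) (_ : CommRing B) (_ : Algebra R B)
      (c : AffineChart X R B), p ∈ Set.range c.map ∧ Set.range c.base ⊆ W ∧
        Algebra.IsStandardSmooth R B := by
  -- Working with the restriction over `W` forces the affine open of the base into `W`.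
  have : Smooth (X.hom ∣_ W) := inferInstance
  obtain ⟨U, hU, V, hV, hpV, e, he⟩ :=
    Smooth.exists_isStandardSmooth (X.hom ∣_ W) (⟨p, hp⟩ : (X.hom ⁻¹ᵁ W).toScheme)
  let φ := (X.hom ∣_ W).appLE U V e
  let _ : Algebra Γ(W, U) Γ((X.hom ⁻¹ᵁ W).toScheme, V) := φ.hom.toAlgebra
  refine ⟨Γ(W, U), Γ((X.hom ⁻¹ᵁ W).toScheme, V), inferInstance, inferInstance, inferInstance,
    ⟨hU.fromSpec ≫ W.ι, hV.fromSpec ≫ (X.hom ⁻¹ᵁ W).ι, inferInstance, inferInstance, ?_⟩,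
    ?_, ?_, he⟩
  · have h := IsAffineOpen.SpecMap_appLE_fromSpec (X.hom ∣_ W) hU hV e
    rw [Category.assoc, ← morphismRestrict_ι, ← Category.assoc, ← h, Category.assoc]
    rfl
  · have hr : (⟨p, hp⟩ : (X.hom ⁻¹ᵁ W).toScheme) ∈ Set.range hV.fromSpec := by
      rw [hV.range_fromSpec]
      exact hpV
    obtain ⟨q, hq⟩ := hr
    refine ⟨q, ?_⟩
    rw [Scheme.Hom.comp_apply, hq]
    rfl
  · rintro _ ⟨q, rfl⟩
    rw [Scheme.Hom.comp_apply]
    exact (hU.fromSpec q).2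

variable (G : Over S) [GrpObj G]

/-- The unit section of a group scheme. -/
def unitSection : S ⟶ G.left :=
  CommaMorphism.left (show Over.mk (𝟙 S) ⟶ G from (1 : (yonedaGrpObj G).obj (op (Over.mk (𝟙 S)))))

lemma unitSection_hom : unitSection G ≫ G.hom = 𝟙 S :=
  Over.w (show Over.mk (𝟙 S) ⟶ G from (1 : (yonedaGrpObj G).obj (op (Over.mk (𝟙 S)))))

lemma ptsLeft_one {R : Type u} [CommRing R] (σ : Spec (.of R) ⟶ S) (C : Type u) [CommRing C]
    [Algebra R C] : ptsLeft σ (1 : Pts σ (yonedaGrpObj G) C) =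
      (specOver σ C).hom ≫ unitSection G := by
  let k : specOver σ C ⟶ Over.mk (𝟙 S) := Over.homMk (specOver σ C).hom (Category.comp_id _)
  have h := map_one ((yonedaGrpObj G).map k.op).hom
  exact congrArg CommaMorphism.left h.symm

/-- A smooth group scheme has charts around the unit section. -/
lemma exists_unitChart [Smooth G.hom] (s : S) : ∃ W : S.Opens, s ∈ W ∧
    ∀ (R : Type u) [CommRing R] (σ : Spec (.of R) ⟶ S) [IsOpenImmersion σ], Set.range σ ⊆ W →
      ∃ (A : Type u) (_ : CommRing A) (_ : Algebra R A), Algebra.IsStandardSmooth R A ∧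
        Nonempty (UnitChart G σ A) := by
  obtain ⟨R₀, A₀, _, _, _, c, hs, -, hA⟩ :=
    exists_standardSmooth_chart G (unitSection G s) ⊤ trivial
  have := c.isOpenImmersion_map
  have := c.isOpenImmersion_base
  -- Over this open the unit section stays inside the chart `c` of `G`.
  refine ⟨unitSection G ⁻¹ᵁ c.map.opensRange, hs, fun R _ σ _ hσ => ?_⟩
  have hr : Set.range (σ ≫ unitSection G) ⊆ Set.range c.map := by
    rintro _ ⟨q, rfl⟩
    rw [Scheme.Hom.comp_apply]
    exact hσ ⟨q, rfl⟩
  obtain ⟨ν, hν⟩ := Spec.map_surjective (IsOpenImmersion.lift c.map _ hr)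
  have hν : Spec.map ν ≫ c.map = σ ≫ unitSection G := by rw [hν, IsOpenImmersion.lift_fac]
  let ρ : CommRingCat.of R₀ ⟶ CommRingCat.of R := CommRingCat.ofHom (algebraMap R₀ A₀) ≫ ν
  have hρ : Spec.map ρ ≫ c.base = σ := by
    rw [Spec.map_comp, Category.assoc, ← c.comp_hom, ← Category.assoc, hν, Category.assoc,
      unitSection_hom, Category.comp_id]
  have : IsOpenImmersion (Spec.map ρ) := by
    have : IsOpenImmersion (Spec.map ρ ≫ c.base) := by rwa [hρ]
    exact IsOpenImmersion.of_comp _ c.base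
  let _ : Algebra R₀ R := ρ.hom.toAlgebra
  let ν' : A₀ →ₐ[R₀] R := ⟨ν.hom, fun _ => rfl⟩
  -- The new chart is the base change of `c` along the open immersion `Spec R ⟶ Spec R₀`, so it
  -- remains open and standard smooth; the unit section factors through it by the universal property
  -- of the tensor product.
  let i : A₀ →+* R ⊗[R₀] A₀ := (Algebra.TensorProduct.includeRight : A₀ →ₐ[R₀] R ⊗[R₀] A₀).toRingHom
  let j : R →+* R ⊗[R₀] A₀ := algebraMap R (R ⊗[R₀] A₀)
  have hP : IsPullback (Spec.map (CommRingCat.ofHom j)) (Spec.map (CommRingCat.ofHom i))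
      (Spec.map ρ) (Spec.map (CommRingCat.ofHom (algebraMap R₀ A₀))) :=
    isPullback_SpecMap_of_isPushout _ _ _ _ (CommRingCat.isPushout_tensorProduct R₀ R A₀)
  have hi : IsOpenImmersion (Spec.map (CommRingCat.ofHom i)) :=
    MorphismProperty.of_isPullback hP.flip.flip ‹IsOpenImmersion (Spec.map ρ)›
  let η : R ⊗[R₀] A₀ →ₐ[R] R := Algebra.TensorProduct.lift (AlgHom.id R R) ν' fun _ _ => .all _ _
  refine ⟨R ⊗[R₀] A₀, inferInstance, inferInstance, inferInstance,
    ⟨Spec.map (CommRingCat.ofHom i) ≫ c.map, inferInstance, inferInstance, ?_, η, ?_⟩⟩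
  · rw [Category.assoc, c.comp_hom, ← Category.assoc, ← hP.w, Category.assoc, hρ]
  · have h : CommRingCat.ofHom i ≫ CommRingCat.ofHom η.toRingHom = ν := by
      ext a
      exact (Algebra.TensorProduct.lift_tmul (AlgHom.id R R) ν' (fun _ _ => .all _ _) 1 a).trans
        (one_mul (ν' a))
    rw [← Category.assoc, ← Spec.map_comp, h, hν, ptsLeft_one]
    refine congrArg (· ≫ unitSection G) ?_
    exact ((congrArg (· ≫ σ) (Spec.map_id _)).trans (Category.id_comp σ)).symm

/-- Both charts must have the same base `Spec R`. The neighbourhood for the unit section is fixed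
before the chart of `X`, and the unit chart is then cut down to the base of that chart. -/
lemma exists_chart (X : Over S) [Smooth X.hom] [Smooth G.hom] (p : X.left) :
    ∃ (R B A : Type u) (_ : CommRing R) (_ : CommRing B) (_ : CommRing A) (_ : Algebra R B)
      (_ : Algebra R A) (c : AffineChart X R B), p ∈ Set.range c.map ∧
        Algebra.IsStandardSmooth R B ∧ Algebra.IsStandardSmooth R A ∧
        Nonempty (UnitChart G c.base A) := by
  obtain ⟨W, hW, H⟩ := exists_unitChart G (X.hom p)
  obtain ⟨R, B, _, _, _, c, hp, hc, hB⟩ := exists_standardSmooth_chart X p W hW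
  have := c.isOpenImmersion_base
  obtain ⟨A, _, _, hA, hU⟩ := H R c.base hc
  exact ⟨R, B, A, _, _, _, _, _, c, hp, hB, hA, hU⟩

end SmoothCharts

/-! ### Existence and uniqueness of the representing forms on a standard smooth chart. -/

section Main

variable {S : Scheme.{u}} {X G : Over S} [GrpObj G] {R B A : Type u} [CommRing R] [CommRing B]
  [CommRing A] [Algebra R B] [Algebra R A] (c : AffineChart X R B) [Algebra.IsStandardSmooth R B]
  [Algebra.IsStandardSmooth R A]

/-- Combinatorial `2`-forms are classical `2`-forms with values in `Lie(G)(R)`. -/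
lemma AffineChart.existsUnique_represents_two (U : UnitChart G c.base A)
    {φ : Cochain (yonedaGrpObj G) X 2} (hφ : IsForm φ) :
    ∃! w : LieForms R B c.base (yonedaGrpObj G) 2, c.Represents (toOn w) φ := by
  obtain ⟨v, hv⟩ := c.exists_represents_two U hφ
  have hb := U.toOn_bijective (B := B) (Module.Free.chooseBasis A Ω[A⁄R]) 2
  obtain ⟨w, rfl⟩ := hb.2 v
  exact ⟨w, hv, fun w' hw' => hb.1 (c.represents_unique U hw' hv)⟩

/-- The combinatorial differential is a classical form. -/
lemma AffineChart.existsUnique_represents_delta2 [Flat G.hom] (U : UnitChart G c.base A)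
    {φ : Cochain (yonedaGrpObj G) X 2} (hφ : IsForm φ)
    {χ : Cochain (autPresheaf (yonedaGrpObj G)) X 1} (hχ : IsForm χ) :
    ∃! v : LieFormsOn R B c.base (yonedaGrpObj G) 3, c.Represents v (delta2 χ φ) := by
  obtain ⟨w, hw, -⟩ := c.existsUnique_represents_two U hφ
  obtain ⟨t, ht, -⟩ := c.existsUnique_represents_one hχ
  -- The formula produces the 3-form, so no universal tetrahedron is needed for existence, and it is
  -- not yet used that `delta2 χ φ` is a combinatorial form.
  have h := c.represents_delta2 w t hw ht
  exact ⟨_, h, fun v hv => c.represents_unique U hv h⟩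

end Main

end CombForms

end

open CombForms in
theorem theorem3p7 {S : Scheme.{u}} (X G : Over S) [GrpObj G] [Smooth X.hom] [Smooth G.hom]
    (φ : Cochain (yonedaGrpObj G) X 2) (hφ : IsForm φ)
    (χ : Cochain (autPresheaf (yonedaGrpObj G)) X 1) (hχ : IsForm χ) :
    IsForm (delta2 χ φ) ∧
    (∀ p : X.left, ∃ (R B : Type u) (_ : CommRing R) (_ : CommRing B) (_ : Algebra R B)
      (c : AffineChart X R B), p ∈ Set.range c.map ∧
      (∃! w : LieForms R B c.base (yonedaGrpObj G) 2, c.Represents (toOn w) φ) ∧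
      (∃! t : LieFormsOn R B c.base (autPresheaf (yonedaGrpObj G)) 1, c.Represents t χ) ∧
      (∃! v : LieFormsOn R B c.base (yonedaGrpObj G) 3, c.Represents v (delta2 χ φ))) ∧
    (∀ (R B : Type u) [CommRing R] [CommRing B] [Algebra R B] (c : AffineChart X R B)
      (w : LieForms R B c.base (yonedaGrpObj G) 2)
      (t : LieFormsOn R B c.base (autPresheaf (yonedaGrpObj G)) 1),
      c.Represents (toOn w) φ → c.Represents t χ →
      c.Represents (toOn (dLie w) + bracketForms 1 2 3 rfl t (toOn w)) (delta2 χ φ)) := by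
  -- Not circular: the local forms for `delta2 χ φ` come from those of `φ` and `χ`, and its
  -- degeneracy is deduced from them.
  refine ⟨isForm_of_represents (delta2_natural hφ hχ) fun p => ?_, fun p => ?_,
    fun R B _ _ _ c w t hw ht => c.represents_delta2 w t hw ht⟩
  · obtain ⟨R, B, A, _, _, _, _, _, c, hp, _, _, ⟨U⟩⟩ := exists_chart G X p
    obtain ⟨v, hv, -⟩ := c.existsUnique_represents_delta2 U hφ hχ
    exact ⟨R, B, _, _, _, c, v, hp, hv⟩
  · obtain ⟨R, B, A, _, _, _, _, _, c, hp, _, _, ⟨U⟩⟩ := exists_chart G X p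
    exact ⟨R, B, _, _, _, c, hp, c.existsUnique_represents_two U hφ,
      c.existsUnique_represents_one hχ, c.existsUnique_represents_delta2 U hφ hχ⟩
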